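/- Let $n\ge 0$ and $0<q<1$, and let $A=C(\mathbb{S}_q^{2n+1})$ be the C*-algebra of the Vaksman–Soibelman quantum sphere, i.e. the universal unital C*-algebra generated by $z_0,\dots,z_n$ with the relations $$z_jz_i=q\,z_iz_j\ (i<j),\qquad z_i^*z_j=q\,z_jz_i^*\ (i\neq j),\qquad z_i^*z_i=z_iz_i^*+(1-q^2)\sum_{j>i}z_jz_j^*,\qquad \sum_{i=0}^n z_iz_i^*=1 .$$ A projection over $A$ is a self-adjoint idempotent $P\in M_\infty(A)=\bigcup_a M_a(A)$; two projections $P,Q$ are equivalent, $P\sim Q$, if $UPU^{-1}=Q$ for some $U\in GL_\infty(A)$; $\boxplus$ denotes the diagonal sum. Let $\eta:A\to C(\mathbb{T})$ be the *-homomorphism with $\eta(z_0)=\mathrm{id}_{\mathbb{T}}$ and $\eta(z_i)=0$ for $i>0$; the rank of $P$ is the rank of the vector bundle over $\mathbb{T}$ determined by $\eta(P)$. Write $P_{0,k}=\boxplus^k 1_A$ for the trivial projection of rank $k$. Then: 1. Every projection $P$ over $A$ of rank $k>0$ is trivial: $P\sim P_{0,k}$. 2. Cancellation holds in positive rank: if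 $P,Q,R$ are projections over $A$, $P$ and $Q$ have rank $\ge 1$, and $P\boxplus R\sim Q\boxplus R$, then $P\sim Q$. 3. If $n>0$, cancellation fails in rank $0$: there are projections $P,Q,R$ over $A$ with $P,Q$ of rank $0$, $P\boxplus R\sim Q\boxplus R$ and $P\not\sim Q$. 4. More precisely, let $\pi$ be the standard representation of $A$ on $\ell^2(\mathbb{Z})\otimes\ell^2(\mathbb{Z}_{\ge0})^{\otimes n}$ with $\pi(z_i)=t\otimes\gamma^{\otimes i}\otimes\alpha^*\otimes 1^{\otimes(n-1-i)}$ for $i<n$ and $\pi(z_n)=t\otimes\gamma^{\otimes n}$, where $t$ is the bilateral shift, $\gamma e_k=q^ke_k$ and $\alpha^*e_k=\sqrt{1-q^{2(k+1)}}\,e_{k+1}$. For $1\le j\le n$ and $k>0$ there are projections $P_{j,k}\in A$ with $\pi(P_{j,k})=1\otimes P_1^{\otimes(j-1)}\otimes P_k\otimes 1^{\otimes(n-j)}$, where $P_k$ is the orthogonal projection onto the span of $e_0,\dots,e_{k-1}$, such that every $P_{j,k}$ has rank $0$, $P_{j,k}\boxplus P_{0,1}\sim P_{0,1}$, and $P_{j,k}\not\sim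 P_{j',k'}$ whenever $(j,k)\neq(j',k')$. -/

import Mathlib

open scoped ENNReal

noncomputable section

namespace QSphere

/-! ### Projections over a C⋆-algebra, their diagonal sum and their equivalence -/

section Projections

variable {A : Type*} [CStarAlgebra A]

/-- The image of an `a × a` matrix in the `N × N` matrices (`a ≤ N`), with zeros outside the upper
left corner. The algebra `M_∞(A)` of all finite matrices over `A` is the union of the `M_a(A)`
along these maps. -/
def pad {a : ℕ} (N : ℕ) (P : Matrix (Fin a) (Fin a) A) : Matrix (Fin N) (Fin N) A :=
  fun i j => if h : i.1 < a ∧ j.1 < a then P ⟨i.1, h.1⟩ ⟨j.1, h.2⟩ else 0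

/-- Equivalence of two finite matrices `P`, `Q` over `A`: conjugacy `U P U⁻¹ = Q` by some
`U ∈ GL_∞(A) = ⋃ GL_N(A)`. -/
def Equivalent {a b : ℕ} (P : Matrix (Fin a) (Fin a) A) (Q : Matrix (Fin b) (Fin b) A) : Prop :=
  ∃ N : ℕ, a ≤ N ∧ b ≤ N ∧ ∃ U : (Matrix (Fin N) (Fin N) A)ˣ,
    (U : Matrix (Fin N) (Fin N) A) * pad N P * ((U⁻¹ : (Matrix (Fin N) (Fin N) A)ˣ) :
      Matrix (Fin N) (Fin N) A) = pad N Q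

/-- The diagonal sum of two finite matrices over `A`. -/
def diagSum {a b : ℕ} (P : Matrix (Fin a) (Fin a) A) (Q : Matrix (Fin b) (Fin b) A) :
    Matrix (Fin (a + b)) (Fin (a + b)) A :=
  Matrix.reindex finSumFinEquiv finSumFinEquiv (Matrix.fromBlocks P 0 0 Q)

end Projections

/-- The diagonal sum. -/
scoped infixl:65 " ⊞ " => diagSum

/-! ### The C⋆-algebra of the quantum sphere -/

/-- The defining relations of the standard generators `z 0, …, z n` of the Vaksman-Soibelman
quantum sphere of dimension `2 n + 1`. (In terms of the last row of the fundamental matrix of the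
quantum group `SU_q(n+1)`, `z i` is the entry `u_{n+1, n+1-i}`.) -/
structure Relations {B : Type*} [CStarAlgebra B] {n : ℕ} (q : ℝ) (z : Fin (n + 1) → B) :
    Prop where
  mul_comm : ∀ i j, i < j → z j * z i = (q : ℂ) • (z i * z j)
  star_mul_comm : ∀ i j, i ≠ j → star (z i) * z j = (q : ℂ) • (z j * star (z i))
  star_mul_self : ∀ i, star (z i) * z i =
    z i * star (z i) + ((1 - q ^ 2 : ℝ) : ℂ) • ∑ j ∈ Finset.Ioi i, z j * star (z j)
  sum_eq_one : ∑ i, z i * star (z i) = 1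

/-- A realization of the relations in some (nonzero, unital) C⋆-algebra. Carriers in `Type` are
enough: the C⋆-algebra generated by finitely many elements has at most the cardinality of the
continuum. -/
structure Realization (n : ℕ) (q : ℝ) : Type 1 where
  carrier : Type
  [cstar : CStarAlgebra carrier]
  [nontrivial : Nontrivial carrier]
  z : Fin (n + 1) → carrier
  rel : Relations q z

attribute [instance] Realization.cstar Realization.nontrivial

theorem Relations.norm_le_one {B : Type*} [CStarAlgebra B] {n : ℕ} {q : ℝ}
    {z : Fin (n + 1) → B} (h : Relations q z) (i : Fin (n + 1)) : ‖z i‖ ≤ 1 := by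
  let _ : PartialOrder B := CStarAlgebra.spectralOrder B
  have _ : StarOrderedRing B := CStarAlgebra.spectralOrderedRing B
  have h1 : z i * star (z i) ≤ 1 := by
    rw [← h.sum_eq_one]
    exact Finset.single_le_sum (f := fun i => z i * star (z i))
      (fun j _ => mul_star_self_nonneg (z j)) (Finset.mem_univ i)
  have h2 : ‖z i * star (z i)‖ ≤ 1 :=
    (CStarAlgebra.norm_le_one_iff_of_nonneg _ (mul_star_self_nonneg (z i))).2 h1
  rw [CStarRing.norm_self_mul_star] at h2
  nlinarith [norm_nonneg (z i)]

/-- The bounded product of all realizations of the relations. -/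
abbrev BigProduct (n : ℕ) (q : ℝ) : Type 1 :=
  lp (fun T : Realization n q => T.carrier) ∞

instance (n : ℕ) (q : ℝ) : CStarAlgebra (BigProduct n q) where
  norm_mul_self_le x := CStarRing.norm_star_mul_self (x := x) |>.symm.le

/-- The generators, realized simultaneously in all realizations of the relations. -/
def bigGen (n : ℕ) (q : ℝ) (i : Fin (n + 1)) : BigProduct n q :=
  ⟨fun T => T.z i, memℓp_infty ⟨1, by rintro _ ⟨T, rfl⟩; exact T.rel.norm_le_one i⟩⟩

/-- The C⋆-algebra of continuous functions on the quantum sphere of dimension `2 n + 1`, i.e. the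
universal C⋆-algebra on generators `z 0, …, z n` with the relations `Relations q z`: the closed
unital ⋆-subalgebra generated by the family of all realizations of the generators, so that
`‖p(z, z⋆)‖` is the supremum of the norms of `p(z, z⋆)` over all realizations. -/
def sphereSubalgebra (n : ℕ) (q : ℝ) : StarSubalgebra ℂ (BigProduct n q) :=
  (StarAlgebra.adjoin ℂ (Set.range (bigGen n q))).topologicalClosure

/-- The C⋆-algebra of continuous functions on the quantum sphere, as a type. -/
abbrev SphereAlgebra (n : ℕ) (q : ℝ) : Type 1 := sphereSubalgebra n q

instance (n : ℕ) (q : ℝ) : IsClosed (sphereSubalgebra n q : Set (BigProduct n q)) :=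
  StarSubalgebra.isClosed_topologicalClosure _

/-- The standard generators of the algebra of the quantum sphere. -/
def gen (n : ℕ) (q : ℝ) (i : Fin (n + 1)) : SphereAlgebra n q :=
  ⟨bigGen n q i, StarSubalgebra.le_topologicalClosure _
    (StarAlgebra.subset_adjoin ℂ _ (Set.mem_range_self i))⟩

/-- The universal property: evaluation at one realization of the relations. -/
def evalAt {n : ℕ} {q : ℝ} (T : Realization n q) : SphereAlgebra n q →⋆ₐ[ℂ] T.carrier where
  toFun x := (x : BigProduct n q) T
  map_one' := rfl
  map_mul' _ _ := rfl
  map_zero' := rfl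
  map_add' _ _ := rfl
  commutes' _ := rfl
  map_star' _ := rfl

theorem evalAt_gen {n : ℕ} {q : ℝ} (T : Realization n q) (i : Fin (n + 1)) :
    evalAt T (gen n q i) = T.z i := rfl

theorem ext_evalAt {n : ℕ} {q : ℝ} {x y : SphereAlgebra n q}
    (h : ∀ T : Realization n q, evalAt T x = evalAt T y) : x = y :=
  Subtype.ext (Subtype.ext (funext h))

/-- The generators satisfy the relations. -/
theorem gen_relations (n : ℕ) (q : ℝ) : Relations q (gen n q) where
  mul_comm i j hij := ext_evalAt fun T => by
    simpa only [map_mul, map_smul, evalAt_gen] using T.rel.mul_comm i j hij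
  star_mul_comm i j hij := ext_evalAt fun T => by
    simpa only [map_mul, map_smul, map_star, evalAt_gen] using T.rel.star_mul_comm i j hij
  star_mul_self i := ext_evalAt fun T => by
    simpa only [map_mul, map_smul, map_star, map_add, map_sum, evalAt_gen] using
      T.rel.star_mul_self i
  sum_eq_one := ext_evalAt fun T => by
    simpa only [map_mul, map_star, map_sum, map_one, evalAt_gen] using T.rel.sum_eq_one

/-! ### The rank of a projection -/

/-- The realization of the relations in `C(𝕋)` with `z 0` the coordinate function of the circle
and `z i = 0` for `i > 0`. -/
def circleRealization (n : ℕ) (q : ℝ) : Realization n q where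
  carrier := C(Circle, ℂ)
  z i := if i = 0 then ⟨fun t => (t : ℂ), by fun_prop⟩ else 0
  rel :=
    { mul_comm := by
        intro i j hij
        have hj : j ≠ 0 := (lt_of_le_of_lt (Fin.zero_le i) hij).ne'
        simp [hj]
      star_mul_comm := by
        intro i j hij
        by_cases hi : i = 0
        · have hj : j ≠ 0 := fun h => hij (hi.trans h.symm)
          simp [hj]
        · simp [hi]
      star_mul_self := by
        intro i
        have h0 : ∑ j ∈ Finset.Ioi i, ((if j = 0 then (⟨fun t => (t : ℂ), by fun_prop⟩ :
            C(Circle, ℂ)) else 0) * star (if j = 0 then (⟨fun t => (t : ℂ), by fun_prop⟩ :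
            C(Circle, ℂ)) else 0)) = 0 := by
          refine Finset.sum_eq_zero fun j hj => ?_
          have hj0 : j ≠ 0 := (lt_of_le_of_lt (Fin.zero_le i) (Finset.mem_Ioi.1 hj)).ne'
          simp [hj0]
        rw [h0, smul_zero, add_zero, mul_comm]
      sum_eq_one := by
        rw [Finset.sum_eq_single 0 (fun j _ hj => by simp [hj]) (by simp)]
        ext t
        simp only [if_true, ContinuousMap.mul_apply, ContinuousMap.star_apply,
          ContinuousMap.one_apply]
        change (t : ℂ) * (starRingEnd ℂ) (t : ℂ) = 1
        rw [Complex.mul_conj, Circle.normSq_coe, Complex.ofReal_one] }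

/-- The quotient map onto the continuous functions on the circle: `z 0` goes to the coordinate
function and `z i` to `0` for `i > 0`. -/
def eta (n : ℕ) (q : ℝ) : SphereAlgebra n q →⋆ₐ[ℂ] C(Circle, ℂ) :=
  evalAt (circleRealization n q)

/-- The complex matrix `η(P)(t)`; its range is the fibre at `t` of the vector bundle over the
circle determined by `η(P)`. -/
def fibreMatrix {n : ℕ} {q : ℝ} {a : ℕ} (P : Matrix (Fin a) (Fin a) (SphereAlgebra n q))
    (t : Circle) : Matrix (Fin a) (Fin a) ℂ :=
  P.map fun x => eta n q x t

/-- The rank of a projection `P`: the rank of the vector bundle over the circle determined by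
`η(P)`, read off at the point `1` (see `rank_eq` for the independence of the point). -/
def rank {n : ℕ} {q : ℝ} {a : ℕ} (P : Matrix (Fin a) (Fin a) (SphereAlgebra n q)) : ℕ :=
  (fibreMatrix P 1).rank

theorem rank_eq {n : ℕ} {q : ℝ} {a : ℕ} (P : Matrix (Fin a) (Fin a) (SphereAlgebra n q))
    (hP : IsStarProjection P) (t : Circle) : (fibreMatrix P t).rank = rank P := by
  have hidem : ∀ t, IsIdempotentElem (fibreMatrix P t) := fun t => by
    have h := congrArg (fun M => fibreMatrix M t) hP.isIdempotentElem.eq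
    ext i j
    have h' := congrFun (congrFun h i) j
    simpa [fibreMatrix, Matrix.mul_apply, map_sum] using h'
  have htr : ∀ t, (fibreMatrix P t).trace = ((fibreMatrix P t).rank : ℂ) := fun t => by
    have h1 : IsIdempotentElem (Matrix.toLin' (fibreMatrix P t)) := by
      have := congrArg Matrix.toLin' (hidem t).eq
      rwa [Matrix.toLin'_mul] at this
    have h2 := (LinearMap.IsIdempotentElem.isProj_range _ h1).trace
    rw [Matrix.trace_toLin'_eq] at h2
    exact h2
  have hcont : Continuous fun t => (fibreMatrix P t).trace := by
    unfold fibreMatrix Matrix.trace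
    simp only [Matrix.diag_apply, Matrix.map_apply]
    fun_prop
  have hcontN : Continuous fun t => (fibreMatrix P t).rank := by
    rw [Nat.isClosedEmbedding_coe_real.isInducing.continuous_iff]
    exact (Complex.continuous_re.comp hcont).congr fun t => by simp [htr t]
  exact PreconnectedSpace.constant inferInstance hcontN

/-! ### The standard representation and the basic projections -/

/-- The Hilbert space `ℓ²(ℤ × ℕⁿ) = ℓ²(ℤ) ⊗ ℓ²(ℕ)^{⊗ n}`. -/
abbrev Hilb (n : ℕ) : Type := lp (fun _ : ℤ × (Fin n → ℕ) => ℂ) 2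

/-- The standard orthonormal basis vectors. -/
def basisVec {n : ℕ} (m : ℤ) (w : Fin n → ℕ) : Hilb n := lp.single 2 (m, w) (1 : ℂ)

/-- `π` is the standard representation, with (tensor factors `ℓ²(ℤ)` first)
`z i ↦ t ⊗ γ^{⊗ i} ⊗ α⋆ ⊗ 1^{⊗ (n-1-i)}` for `i < n` and `z n ↦ t ⊗ γ^{⊗ n}`. Here `t` is the
bilateral shift, `γ e_k = q^k e_k` and `α⋆ e_k = √(1 - q^{2(k+1)}) e_{k+1}`. -/
structure IsStandardRep {n : ℕ} {q : ℝ} (π : SphereAlgebra n q →⋆ₐ[ℂ] (Hilb n →L[ℂ] Hilb n)) :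
    Prop where
  gen_castSucc : ∀ (i : Fin n) (m : ℤ) (w : Fin n → ℕ),
    π (gen n q i.castSucc) (basisVec m w) =
      (((∏ s ∈ Finset.Iio i, q ^ w s) * √(1 - q ^ (2 * (w i + 1))) : ℝ) : ℂ) •
        basisVec (m + 1) (w + Pi.single i 1)
  gen_last : ∀ (m : ℤ) (w : Fin n → ℕ),
    π (gen n q (Fin.last n)) (basisVec m w) =
      ((∏ s, q ^ w s : ℝ) : ℂ) • basisVec (m + 1) w

open Classical in
/-- `T` is the operator `1 ⊗ P_1^{⊗ (j-1)} ⊗ P_k ⊗ I^{⊗ (n-j)}` (for `1 ≤ j ≤ n`), where `P_k` is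
the orthogonal projection of `ℓ²(ℕ)` onto the span of `e_0, …, e_{k-1}`. -/
def IsBasicOperator {n : ℕ} (j k : ℕ) (T : Hilb n →L[ℂ] Hilb n) : Prop :=
  ∀ (m : ℤ) (w : Fin n → ℕ), T (basisVec m w) =
    if ∀ s : Fin n, (s.1 + 1 < j → w s < 1) ∧ (s.1 + 1 = j → w s < k) then basisVec m w else 0

end QSphere

end

open QSphere

open scoped ENNReal

noncomputable section

namespace QSphere

open Filter Topology

/-! ### Algebraic equivalence of idempotent matrices -/

section IdemEquiv

variable {A : Type*} [Ring A]
variable {ι κ μ ι' κ' : Type*}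

/-! Conjugacy of idempotents in `GL_∞` amounts to the existence of `X`, `Y` with `Y X = P` and `X Y
= Q` (`Equivalent.idemEquiv`, `IdemEquiv.equivalent`). Self-adjointness plays no role in this, so
the work is done with idempotents, over corners `p A p`.

The algebra is taken apart one generator at a time. Let `y₀, …, y_m` generate `p A p` and satisfy
the sphere relations there. The defect `d = p - y₀ y₀*` satisfies `d y₀ = q² y₀ d`, so its powers
converge in norm to a projection `p'` with `y₀* p' = 0`. The other generators commute with `d`; cut
down by `p'`, they satisfy the same relations and generate `p' A p'` (`CornerRelations.next`,
`CornerRelations.generates_next`). The element `v = y₀ (1 - q² d)^(-1/2)` is an isometry of the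
corner with `p - v v* = p'`. Iteration gives a tower `1 = p_0 ≥ p_1 ≥ … ≥ p_(n+1) = 0`
(`towerProj`).

For `J ≤ n` the corner of `p_J` has a symbol `η` onto `C(𝕋)`, which sends the first generator to the
coordinate and the others to zero, and every `x` in its kernel satisfies `v^k p v*^k x → 0`
(`symbol_surjective_and_ker`). Idempotents over `C(𝕋)` are trivial (`exists_trivialization`).
Suppose that `η(P)` is trivial of rank `k > 0`. Lifting the trivialization and compressing it by
`v^m p v*^m` for large `m` yields a subidempotent of `P` equivalent to `k` copies of `p`. The rest
of `P` has symbol zero and is equivalent to an idempotent `Q` over the corner of `p'`. Since `v` is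
an isometry, `p ⊕ p' ∼ p`; so `P ∼ p^k ⊕ Q ∼ p^k ⊕ p' ⊕ Q`. By induction along the tower `p' ⊕ Q` is
a multiple of `p'`, which `p^k` swallows, and `P ∼ p^k` (`idemEquiv_constDiag_of_map`, with
induction hypothesis `Absorbing`). At the bottom of the tower this is the triviality in positive
rank, and cancellation follows from additivity of the rank.

In rank zero, `basicProj n q j k` is equivalent to `k` copies of `p_j` and is swallowed by the unit.
The symbol of the corner of `p_j` shows that `k` is determined by the class. If `j' < j`, then
`p_j'` swallows `p_j`, so `k p_j ∼ k' p_j'` would give `(k + 1) p_j ∼ k p_j`. The symbols along the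
tower are vacuum expectations in weighted shift representations, spread over the circle by the gauge
action (`isSymbol_of_vacuum`). -/

/-- Block diagonal sum, indexed by the sum type. -/
abbrev blockSum (P : Matrix ι ι A) (Q : Matrix κ κ A) : Matrix (ι ⊕ κ) (ι ⊕ κ) A :=
  Matrix.fromBlocks P 0 0 Q

/-- The diagonal matrix with the constant entry `p`. -/
abbrev constDiag (ι : Type*) [DecidableEq ι] (p : A) : Matrix ι ι A :=
  Matrix.diagonal fun _ => p

theorem blockSum_submatrix_comm (P : Matrix ι ι A) (Q : Matrix κ κ A) :
    (blockSum P Q).submatrix (Equiv.sumComm κ ι) (Equiv.sumComm κ ι) = blockSum Q P := by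
  ext (i | i) (j | j) <;> rfl

theorem blockSum_submatrix_assoc (P : Matrix ι ι A) (Q : Matrix κ κ A) (R : Matrix μ μ A) :
    (blockSum (blockSum P Q) R).submatrix (Equiv.sumAssoc ι κ μ).symm
      (Equiv.sumAssoc ι κ μ).symm = blockSum P (blockSum Q R) := by
  ext (i | i | i) (j | j | j) <;> rfl

variable [Fintype ι] [Fintype κ] [Fintype μ] [Fintype ι'] [Fintype κ']

/-- Algebraic (Murray-von Neumann) equivalence of square matrices, possibly of different sizes. -/
def IdemEquiv (P : Matrix ι ι A) (Q : Matrix κ κ A) : Prop :=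
  ∃ (X : Matrix κ ι A) (Y : Matrix ι κ A), Y * X = P ∧ X * Y = Q

theorem IdemEquiv.refl {P : Matrix ι ι A} (hP : IsIdempotentElem P) : IdemEquiv P P :=
  ⟨P, P, hP, hP⟩

theorem IdemEquiv.symm {P : Matrix ι ι A} {Q : Matrix κ κ A} (h : IdemEquiv P Q) :
    IdemEquiv Q P := by
  obtain ⟨X, Y, h₁, h₂⟩ := h
  exact ⟨Y, X, h₂, h₁⟩

theorem IdemEquiv.trans {P : Matrix ι ι A} {Q : Matrix κ κ A} {R : Matrix μ μ A}
    (h : IdemEquiv P Q) (h' : IdemEquiv Q R) (hP : IsIdempotentElem P)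
    (hR : IsIdempotentElem R) : IdemEquiv P R := by
  obtain ⟨X, Y, h₁, h₂⟩ := h
  obtain ⟨X', Y', h₃, h₄⟩ := h'
  refine ⟨X' * X, Y * Y', ?_, ?_⟩
  -- The middle factor `Y' X' = Q = X Y` produces `(Y X)²`, so idempotency is needed only for the
  -- two outer matrices.
  · calc Y * Y' * (X' * X) = Y * (Y' * X') * X := by simp only [Matrix.mul_assoc]
      _ = (Y * X) * (Y * X) := by rw [h₃, ← h₂]; simp only [Matrix.mul_assoc]
      _ = P := by rw [h₁]; exact hP
  · calc X' * X * (Y * Y') = X' * (X * Y) * Y' := by simp only [Matrix.mul_assoc]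
      _ = (X' * Y') * (X' * Y') := by rw [h₂, ← h₃]; simp only [Matrix.mul_assoc]
      _ = R := by rw [h₄]; exact hR

theorem isIdempotentElem_blockSum {P : Matrix ι ι A} {Q : Matrix κ κ A}
    (hP : IsIdempotentElem P) (hQ : IsIdempotentElem Q) : IsIdempotentElem (blockSum P Q) := by
  unfold IsIdempotentElem at *
  simp [Matrix.fromBlocks_multiply, hP, hQ]

theorem isIdempotentElem_constDiag [DecidableEq ι] {p : A} (hp : IsIdempotentElem p) :
    IsIdempotentElem (constDiag ι p) := by
  unfold IsIdempotentElem at *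
  simp [hp]

theorem IdemEquiv.sum {P : Matrix ι ι A} {P' : Matrix ι' ι' A} {Q : Matrix κ κ A}
    {Q' : Matrix κ' κ' A} (h : IdemEquiv P P') (h' : IdemEquiv Q Q') :
    IdemEquiv (blockSum P Q) (blockSum P' Q') := by
  obtain ⟨X, Y, h₁, h₂⟩ := h
  obtain ⟨X', Y', h₃, h₄⟩ := h'
  refine ⟨Matrix.fromBlocks X 0 0 X', Matrix.fromBlocks Y 0 0 Y', ?_, ?_⟩ <;>
    simp [Matrix.fromBlocks_multiply, h₁, h₂, h₃, h₄]

theorem IdemEquiv.submatrix {P : Matrix ι ι A} (hP : IsIdempotentElem P) (e : κ ≃ ι) :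
    IdemEquiv P (P.submatrix e e) := by
  refine ⟨P.submatrix e id, P.submatrix id e, ?_, ?_⟩
  · rw [Matrix.submatrix_mul_equiv, hP]; rfl
  · have := Matrix.submatrix_mul P P e id e Function.bijective_id
    rw [← this, hP]

/-- Two orthogonal idempotents: their sum is equivalent to their block sum. -/
theorem IdemEquiv.of_orthogonal {P Q : Matrix ι ι A} (hP : IsIdempotentElem P)
    (hQ : IsIdempotentElem Q) (hPQ : P * Q = 0) (hQP : Q * P = 0) :
    IdemEquiv (P + Q) (blockSum P Q) := by
  refine ⟨Matrix.fromRows P Q, Matrix.fromCols P Q, ?_, ?_⟩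
  · rw [Matrix.fromCols_mul_fromRows, hP, hQ]
  · rw [Matrix.fromRows_mul_fromCols, hP, hQ, hPQ, hQP]

theorem IdemEquiv.map {B : Type*} [Ring B] {P : Matrix ι ι A} {Q : Matrix κ κ A}
    (h : IdemEquiv P Q) (f : A →+* B) : IdemEquiv (P.map f) (Q.map f) := by
  obtain ⟨X, Y, h₁, h₂⟩ := h
  exact ⟨X.map f, Y.map f, by rw [← Matrix.map_mul, h₁], by rw [← Matrix.map_mul, h₂]⟩

theorem IdemEquiv.sum_comm {P : Matrix ι ι A} {Q : Matrix κ κ A} (hP : IsIdempotentElem P)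
    (hQ : IsIdempotentElem Q) : IdemEquiv (blockSum P Q) (blockSum Q P) := by
  rw [← blockSum_submatrix_comm P Q]
  exact .submatrix (isIdempotentElem_blockSum hP hQ) _

theorem IdemEquiv.sum_assoc {P : Matrix ι ι A} {Q : Matrix κ κ A} {R : Matrix μ μ A}
    (hP : IsIdempotentElem P) (hQ : IsIdempotentElem Q) (hR : IsIdempotentElem R) :
    IdemEquiv (blockSum (blockSum P Q) R) (blockSum P (blockSum Q R)) := by
  rw [← blockSum_submatrix_assoc P Q R]
  exact .submatrix (isIdempotentElem_blockSum (isIdempotentElem_blockSum hP hQ) hR) _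

theorem IdemEquiv.constDiag_sum [DecidableEq ι] [DecidableEq κ] {p : A}
    (hp : IsIdempotentElem p) :
    IdemEquiv (constDiag (ι ⊕ κ) p) (blockSum (constDiag ι p) (constDiag κ p)) := by
  have : blockSum (constDiag ι p) (constDiag κ p) = constDiag (ι ⊕ κ) p := by
    simp [blockSum, Matrix.fromBlocks_diagonal]
  rw [this]
  exact .refl (isIdempotentElem_constDiag hp)

theorem IdemEquiv.constDiag_congr [DecidableEq ι] [DecidableEq κ] {p : A}
    (hp : IsIdempotentElem p) (e : κ ≃ ι) : IdemEquiv (constDiag ι p) (constDiag κ p) := by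
  have : (constDiag ι p).submatrix e e = constDiag κ p := by
    simp
  rw [← this]
  exact .submatrix (isIdempotentElem_constDiag hp) e

theorem IdemEquiv.sum_of_isEmpty [IsEmpty κ] {P : Matrix ι ι A} (hP : IsIdempotentElem P)
    (Q : Matrix κ κ A) : IdemEquiv (blockSum P Q) P := by
  refine ⟨Matrix.fromCols P 0, Matrix.fromRows P 0, ?_, ?_⟩
  · rw [Matrix.fromRows_mul_fromCols, hP.eq]
    ext (i | i) (j | j)
    · rfl
    · exact isEmptyElim j
    · exact isEmptyElim i
    · exact isEmptyElim j
  · rw [Matrix.fromCols_mul_fromRows, hP.eq]; simp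

/-- An idempotent `p` that is infinite, with complement `p - v w`, absorbs this complement. -/
theorem IdemEquiv.absorb {p v w : A} (hp : IsIdempotentElem p) (hwv : w * v = p)
    (hpv : p * v = v) (hvp : v * p = v) (hpw : p * w = w) (hwp : w * p = w) :
    IdemEquiv (blockSum (constDiag Unit p) (constDiag Unit (p - v * w)))
      (constDiag Unit p) := by
  have e1 : w * (p - v * w) = 0 := by rw [mul_sub, hwp, ← mul_assoc, hwv, hpw, sub_self]
  have e2 : (p - v * w) * v = 0 := by rw [sub_mul, hpv, mul_assoc, hwv, hvp, sub_self]
  have e3 : (p - v * w) * (p - v * w) = p - v * w := by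
    rw [sub_mul p, mul_assoc, e1, mul_zero, sub_zero, mul_sub, hp.eq, ← mul_assoc, hpv]
  -- The row `(v, p - v w)` carries `p ⊕ (p - v w)` onto `p`: `v` takes `p` to `v w`, and the
  -- complement stays where it is.
  refine ⟨Matrix.fromCols (constDiag Unit v) (constDiag Unit (p - v * w)),
    Matrix.fromRows (constDiag Unit w) (constDiag Unit (p - v * w)), ?_, ?_⟩
  · rw [Matrix.fromRows_mul_fromCols]
    simp [e1, e2, e3, hwv]
  · rw [Matrix.fromCols_mul_fromRows]
    simp [e3]

end IdemEquiv

/-! ### Conjugacy and algebraic equivalence -/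

section Equivalent

variable {A : Type*} [CStarAlgebra A]

/-- The inclusion of the first `a` coordinates into `N` coordinates. -/
def inclMatrix (A : Type*) [CStarAlgebra A] (N a : ℕ) : Matrix (Fin N) (Fin a) A :=
  fun i j => if i.1 = j.1 then 1 else 0

theorem inclMatrix_transpose_mul {N a : ℕ} (h : a ≤ N) :
    (inclMatrix A N a).transpose * inclMatrix A N a = 1 := by
  ext i j
  rw [Matrix.mul_apply, Finset.sum_eq_single (Fin.castLE h i)]
  · simp [inclMatrix, Matrix.one_apply, Fin.ext_iff]
  · intro b _ hb
    have : b.1 ≠ i.1 := fun h' => hb (Fin.ext h')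
    simp [inclMatrix, this]
  · simp

/-- The inclusion `J` satisfies `Jᵀ J = 1` when `a ≤ N`, so this form yields idempotency of the
padded matrix and its equivalence to `P` without looking at entries. -/
theorem pad_eq {N a : ℕ} (P : Matrix (Fin a) (Fin a) A) :
    pad N P = inclMatrix A N a * P * (inclMatrix A N a).transpose := by
  have h1 : ∀ i k, (inclMatrix A N a * P) i k = if h : i.1 < a then P ⟨i.1, h⟩ k else 0 := by
    intro i k
    rw [Matrix.mul_apply]
    split_ifs with h
    · rw [Finset.sum_eq_single ⟨i.1, h⟩]
      · simp [inclMatrix]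
      · intro b _ hb
        have : i.1 ≠ b.1 := fun h' => hb (Fin.ext h'.symm)
        simp [inclMatrix, this]
      · simp
    · refine Finset.sum_eq_zero fun b _ => ?_
      have : i.1 ≠ b.1 := fun h' => h (h' ▸ b.2)
      simp [inclMatrix, this]
  ext i j
  rw [Matrix.mul_apply]
  simp only [h1, Matrix.transpose_apply, pad]
  by_cases hj : j.1 < a
  · rw [Finset.sum_eq_single ⟨j.1, hj⟩]
    · by_cases hi : i.1 < a <;> simp [inclMatrix, hi, hj]
    · intro b _ hb
      have : j.1 ≠ b.1 := fun h' => hb (Fin.ext h'.symm)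
      simp [inclMatrix, this]
    · simp
  · rw [Finset.sum_eq_zero]
    · simp [hj]
    · intro b _
      have : j.1 ≠ b.1 := fun h' => hj (h' ▸ b.2)
      simp [inclMatrix, this]

theorem idemEquiv_pad {N a : ℕ} (h : a ≤ N) {P : Matrix (Fin a) (Fin a) A}
    (hP : IsIdempotentElem P) : IdemEquiv P (pad N P) := by
  refine ⟨inclMatrix A N a * P, P * (inclMatrix A N a).transpose, ?_, ?_⟩
  · rw [Matrix.mul_assoc, ← Matrix.mul_assoc _ _ P, inclMatrix_transpose_mul h, Matrix.one_mul,
      hP.eq]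
  · rw [pad_eq, Matrix.mul_assoc, ← Matrix.mul_assoc P, hP.eq, Matrix.mul_assoc]

theorem isIdempotentElem_pad {N a : ℕ} (h : a ≤ N) {P : Matrix (Fin a) (Fin a) A}
    (hP : IsIdempotentElem P) : IsIdempotentElem (pad N P) := by
  unfold IsIdempotentElem
  rw [pad_eq, Matrix.mul_assoc, Matrix.mul_assoc, Matrix.mul_assoc,
    ← Matrix.mul_assoc (Matrix.transpose _), inclMatrix_transpose_mul h, Matrix.one_mul,
    ← Matrix.mul_assoc P, hP.eq]

theorem pad_add {N M a : ℕ} (h : a ≤ N) (P : Matrix (Fin a) (Fin a) A) :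
    pad (N + M) P = Matrix.reindex finSumFinEquiv finSumFinEquiv
      (Matrix.fromBlocks (pad N P) 0 0 (0 : Matrix (Fin M) (Fin M) A)) := by
  ext i j
  refine Fin.addCases (fun i => ?_) (fun i => ?_) i <;>
    refine Fin.addCases (fun j => ?_) (fun j => ?_) j
  · simp [pad]
  · have : ¬ (N + j.1 < a) := by omega
    simp [pad, this]
  · have : ¬ (N + i.1 < a) := by omega
    simp [pad, this]
  · have : ¬ (N + i.1 < a) := by omega
    simp [pad, this]

theorem Equivalent.idemEquiv {a b : ℕ} {P : Matrix (Fin a) (Fin a) A}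
    {Q : Matrix (Fin b) (Fin b) A} (hP : IsIdempotentElem P) (hQ : IsIdempotentElem Q)
    (h : Equivalent P Q) : IdemEquiv P Q := by
  obtain ⟨N, ha, hb, U, hU⟩ := h
  have hP' := isIdempotentElem_pad ha hP
  have h1 : IdemEquiv (pad N P) (pad N Q) := by
    refine ⟨U.1 * pad N P, pad N P * (U⁻¹).1, ?_, ?_⟩
    · rw [mul_assoc, ← mul_assoc (U⁻¹).1, Units.inv_mul, one_mul, hP'.eq]
    · rw [mul_assoc, ← mul_assoc (pad N P), hP'.eq, ← mul_assoc, hU]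
  exact ((idemEquiv_pad ha hP).trans h1 hP (isIdempotentElem_pad hb hQ)).trans
    (idemEquiv_pad hb hQ).symm hP hQ

/-- Within one matrix size the complements of `P` and `Q` may be inequivalent, and then no
invertible matrix conjugates one into the other. Doubling the size helps: with `X`, `Y` on the
diagonal and the complements off it, the block matrix is invertible and takes `P ⊕ 0` to `Q ⊕ 0`. -/
theorem IdemEquiv.equivalent {a b : ℕ} {P : Matrix (Fin a) (Fin a) A}
    {Q : Matrix (Fin b) (Fin b) A} (hP : IsIdempotentElem P) (hQ : IsIdempotentElem Q)
    (h : IdemEquiv P Q) : Equivalent P Q := by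
  set N := a + b
  have ha : a ≤ N := Nat.le_add_right _ _
  have hb : b ≤ N := Nat.le_add_left _ _
  have hP' := isIdempotentElem_pad ha hP
  have hQ' := isIdempotentElem_pad hb hQ
  have h' : IdemEquiv (pad N P) (pad N Q) :=
    ((idemEquiv_pad ha hP).symm.trans h hP' hQ).trans (idemEquiv_pad hb hQ) hP' hQ'
  obtain ⟨X₀, Y₀, h₁, h₂⟩ := h'
  set P' := pad N P
  set Q' := pad N Q
  obtain ⟨X, Y, hYX, hXY, hX₁, hX₂, hY₁, hY₂⟩ : ∃ X Y : Matrix (Fin N) (Fin N) A,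
      Y * X = P' ∧ X * Y = Q' ∧ X * P' = X ∧ Q' * X = X ∧ P' * Y = Y ∧ Y * Q' = Y := by
    -- Cutting down by `P'` makes `X` and `Y` vanish on the complements, which is what cancels the
    -- mixed terms of the block products below.
    refine ⟨X₀ * P', P' * Y₀, ?_, ?_, ?_, ?_, ?_, ?_⟩
    · rw [mul_assoc, ← mul_assoc Y₀, h₁, hP'.eq, hP'.eq]
    · rw [mul_assoc, ← mul_assoc P', hP'.eq, ← h₁, mul_assoc, h₂, ← mul_assoc, h₂, hQ'.eq]
    · rw [mul_assoc, hP'.eq]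
    · rw [← h₂, mul_assoc, ← mul_assoc Y₀, h₁, hP'.eq]
    · rw [← mul_assoc, hP'.eq]
    · rw [← h₂, mul_assoc, ← mul_assoc Y₀, h₁, ← mul_assoc, hP'.eq]
  refine ⟨N + N, ha.trans (Nat.le_add_right _ _), hb.trans (Nat.le_add_right _ _), ?_⟩
  have hpX : (1 - Q') * X = 0 := by rw [sub_mul, one_mul, hX₂, sub_self]
  have hXp : X * (1 - P') = 0 := by rw [mul_sub, mul_one, hX₁, sub_self]
  have hpY : (1 - P') * Y = 0 := by rw [sub_mul, one_mul, hY₁, sub_self]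
  have hYp : Y * (1 - Q') = 0 := by rw [mul_sub, mul_one, hY₂, sub_self]
  have hPc := hP'.one_sub
  have hQc := hQ'.one_sub
  have hPo : (1 - P') * P' = 0 := by rw [sub_mul, one_mul, hP'.eq, sub_self]
  let U := Matrix.fromBlocks X (1 - Q') (1 - P') Y
  let V := Matrix.fromBlocks Y (1 - P') (1 - Q') X
  have hUV : U * V = 1 := by
    simp only [U, V, Matrix.fromBlocks_multiply, hXY, hYX, hpX, hXp, hpY, hYp, hPc.eq, hQc.eq,
      add_sub_cancel, sub_add_cancel, add_zero, Matrix.fromBlocks_one]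
  have hVU : V * U = 1 := by
    simp only [U, V, Matrix.fromBlocks_multiply, hXY, hYX, hpX, hXp, hpY, hYp, hPc.eq, hQc.eq,
      add_sub_cancel, sub_add_cancel, add_zero, Matrix.fromBlocks_one]
  let e := Matrix.reindexAlgEquiv ℂ A (finSumFinEquiv (m := N) (n := N))
  refine ⟨⟨e U, e V, by rw [← map_mul, hUV, map_one], by rw [← map_mul, hVU, map_one]⟩, ?_⟩
  rw [pad_add ha P, pad_add hb Q]
  change e U * e (Matrix.fromBlocks P' 0 0 0) * e V = e (Matrix.fromBlocks Q' 0 0 0)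
  rw [← map_mul, ← map_mul]
  congr 1
  simp only [U, V, Matrix.fromBlocks_multiply, mul_zero, add_zero, hX₁, hPo, hXY, zero_mul, hXp]

theorem diagSum_eq {a b : ℕ} (P : Matrix (Fin a) (Fin a) A) (Q : Matrix (Fin b) (Fin b) A) :
    diagSum P Q = (blockSum P Q).submatrix finSumFinEquiv.symm finSumFinEquiv.symm := rfl

theorem idemEquiv_diagSum {a b : ℕ} {P : Matrix (Fin a) (Fin a) A}
    {Q : Matrix (Fin b) (Fin b) A} (hP : IsIdempotentElem P) (hQ : IsIdempotentElem Q) :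
    IdemEquiv (blockSum P Q) (diagSum P Q) :=
  .submatrix (isIdempotentElem_blockSum hP hQ) _

theorem isIdempotentElem_diagSum {a b : ℕ} {P : Matrix (Fin a) (Fin a) A}
    {Q : Matrix (Fin b) (Fin b) A} (hP : IsIdempotentElem P) (hQ : IsIdempotentElem Q) :
    IsIdempotentElem (diagSum P Q) := by
  unfold IsIdempotentElem
  rw [diagSum_eq, Matrix.submatrix_mul_equiv, isIdempotentElem_blockSum hP hQ]

end Equivalent

/-! ### Ranks -/

section Rank

variable {ι κ : Type*} [Fintype ι] [Fintype κ]

theorem rank_le_of_idemEquiv {P : Matrix ι ι ℂ} {Q : Matrix κ κ ℂ} (hP : IsIdempotentElem P)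
    (h : IdemEquiv P Q) : P.rank ≤ Q.rank := by
  obtain ⟨X, Y, h₁, h₂⟩ := h
  have : P = Y * (Q * X) := by
    rw [← hP.eq, ← h₁, ← h₂]; simp only [Matrix.mul_assoc]
  calc P.rank = (Y * (Q * X)).rank := by rw [← this]
    _ ≤ (Q * X).rank := Matrix.rank_mul_le_right _ _
    _ ≤ Q.rank := Matrix.rank_mul_le_left _ _

theorem IdemEquiv.rank_eq {P : Matrix ι ι ℂ} {Q : Matrix κ κ ℂ} (hP : IsIdempotentElem P)
    (hQ : IsIdempotentElem Q) (h : IdemEquiv P Q) : P.rank = Q.rank :=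
  le_antisymm (rank_le_of_idemEquiv hP h) (rank_le_of_idemEquiv hQ h.symm)

theorem trace_eq_rank_of_isIdempotentElem [DecidableEq ι] {P : Matrix ι ι ℂ}
    (hP : IsIdempotentElem P) : P.trace = (P.rank : ℂ) := by
  have h1 : IsIdempotentElem (Matrix.toLin' P) := by
    have := congrArg Matrix.toLin' hP.eq
    rwa [Matrix.toLin'_mul] at this
  have h2 := (LinearMap.IsIdempotentElem.isProj_range _ h1).trace
  rw [Matrix.trace_toLin'_eq] at h2
  exact h2

/-- The trace is visibly additive, and on idempotents it equals the rank. -/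
theorem rank_blockSum [DecidableEq ι] [DecidableEq κ] {P : Matrix ι ι ℂ} {Q : Matrix κ κ ℂ}
    (hP : IsIdempotentElem P) (hQ : IsIdempotentElem Q) :
    (blockSum P Q).rank = P.rank + Q.rank := by
  have := trace_eq_rank_of_isIdempotentElem (isIdempotentElem_blockSum hP hQ)
  rw [show (blockSum P Q).trace = P.trace + Q.trace by simp [Matrix.trace, Fintype.sum_sum_type], trace_eq_rank_of_isIdempotentElem hP,
    trace_eq_rank_of_isIdempotentElem hQ] at this
  exact_mod_cast this.symm

variable {n : ℕ} {q : ℝ}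

/-- Evaluation at the point `1` of the circle. -/
def evalOne (n : ℕ) (q : ℝ) : SphereAlgebra n q →+* ℂ where
  toFun x := eta n q x 1
  map_one' := by simp
  map_mul' := by simp
  map_zero' := by simp
  map_add' := by simp

theorem isIdempotentElem_map {A B : Type*} [Ring A] [Ring B] {P : Matrix ι ι A}
    (hP : IsIdempotentElem P) (f : A →+* B) : IsIdempotentElem (P.map f) := by
  unfold IsIdempotentElem
  rw [← Matrix.map_mul, hP.eq]

theorem rank_eq_of_idemEquiv {a b : ℕ} {P : Matrix (Fin a) (Fin a) (SphereAlgebra n q)}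
    {Q : Matrix (Fin b) (Fin b) (SphereAlgebra n q)} (hP : IsIdempotentElem P)
    (hQ : IsIdempotentElem Q) (h : IdemEquiv P Q) : rank P = rank Q := by
  have h' := (h.map (evalOne n q)).rank_eq (isIdempotentElem_map hP _)
    (isIdempotentElem_map hQ _)
  exact h'

theorem rank_diagSum {a b : ℕ} {P : Matrix (Fin a) (Fin a) (SphereAlgebra n q)}
    {Q : Matrix (Fin b) (Fin b) (SphereAlgebra n q)} (hP : IsIdempotentElem P)
    (hQ : IsIdempotentElem Q) : rank (diagSum P Q) = rank P + rank Q := by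
  have h := ((idemEquiv_diagSum hP hQ).map (evalOne n q)).rank_eq
    (isIdempotentElem_map (isIdempotentElem_blockSum hP hQ) _)
    (isIdempotentElem_map (isIdempotentElem_diagSum hP hQ) _)
  have h' := rank_blockSum (isIdempotentElem_map hP (evalOne n q))
    (isIdempotentElem_map hQ (evalOne n q))
  rw [Matrix.fromBlocks_map] at h
  simp only [blockSum] at h'
  rw [Matrix.map_zero _ (map_zero _), Matrix.map_zero _ (map_zero _), h'] at h
  exact h.symm

theorem rank_one (k : ℕ) : rank (1 : Matrix (Fin k) (Fin k) (SphereAlgebra n q)) = k := by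
  have : fibreMatrix (1 : Matrix (Fin k) (Fin k) (SphereAlgebra n q)) 1 = 1 :=
    Matrix.map_one (evalOne n q) (map_zero _) (map_one _)
  rw [rank, this, Matrix.rank_one, Fintype.card_fin]

end Rank

/-! ### Idempotents over the circle -/

section Circle

/-- The half-open interval meets each point of the circle once; equality at the endpoints makes the
descended function continuous. -/
theorem exists_circle_lift {f : ℝ → ℂ} (hf : ContinuousOn f (Set.Icc 0 (2 * Real.pi)))
    (h : f 0 = f (2 * Real.pi)) :
    ∃ F : C(Circle, ℂ), ∀ t ∈ Set.Ico 0 (2 * Real.pi), F (Circle.exp t) = f t := by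
  have : Fact (0 < 2 * Real.pi) := ⟨by positivity⟩
  refine ⟨⟨AddCircle.liftIco (2 * Real.pi) 0 f ∘ AddCircle.homeomorphCircle'.symm,
    (AddCircle.liftIco_zero_continuous h hf).comp (Homeomorph.continuous _)⟩, fun t ht => ?_⟩
  have : AddCircle.homeomorphCircle'.symm (Circle.exp t) = (t : AddCircle (2 * Real.pi)) := by
    rw [Homeomorph.symm_apply_eq, AddCircle.homeomorphCircle'_apply_mk]
  simp only [ContinuousMap.coe_mk, Function.comp_apply, this]
  exact AddCircle.liftIco_zero_coe_apply ht

theorem exists_exp_eq (z : Circle) : ∃ t ∈ Set.Ico 0 (2 * Real.pi), Circle.exp t = z := by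
  have : Fact (0 < 2 * Real.pi) := ⟨by positivity⟩
  obtain ⟨t, ht, h⟩ := AddCircle.eq_coe_Ico (AddCircle.homeomorphCircle'.symm z)
  refine ⟨t, ht, ?_⟩
  rw [← AddCircle.homeomorphCircle'_apply_mk, h, Homeomorph.apply_symm_apply]

variable {ι : Type*} [Fintype ι] [DecidableEq ι]

/-- `X` is the corestriction of `P` to its range and `Y` the inclusion of the range, written in a
basis of the range. -/
theorem exists_rank_factorization {P : Matrix ι ι ℂ} (hP : IsIdempotentElem P) :
    ∃ (X : Matrix (Fin P.rank) ι ℂ) (Y : Matrix ι (Fin P.rank) ℂ), Y * X = P ∧ X * Y = 1 := by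
  let f := Matrix.toLin' P
  have hf : f ∘ₗ f = f := by
    have := congrArg Matrix.toLin' hP.eq
    rwa [Matrix.toLin'_mul] at this
  let b : Module.Basis (Fin P.rank) ℂ (LinearMap.range f) := Module.finBasisOfFinrankEq ℂ _ rfl
  have hs : (LinearMap.range f).subtype ∘ₗ f.rangeRestrict = f := by ext; rfl
  have hr : f.rangeRestrict ∘ₗ (LinearMap.range f).subtype = LinearMap.id := by
    ext ⟨x, y, rfl⟩
    exact congrFun (LinearMap.congr_fun hf y) _
  refine ⟨LinearMap.toMatrix (Pi.basisFun ℂ ι) b f.rangeRestrict,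
    LinearMap.toMatrix b (Pi.basisFun ℂ ι) (LinearMap.range f).subtype, ?_, ?_⟩
  · rw [← LinearMap.toMatrix_comp, hs, LinearMap.toMatrix_eq_toMatrix']
    exact LinearMap.toMatrix'_toLin' P
  · rw [← LinearMap.toMatrix_comp, hr, LinearMap.toMatrix_id]

/-- The canonical intertwiner of two idempotents. -/
def intertwiner (P Q : Matrix ι ι ℂ) : Matrix ι ι ℂ := P * Q + (1 - P) * (1 - Q)

theorem mul_intertwiner {P Q : Matrix ι ι ℂ} (hP : IsIdempotentElem P)
    (hQ : IsIdempotentElem Q) : P * intertwiner P Q = intertwiner P Q * Q := by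
  have h1 : P * (1 - P) = 0 := by rw [mul_sub, mul_one, hP.eq, sub_self]
  have h2 : (1 - Q) * Q = 0 := by rw [sub_mul, one_mul, hQ.eq, sub_self]
  rw [intertwiner, mul_add, add_mul, ← mul_assoc, hP.eq, ← mul_assoc, h1, mul_assoc, hQ.eq,
    mul_assoc _ _ Q, h2, zero_mul, mul_zero]

/-- With continuity of the determinant, this makes the intertwiner of two nearby idempotents on a
path invertible. -/
theorem intertwiner_self {P : Matrix ι ι ℂ} (hP : IsIdempotentElem P) : intertwiner P P = 1 := by
  rw [intertwiner, hP.eq, hP.one_sub.eq, add_sub_cancel]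

/-- Parallel transport along a path of idempotents. -/
theorem exists_transport {T : ℝ} (hT : 0 < T) {E : ℝ → Matrix ι ι ℂ} (hE : Continuous E)
    (hidem : ∀ t, IsIdempotentElem (E t)) :
    ∃ G : ℝ → Matrix ι ι ℂ, Continuous G ∧ G 0 = 1 ∧
      (∀ t ∈ Set.Icc 0 T, E t * G t = G t * E 0) ∧ ∀ t ∈ Set.Icc 0 T, (G t).det ≠ 0 := by
  have hu : Continuous fun x : ℝ × ℝ => intertwiner (E x.1) (E x.2) := by
    unfold intertwiner; fun_prop
  obtain ⟨δ, hδ, hδ'⟩ := Metric.uniformContinuousOn_iff.1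
    ((isCompact_Icc (a := (0 : ℝ)) (b := T)).prod (isCompact_Icc (a := (0 : ℝ)) (b := T))
      |>.uniformContinuousOn_of_continuous (f := fun x : ℝ × ℝ =>
        (intertwiner (E x.1) (E x.2)).det) hu.matrix_det.continuousOn) 1 one_pos
  have hdet : ∀ a ∈ Set.Icc 0 T, ∀ b ∈ Set.Icc 0 T, |a - b| < δ →
      (intertwiner (E a) (E b)).det ≠ 0 := by
    intro a ha b hb hab h0
    have := hδ' (a, b) ⟨ha, hb⟩ (b, b) ⟨hb, hb⟩ (by simpa [Prod.dist_eq, Real.dist_eq, hδ] using hab)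
    simp [h0, intertwiner_self (hidem b)] at this
  obtain ⟨N, hN⟩ := exists_nat_gt (T / δ)
  have hN0 : (0 : ℝ) < N := (div_pos hT hδ).trans hN
  -- The point `t` stopped at the grid times. On `[0, T]` one has `c 0 t = 0` and `c N t = t`, and
  -- consecutive values are closer than `δ`; so the product of the intertwiners of consecutive
  -- points is invertible, continuous in `t`, and moves `E 0` to `E t`.
  let c : ℕ → ℝ → ℝ := fun i t => min t (i * (T / N))
  have hcc : ∀ i, Continuous (c i) := fun i => by fun_prop
  have hc0 : ∀ i, c i 0 = 0 := fun i => min_eq_left (by positivity)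
  have hcI : ∀ i, ∀ t ∈ Set.Icc 0 T, c i t ∈ Set.Icc 0 T := fun i t ht =>
    ⟨le_min ht.1 (by positivity), (min_le_left _ _).trans ht.2⟩
  have hcd : ∀ i t, |c (i + 1) t - c i t| < δ := by
    intro i t
    have h1 : T / N < δ := by
      rw [div_lt_iff₀ hN0]; rw [div_lt_iff₀ hδ] at hN; linarith
    have h2 : |c (i + 1) t - c i t| ≤ |(((i + 1 : ℕ) : ℝ) * (T / N)) - i * (T / N)| := by
      have := abs_min_sub_min_le_max t (((i + 1 : ℕ) : ℝ) * (T / N)) t (i * (T / N))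
      simpa [c] using this
    refine h2.trans_lt ?_
    push_cast
    rw [add_mul, one_mul, add_sub_cancel_left, abs_of_pos (by positivity)]
    exact h1
  let G : ℕ → ℝ → Matrix ι ι ℂ := fun i t =>
    Nat.rec 1 (fun i g => intertwiner (E (c (i + 1) t)) (E (c i t)) * g) i
  have hGs : ∀ i t, G (i + 1) t = intertwiner (E (c (i + 1) t)) (E (c i t)) * G i t :=
    fun i t => rfl
  have hGc : ∀ i, Continuous (G i) := by
    intro i
    induction i with
    | zero => exact continuous_const
    | succ i ih =>
      exact (hu.comp ((hcc (i + 1)).prodMk (hcc i))).mul ih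
  have hG0 : ∀ i, G i 0 = 1 := by
    intro i
    induction i with
    | zero => rfl
    | succ i ih => rw [hGs, ih, hc0, hc0, intertwiner_self (hidem 0), one_mul]
  have hGE : ∀ i, ∀ t ∈ Set.Icc 0 T, E (c i t) * G i t = G i t * E 0 := by
    intro i t ht
    induction i with
    | zero =>
      have : c 0 t = 0 := by simp [c, ht.1]
      simp [G, this]
    | succ i ih =>
      rw [hGs, ← mul_assoc, mul_intertwiner (hidem _) (hidem _), mul_assoc, ih, mul_assoc]
  have hGd : ∀ i, ∀ t ∈ Set.Icc 0 T, (G i t).det ≠ 0 := by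
    intro i t ht
    induction i with
    | zero => simp [G]
    | succ i ih =>
      rw [hGs, Matrix.det_mul]
      exact mul_ne_zero (hdet _ (hcI _ _ ht) _ (hcI _ _ ht) (hcd i t)) ih
  refine ⟨G N, hGc N, hG0 N, fun t ht => ?_, hGd N⟩
  have : c N t = t := by
    simp only [c]
    rw [mul_div_cancel₀ _ hN0.ne', min_eq_left ht.2]
  rw [← hGE N t ht, this]

/-- An invertible matrix is connected to the identity by a path of invertible matrices that commute
with everything it commutes with. -/
theorem exists_path_to_one {g : Matrix ι ι ℂ} (hg : g.det ≠ 0) {T : ℝ} (hT : 0 < T) :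
    ∃ γ : ℝ → ℂ, Continuous γ ∧ γ 0 = 0 ∧ γ T = 1 ∧ ∀ t, (1 + γ t • (g - 1)).det ≠ 0 := by
  let p : Polynomial ℂ := (1 + (Polynomial.X : Polynomial ℂ) • (g - 1).map Polynomial.C).det
  have hp : ∀ z, p.eval z = (1 + z • (g - 1)).det := by
    intro z
    rw [← Polynomial.coe_evalRingHom, RingHom.map_det]
    congr 1
    ext i j
    by_cases hij : i = j
    · simp [hij]
    · simpa [hij] using mul_comm _ _
  have hp0 : p ≠ 0 := by
    intro h
    have := hp 0
    simp [h] at this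
  have hc : (p.rootSet ℂ).Countable := (p.rootSet_finite ℂ).countable
  -- The zeros of `det (1 + z (g - 1))` form a finite set, and removing a countable set from the
  -- plane leaves it path connected. The path runs in the scalar `z`, so every matrix on it is a
  -- polynomial in `g`.
  have hpc := hc.isPathConnected_compl_of_one_lt_rank (by simp [Complex.rank_real_complex])
  have hmem : ∀ z, z ∈ (p.rootSet ℂ)ᶜ ↔ (1 + z • (g - 1)).det ≠ 0 := by
    intro z
    rw [Set.mem_compl_iff, Polynomial.mem_rootSet, ← hp]
    simp [hp0]
  obtain ⟨γ, hγ⟩ := hpc.joinedIn 0 ((hmem 0).2 (by simp)) 1 ((hmem 1).2 (by simpa using hg))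
  refine ⟨fun t => γ.extend (t / T), γ.continuous_extend.comp (by fun_prop), by simp,
    by simp [hT.ne'], fun t => (hmem _).1 ?_⟩
  have : γ.extend (t / T) ∈ Set.range γ := by
    rw [← Path.extend_range]; exact Set.mem_range_self _
  obtain ⟨s, hs⟩ := this
  change γ.extend (t / T) ∈ _
  rw [← hs]
  exact hγ s

/-- Parallel transport trivializes the bundle over `[0, 2π]`, up to a monodromy `G (2π)` that
commutes with the fibre projection `E 0` by periodicity. A path from `1` to the inverse monodromy,
inside the invertible matrices commuting with `E 0`, undoes it gradually; the corrected frame `L`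
closes up and descends to the circle. -/
theorem exists_trivialization {e : Matrix ι ι C(Circle, ℂ)} (he : IsIdempotentElem e) :
    ∃ (X : Matrix (Fin (e.map fun f => f 1).rank) ι C(Circle, ℂ))
      (Y : Matrix ι (Fin (e.map fun f => f 1).rank) C(Circle, ℂ)), Y * X = e ∧ X * Y = 1 := by
  have hT : (0 : ℝ) < 2 * Real.pi := by positivity
  let E : ℝ → Matrix ι ι ℂ := fun t => e.map fun f => f (Circle.exp t)
  have hE : Continuous E := continuous_matrix fun i j => by
    simp only [E, Matrix.map_apply]; fun_prop
  have hidem : ∀ t, IsIdempotentElem (E t) := by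
    intro t
    ext i j
    have := congrArg (fun f : C(Circle, ℂ) => f (Circle.exp t)) (congrFun (congrFun he.eq i) j)
    simpa [E, Matrix.mul_apply] using this
  have hE0 : E 0 = e.map fun f => f 1 := by simp [E]
  have hEper : E (2 * Real.pi) = E 0 := by simp [E]
  obtain ⟨G, hGc, hG0, hGE, hGd⟩ := exists_transport hT hE hidem
  have h2 : 2 * Real.pi ∈ Set.Icc 0 (2 * Real.pi) := ⟨hT.le, le_rfl⟩
  have hu := isUnit_iff_ne_zero.2 (hGd _ h2)
  obtain ⟨γ, hγc, hγ0, hγ1, hγd⟩ :=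
    exists_path_to_one (g := (G (2 * Real.pi))⁻¹) (T := 2 * Real.pi)
      ((Matrix.isUnit_nonsing_inv_det_iff.2 hu).ne_zero) hT
  have hcomm : (G (2 * Real.pi))⁻¹ * E 0 = E 0 * (G (2 * Real.pi))⁻¹ := by
    have h := hGE _ h2
    rw [hEper] at h
    calc (G (2 * Real.pi))⁻¹ * E 0
        = (G (2 * Real.pi))⁻¹ * (E 0 * G (2 * Real.pi)) * (G (2 * Real.pi))⁻¹ := by
          rw [mul_assoc, mul_assoc, Matrix.mul_nonsing_inv _ hu, mul_one]
      _ = E 0 * (G (2 * Real.pi))⁻¹ := by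
          rw [h, ← mul_assoc, Matrix.nonsing_inv_mul _ hu, one_mul]
  let L : ℝ → Matrix ι ι ℂ := fun t => G t * (1 + γ t • ((G (2 * Real.pi))⁻¹ - 1))
  have hLc : Continuous L := by fun_prop
  have hL0 : L 0 = 1 := by simp [L, hγ0, hG0]
  have hL1 : L (2 * Real.pi) = 1 := by
    simp [L, hγ1, Matrix.mul_nonsing_inv _ hu]
  have hLd : ∀ t ∈ Set.Icc 0 (2 * Real.pi), IsUnit (L t).det := fun t ht => by
    rw [Matrix.det_mul]
    exact isUnit_iff_ne_zero.2 (mul_ne_zero (hGd t ht) (hγd t))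
  have hLE : ∀ t ∈ Set.Icc 0 (2 * Real.pi), E t * L t = L t * E 0 := fun t ht => by
    simp only [L]
    rw [← mul_assoc, hGE t ht, mul_assoc, mul_assoc]
    congr 1
    simp only [mul_add, add_mul, mul_one, one_mul, Matrix.mul_smul, Matrix.smul_mul, mul_sub,
      sub_mul, hcomm]
  have hLi : ContinuousOn (fun t => (L t)⁻¹) (Set.Icc 0 (2 * Real.pi)) := by
    have h1 : ContinuousOn (fun t => ((L t).det)⁻¹) (Set.Icc 0 (2 * Real.pi)) :=
      hLc.matrix_det.continuousOn.inv₀ fun t ht => (hLd t ht).ne_zero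
    simp only [Matrix.inv_def, Ring.inverse_eq_inv']
    exact h1.smul hLc.matrix_adjugate.continuousOn
  obtain ⟨X₀, Y₀, hYX, hXY⟩ := exists_rank_factorization (hE0 ▸ hidem 0)
  replace hYX := hYX.trans hE0.symm
  have hXc : ContinuousOn (fun t => X₀ * (L t)⁻¹) (Set.Icc 0 (2 * Real.pi)) :=
    (Continuous.matrix_mul continuous_const continuous_id).comp_continuousOn hLi
  have hYc : Continuous (fun t => L t * Y₀) := hLc.matrix_mul continuous_const
  have hX : ∀ i j, ∃ F : C(Circle, ℂ), ∀ t ∈ Set.Ico 0 (2 * Real.pi),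
      F (Circle.exp t) = (X₀ * (L t)⁻¹) i j := fun i j =>
    exists_circle_lift ((continuous_id.matrix_elem i j).comp_continuousOn hXc)
      (by simp [hL0, hL1])
  have hY : ∀ i j, ∃ F : C(Circle, ℂ), ∀ t ∈ Set.Ico 0 (2 * Real.pi),
      F (Circle.exp t) = (L t * Y₀) i j := fun i j =>
    exists_circle_lift (hYc.matrix_elem i j).continuousOn (by simp [hL0, hL1])
  choose X hX using hX
  choose Y hY using hY
  refine ⟨Matrix.of X, Matrix.of Y, ?_, ?_⟩
  · ext i j z
    obtain ⟨t, ht, rfl⟩ := exists_exp_eq z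
    have h' : (L t * Y₀) * (X₀ * (L t)⁻¹) = E t := by
      rw [Matrix.mul_assoc, ← Matrix.mul_assoc Y₀, hYX, ← Matrix.mul_assoc,
        ← hLE t (Set.Ico_subset_Icc_self ht), Matrix.mul_assoc,
        Matrix.mul_nonsing_inv _ (hLd t (Set.Ico_subset_Icc_self ht)), Matrix.mul_one]
    have h'' := congrFun (congrFun h' i) j
    rw [Matrix.mul_apply] at h'' ⊢
    simpa [hX _ _ t ht, hY _ _ t ht, E] using h''
  · ext i j z
    obtain ⟨t, ht, rfl⟩ := exists_exp_eq z
    have h' : (X₀ * (L t)⁻¹) * (L t * Y₀) = 1 := by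
      rw [Matrix.mul_assoc, ← Matrix.mul_assoc _ _ Y₀,
        Matrix.nonsing_inv_mul _ (hLd t (Set.Ico_subset_Icc_self ht)), Matrix.one_mul, hXY]
    have h'' := congrFun (congrFun h' i) j
    rw [Matrix.mul_apply] at h'' ⊢
    by_cases hij : i = j <;> simpa [hX _ _ t ht, hY _ _ t ht, Matrix.one_apply, hij] using h''

end Circle

/-! ### Idempotents over corners -/

section Corner

variable {A : Type*} [Ring A]

/-- `x` belongs to the corner `p A p` (for an idempotent `p`). -/
def InCorner (p x : A) : Prop := p * x = x ∧ x * p = x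

namespace InCorner

variable {p x y : A}

theorem zero : InCorner p 0 := ⟨mul_zero _, zero_mul _⟩

theorem self (hp : IsIdempotentElem p) : InCorner p p := ⟨hp, hp⟩

theorem add (hx : InCorner p x) (hy : InCorner p y) : InCorner p (x + y) :=
  ⟨by rw [mul_add, hx.1, hy.1], by rw [add_mul, hx.2, hy.2]⟩

theorem sub (hx : InCorner p x) (hy : InCorner p y) : InCorner p (x - y) :=
  ⟨by rw [mul_sub, hx.1, hy.1], by rw [sub_mul, hx.2, hy.2]⟩

theorem mul (hx : InCorner p x) (hy : InCorner p y) : InCorner p (x * y) :=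
  ⟨by rw [← mul_assoc, hx.1], by rw [mul_assoc, hy.2]⟩

theorem mul_mul (hx : InCorner p x) (hy : InCorner p y) (z : A) : InCorner p (x * z * y) :=
  ⟨by rw [← mul_assoc, ← mul_assoc, hx.1], by rw [mul_assoc, hy.2]⟩

theorem compress (hp : IsIdempotentElem p) (z : A) : InCorner p (p * z * p) :=
  (self hp).mul_mul (self hp) z

theorem sum {ι : Type*} {s : Finset ι} {f : ι → A} (h : ∀ i ∈ s, InCorner p (f i)) :
    InCorner p (∑ i ∈ s, f i) :=
  ⟨by rw [Finset.mul_sum]; exact Finset.sum_congr rfl fun i hi => (h i hi).1,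
    by rw [Finset.sum_mul]; exact Finset.sum_congr rfl fun i hi => (h i hi).2⟩

/-- The middle factor `p` makes the value at `m = 0` equal to `p` and not to the unit of `A`. -/
theorem pow_mul_mul_pow {v w : A} (hp : IsIdempotentElem p) (hv : InCorner p v)
    (hw : InCorner p w) (m : ℕ) : InCorner p (v ^ m * p * w ^ m) := by
  induction m with
  | zero => simpa using self hp
  | succ m ih =>
    have : v ^ (m + 1) * p * w ^ (m + 1) = v * (v ^ m * p * w ^ m) * w := by
      rw [pow_succ', pow_succ]; noncomm_ring
    rw [this]
    exact (hv.mul ih).mul hw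

end InCorner

variable {ι κ μ : Type*}

/-- All entries of a matrix belong to the corner `p A p`. -/
def MatCorner (p : A) (X : Matrix ι κ A) : Prop := ∀ i j, InCorner p (X i j)

theorem MatCorner.mul [Fintype κ] {p : A} {X : Matrix ι κ A} {Y : Matrix κ μ A}
    (hX : MatCorner p X) (hY : MatCorner p Y) : MatCorner p (X * Y) := fun i j => by
  rw [Matrix.mul_apply]
  exact InCorner.sum fun k _ => (hX i k).mul (hY k j)

theorem MatCorner.sub {p : A} {X Y : Matrix ι κ A}
    (hX : MatCorner p X) (hY : MatCorner p Y) : MatCorner p (X - Y) := fun i j =>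
  (hX i j).sub (hY i j)

theorem MatCorner.constDiag [DecidableEq ι] {p x : A} (hx : InCorner p x) :
    MatCorner p (constDiag ι x) := fun i j => by
  by_cases h : i = j
  · subst h; simpa using hx
  · simpa [h] using InCorner.zero

theorem MatCorner.constDiag_mul [Fintype ι] [DecidableEq ι] {p : A} {X : Matrix ι κ A}
    (hX : MatCorner p X) : QSphere.constDiag ι p * X = X := by
  ext i j
  simp [(hX i j).1]

theorem MatCorner.mul_constDiag [Fintype κ] [DecidableEq κ] {p : A} {X : Matrix ι κ A}
    (hX : MatCorner p X) : X * QSphere.constDiag κ p = X := by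
  ext i j
  simp [(hX i j).2]

theorem MatCorner.blockSum {p : A} {P : Matrix ι ι A} {Q : Matrix κ κ A}
    (hP : MatCorner p P) (hQ : MatCorner p Q) : MatCorner p (blockSum P Q) := by
  rintro (i | i) (j | j)
  · exact hP i j
  · exact InCorner.zero
  · exact InCorner.zero
  · exact hQ i j

/-- An additive map that restricts to a unital ring homomorphism on the corner `p A p`. -/
structure IsCornerHom {D : Type*} [CommRing D] (p : A) (η : A →+ D) : Prop where
  map_mul : ∀ x y, InCorner p x → InCorner p y → η (x * y) = η x * η y
  map_unit : η p = 1

theorem IsCornerHom.map_matrix_mul {D : Type*} [CommRing D] {p : A} {η : A →+ D}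
    (hη : IsCornerHom p η) [Fintype κ] {X : Matrix ι κ A} {Y : Matrix κ μ A}
    (hX : MatCorner p X) (hY : MatCorner p Y) :
    (X * Y).map η = X.map η * Y.map η := by
  ext i j
  simp only [Matrix.map_apply, Matrix.mul_apply, map_sum]
  exact Finset.sum_congr rfl fun k _ => hη.map_mul _ _ (hX i k) (hY k j)

variable [Fintype ι] [Fintype κ]

/-- A pair of maps that is almost an equivalence onto a subidempotent yields an equivalence. -/
theorem idemEquiv_of_isUnit [DecidableEq ι] {F : Matrix ι ι A} (hF : IsIdempotentElem F)
    {X : Matrix κ ι A} {Y : Matrix ι κ A} (hX : X * F = X) (hY : F * Y = Y) {c : Matrix ι ι A}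
    (hc₁ : (1 - F + Y * X) * c = 1) (hc₂ : c * (1 - F + Y * X) = 1) :
    F * c = c * F ∧ c * (Y * X) = F ∧ IsIdempotentElem (X * c * Y) ∧
      IdemEquiv F (X * c * Y) := by
  have h1 : (1 - F + Y * X) * F = Y * X := by
    rw [add_mul, sub_mul, one_mul, hF.eq, sub_self, zero_add, Matrix.mul_assoc, hX]
  have h2 : F * (1 - F + Y * X) = Y * X := by
    rw [mul_add, mul_sub, mul_one, hF.eq, sub_self, zero_add, ← Matrix.mul_assoc, hY]
  -- `F` commutes with `1 - F + Y X`, hence with its inverse `c`. On the range of `F` this inverse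
  -- inverts `Y X`, so `X` and `c Y` implement the equivalence.
  have h3 : F * c = c * F := by
    calc F * c = c * ((1 - F + Y * X) * F) * c := by rw [← mul_assoc, hc₂, one_mul]
      _ = c * (F * (1 - F + Y * X)) * c := by rw [h1, h2]
      _ = c * F := by rw [mul_assoc, mul_assoc, hc₁, mul_one]
  have h4 : c * (Y * X) = F := by rw [← h1, ← mul_assoc, hc₂, one_mul]
  refine ⟨h3, h4, ?_, X, c * Y, ?_, ?_⟩
  · unfold IsIdempotentElem
    calc X * c * Y * (X * c * Y) = X * (c * (Y * X)) * c * Y := by simp only [Matrix.mul_assoc]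
      _ = X * c * Y := by rw [h4, hX]
  · rw [Matrix.mul_assoc, h4]
  · rw [Matrix.mul_assoc]

end Corner

/-! ### Stable triviality over a corner, and absorption by several copies -/

section Absorbing

variable {A : Type*} [Ring A]

/-- Every idempotent over the corner `p A p` becomes trivial after adding one copy of `p`. -/
def Absorbing (p : A) : Prop :=
  ∀ (ι : Type) [Fintype ι] [DecidableEq ι] (Q : Matrix ι ι A), IsIdempotentElem Q →
    MatCorner p Q → ∃ r : ℕ, 0 < r ∧
      IdemEquiv (blockSum Q (constDiag Unit p)) (constDiag (Fin r) p)

/-- One of the `k` copies of `p` does the absorbing; `k > 0` provides it. -/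
theorem idemEquiv_absorb_unit {p p' : A} (hp : IsIdempotentElem p) (hp' : IsIdempotentElem p')
    (h : IdemEquiv (blockSum (constDiag Unit p) (constDiag Unit p')) (constDiag Unit p)) {k : ℕ}
    (hk : 0 < k) :
    IdemEquiv (blockSum (constDiag (Fin k) p) (constDiag Unit p')) (constDiag (Fin k) p) := by
  obtain ⟨k, rfl⟩ : ∃ l, k = l + 1 := ⟨k - 1, by omega⟩
  have ip : ∀ l, IsIdempotentElem (constDiag (Fin l) p) := fun l => isIdempotentElem_constDiag hp
  have iu : IsIdempotentElem (constDiag Unit p) := isIdempotentElem_constDiag hp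
  have iu' : IsIdempotentElem (constDiag Unit p') := isIdempotentElem_constDiag hp'
  have e : (Fin k ⊕ Unit) ≃ Fin (k + 1) :=
    ((Equiv.refl _).sumCongr finOneEquiv.symm).trans finSumFinEquiv
  have h0 : IdemEquiv (constDiag (Fin (k + 1)) p) (blockSum (constDiag (Fin k) p)
      (constDiag Unit p)) :=
    (IdemEquiv.constDiag_congr hp e).trans (.constDiag_sum hp) (ip _)
      (isIdempotentElem_blockSum (ip _) iu)
  have h1 := h0.sum (.refl iu')
  have h2 := h1.trans (.sum_assoc (ip k) iu iu') (isIdempotentElem_blockSum (ip _) iu')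
    (isIdempotentElem_blockSum (ip _) (isIdempotentElem_blockSum iu iu'))
  have h3 := h2.trans ((IdemEquiv.refl (ip k)).sum h) (isIdempotentElem_blockSum (ip _) iu')
    (isIdempotentElem_blockSum (ip _) iu)
  exact h3.trans h0.symm (isIdempotentElem_blockSum (ip _) iu') (ip _)

theorem idemEquiv_absorb {p p' : A} (hp : IsIdempotentElem p) (hp' : IsIdempotentElem p')
    (h : IdemEquiv (blockSum (constDiag Unit p) (constDiag Unit p')) (constDiag Unit p)) {k : ℕ}
    (hk : 0 < k) (r : ℕ) :
    IdemEquiv (blockSum (constDiag (Fin k) p) (constDiag (Fin r) p'))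
      (constDiag (Fin k) p) := by
  have ip : IsIdempotentElem (constDiag (Fin k) p) := isIdempotentElem_constDiag hp
  have ip' : ∀ l, IsIdempotentElem (constDiag (Fin l) p') := fun l =>
    isIdempotentElem_constDiag hp'
  have iu' : IsIdempotentElem (constDiag Unit p') := isIdempotentElem_constDiag hp'
  induction r with
  | zero => exact .sum_of_isEmpty ip _
  | succ r ih =>
    have e : (Unit ⊕ Fin r) ≃ Fin (r + 1) :=
      (finOneEquiv.symm.sumCongr (Equiv.refl _)).trans
        (finSumFinEquiv.trans (finCongr (Nat.add_comm 1 r)))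
    have h0 : IdemEquiv (constDiag (Fin (r + 1)) p') (blockSum (constDiag Unit p')
        (constDiag (Fin r) p')) :=
      (IdemEquiv.constDiag_congr hp' e).trans (.constDiag_sum hp') (ip' _)
        (isIdempotentElem_blockSum iu' (ip' _))
    have i1 := isIdempotentElem_blockSum ip (ip' (r + 1))
    have h1 := (IdemEquiv.refl ip).sum h0
    have h2 := h1.trans (IdemEquiv.sum_assoc ip iu' (ip' r)).symm i1
      (isIdempotentElem_blockSum (isIdempotentElem_blockSum ip iu') (ip' r))
    have h3 := h2.trans ((idemEquiv_absorb_unit hp hp' h hk).sum (.refl (ip' r))) i1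
      (isIdempotentElem_blockSum ip (ip' r))
    exact h3.trans ih i1 ip

end Absorbing

/-! ### Openness of the invertible matrices -/

section Units

variable {A : Type*} [NormedRing A] [CompleteSpace A] {κ : Type*} [Fintype κ] [DecidableEq κ]

theorem eventually_isUnit_matrix {f : ℕ → Matrix κ κ A} (hf : Tendsto f atTop (𝓝 1)) :
    ∀ᶠ m in atTop, IsUnit (f m) := by
  -- This norm induces the entrywise topology and is complete, so the limit takes place in a Banach
  -- ring, where the units are open.
  let R : NormedRing (Matrix κ κ A) := Matrix.linftyOpNormedRing
  have hR : @CompleteSpace (Matrix κ κ A) R.toMetricSpace.toUniformSpace :=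
    (inferInstance : CompleteSpace (κ → κ → A))
  have hS : @HasSummableGeomSeries (Matrix κ κ A) R :=
    @instHasSummableGeomSeriesOfCompleteSpace _ R hR
  exact hf.eventually ((@Units.isOpen _ R hS).mem_nhds isUnit_one)

end Units

/-! ### The inductive step: lifting a trivialization of the symbol -/

section Step

variable {A : Type*} [NormedRing A] [CompleteSpace A] {D : Type*} [CommRing D]

/-- Telescoping: the summands are the successive differences of the elements `v ^ i * p * w ^ i`. -/
theorem sub_pow_mul_pow_eq_sum {A : Type*} [Ring A] {p v w : A} (hv : InCorner p v) (m : ℕ) :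
    p - v ^ m * p * w ^ m = ∑ i : Fin m, v ^ i.1 * (p - v * w) * w ^ i.1 := by
  rw [Fin.sum_univ_eq_sum_range (fun i => v ^ i * (p - v * w) * w ^ i) m]
  induction m with
  | zero => simp
  | succ m ih =>
    rw [Finset.sum_range_succ, ← ih]
    have : v ^ (m + 1) * p = v ^ m * v := by rw [pow_succ, mul_assoc, hv.2]
    rw [this, mul_sub, sub_mul, pow_succ' w]
    simp only [mul_assoc]
    abel

theorem isIdempotentElem_pow_mul_pow {A : Type*} [Ring A] {p v w : A}
    (hp : IsIdempotentElem p) (hv : InCorner p v) (hwv : w * v = p) (m : ℕ) :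
    p * w ^ m * (v ^ m * p) = p := by
  induction m with
  | zero => simpa using hp.eq
  | succ m ih =>
    calc p * w ^ (m + 1) * (v ^ (m + 1) * p) = p * w ^ m * ((w * v) * v ^ m * p) := by
          rw [pow_succ w, pow_succ' v]; simp only [mul_assoc]
      _ = p * w ^ m * (v ^ m * p) := by
          rw [hwv]
          congr 1
          cases m with
          | zero => simpa using hp.eq
          | succ m => rw [pow_succ', ← mul_assoc p, hv.1]
      _ = p := ih

/-- An idempotent over the ideal where the range projections of `v ^ m` tend to zero is equivalent
to an idempotent over the corner of `p - v w`. -/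
theorem exists_idemEquiv_corner {p v w : A} (hp : IsIdempotentElem p)
    (hv : InCorner p v) (hw : InCorner p w) (hwv : w * v = p)
    {ι : Type} [Fintype ι] [DecidableEq ι] {G : Matrix ι ι A} (hG : IsIdempotentElem G)
    (hGc : MatCorner p G)
    (hlim : ∀ i j, Tendsto (fun m => v ^ m * p * w ^ m * G i j) atTop (𝓝 0)) :
    ∃ (κ : Type) (_ : Fintype κ) (_ : DecidableEq κ) (Q : Matrix κ κ A),
      IsIdempotentElem Q ∧ MatCorner (p - v * w) Q ∧ IdemEquiv G Q := by
  set p' := p - v * w with hp'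
  have e1 : w * p' = 0 := by rw [hp', mul_sub, hw.2, ← mul_assoc, hwv, hw.1, sub_self]
  have ip' : IsIdempotentElem p' := by
    unfold IsIdempotentElem
    nth_rewrite 1 [hp']
    rw [sub_mul p, mul_assoc, e1, mul_zero, sub_zero, hp', mul_sub, hp.eq, ← mul_assoc, hv.1]
  have hpp' : InCorner p p' := (InCorner.self hp).sub (hv.mul hw)
  -- On each diagonal place `Z' Z` is the sum of `v^i p' w^i` over `i < m`, that is `p - v^m p w^m`.
  -- Hence `(G Z') (Z G) = G - G (v^m p w^m) G` tends to `G`, while the factorization passes through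
  -- the corner of `p'`.
  let Z : (m : ℕ) → Matrix (ι × Fin m) ι A := fun m => .of fun a b =>
    if a.1 = b then p' * w ^ a.2.1 else 0
  let Z' : (m : ℕ) → Matrix ι (ι × Fin m) A := fun m => .of fun b a =>
    if a.1 = b then v ^ a.2.1 * p' else 0
  have hZ : ∀ m, Z' m * Z m = constDiag ι (p - v ^ m * p * w ^ m) := by
    intro m
    ext a b
    rw [Matrix.mul_apply, Fintype.sum_prod_type, Finset.sum_eq_single a]
    · rw [sub_pow_mul_pow_eq_sum hv, constDiag]
      by_cases h : a = b
      · subst h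
        rw [Matrix.diagonal_apply_eq]
        refine Finset.sum_congr rfl fun i _ => ?_
        simp only [Z, Z', Matrix.of_apply, if_true]
        rw [mul_assoc, ← mul_assoc p', ip'.eq, mul_assoc]
      · rw [Matrix.diagonal_apply_ne _ h]
        simp [Z, h]
    · intro c _ hc
      simp [Z', hc]
    · simp
  have hlim' : Tendsto (fun m => 1 - G + (G * Z' m) * (Z m * G)) atTop (𝓝 1) := by
    have h1 : ∀ m, 1 - G + (G * Z' m) * (Z m * G) =
        1 - G * (constDiag ι (v ^ m * p * w ^ m) * G) := by
      intro m
      have : constDiag ι (p - v ^ m * p * w ^ m) =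
          constDiag ι p - constDiag ι (v ^ m * p * w ^ m) := by
        simp [constDiag, Matrix.diagonal_sub]
      rw [Matrix.mul_assoc, ← Matrix.mul_assoc (Z' m), hZ, this, Matrix.sub_mul,
        hGc.constDiag_mul, Matrix.mul_sub, hG.eq]
      abel
    simp only [h1]
    have h2 : Tendsto (fun m => constDiag ι (v ^ m * p * w ^ m) * G) atTop (𝓝 0) := by
      refine tendsto_pi_nhds.2 fun i => tendsto_pi_nhds.2 fun j => ?_
      simpa using hlim i j
    simpa using tendsto_const_nhds.sub (h2.const_mul G)
  obtain ⟨m, hm⟩ := (eventually_isUnit_matrix hlim').exists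
  obtain ⟨u, hu⟩ := hm
  have hX : (Z m * G) * G = Z m * G := by rw [Matrix.mul_assoc, hG.eq]
  have hY : G * (G * Z' m) = G * Z' m := by rw [← Matrix.mul_assoc, hG.eq]
  obtain ⟨-, -, h3, h4⟩ := idemEquiv_of_isUnit hG hX hY (c := (u⁻¹).1)
    (by rw [← hu]; exact u.mul_inv) (by rw [← hu]; exact u.inv_mul)
  refine ⟨ι × Fin m, inferInstance, inferInstance, _, h3, ?_, h4⟩
  have l1 : ∀ M : Matrix ι ι A, constDiag (ι × Fin m) p' * (Z m * M) = Z m * M := by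
    intro M
    rw [← Matrix.mul_assoc]
    congr 1
    ext a b
    simp only [Matrix.diagonal_mul, Z, Matrix.of_apply]
    split_ifs
    · rw [← mul_assoc, ip'.eq]
    · simp
  have l2 : ∀ M : Matrix (ι × Fin m) ι A, (M * Z' m) * constDiag (ι × Fin m) p' = M * Z' m := by
    intro M
    rw [Matrix.mul_assoc]
    congr 1
    ext a b
    simp only [Matrix.mul_diagonal, Z', Matrix.of_apply]
    split_ifs
    · rw [mul_assoc, ip'.eq]
    · simp
  have l1' : constDiag (ι × Fin m) p' * (Z m * G * (u⁻¹).1 * (G * Z' m)) =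
      Z m * G * (u⁻¹).1 * (G * Z' m) := by
    rw [Matrix.mul_assoc (Z m * G), ← Matrix.mul_assoc, l1 G]
  have l2' : Z m * G * (u⁻¹).1 * (G * Z' m) * constDiag (ι × Fin m) p' =
      Z m * G * (u⁻¹).1 * (G * Z' m) := by
    rw [← Matrix.mul_assoc, l2]
  intro a b
  constructor
  · have := congrFun (congrFun l1' a) b
    rwa [Matrix.diagonal_mul] at this
  · have := congrFun (congrFun l2' a) b
    rwa [Matrix.mul_diagonal] at this

/-- The inductive step: if `p - v w` is absorbing and the kernel of `η` on the corner of `p` is the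
ideal generated by `p - v w`, then triviality of an idempotent over the corner is detected
by `η`. -/
theorem idemEquiv_constDiag_of_map {p v w : A} {η : A →+ D} (hp : IsIdempotentElem p)
    (hv : InCorner p v) (hw : InCorner p w) (hwv : w * v = p)
    (hb : ∀ m, ‖v ^ m * p * w ^ m‖ ≤ 1) (hη : IsCornerHom p η)
    (hsurj : ∀ f, ∃ x, InCorner p x ∧ η x = f)
    (hker : ∀ x, InCorner p x → η x = 0 →
      Tendsto (fun m => v ^ m * p * w ^ m * x) atTop (𝓝 0))
    (habs : Absorbing (p - v * w)) {ι : Type} [Fintype ι] [DecidableEq ι] {P : Matrix ι ι A}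
    (hP : IsIdempotentElem P) (hPc : MatCorner p P) {k : ℕ} (hk : 0 < k)
    {X : Matrix (Fin k) ι D} {Y : Matrix ι (Fin k) D} (hYX : Y * X = P.map η)
    (hXY : X * Y = 1) : IdemEquiv P (constDiag (Fin k) p) := by
  -- Any set-theoretic lift of the trivialization will do: `X' P Y'` has symbol `1`, so it differs
  -- from the diagonal matrix with entry `p` by a matrix over the kernel of `η`.
  choose s hsc hs using hsurj
  let X' : Matrix (Fin k) ι A := X.map s
  let Y' : Matrix ι (Fin k) A := Y.map s
  have hX'c : MatCorner p X' := fun i j => hsc _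
  have hY'c : MatCorner p Y' := fun i j => hsc _
  have hX'η : X'.map η = X := by ext i j; exact hs _
  have hY'η : Y'.map η = Y := by ext i j; exact hs _
  have hfc := InCorner.pow_mul_mul_pow hp hv hw
  let F : ℕ → Matrix (Fin k) (Fin k) A := fun m => constDiag (Fin k) (v ^ m * p * w ^ m)
  have hFc : ∀ m, MatCorner p (F m) := fun m => MatCorner.constDiag (hfc m)
  have hfi : ∀ m, IsIdempotentElem (v ^ m * p * w ^ m) := by
    intro m
    unfold IsIdempotentElem
    calc v ^ m * p * w ^ m * (v ^ m * p * w ^ m)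
        = v ^ m * (p * p) * w ^ m * (v ^ m * (p * p) * w ^ m) := by rw [hp.eq]
      _ = v ^ m * p * (p * w ^ m * (v ^ m * p)) * (p * w ^ m) := by simp only [mul_assoc]
      _ = v ^ m * (p * p * p) * w ^ m := by
        rw [isIdempotentElem_pow_mul_pow hp hv hwv]; simp only [mul_assoc]
      _ = v ^ m * p * w ^ m := by rw [hp.eq, hp.eq]
  have hFi : ∀ m, IsIdempotentElem (F m) := fun m => isIdempotentElem_constDiag (hfi m)
  have ηvw : η v * η w = 1 := by
    rw [mul_comm, ← hη.map_mul _ _ hw hv, hwv, hη.map_unit]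
  have ηf : ∀ m, η (v ^ m * p * w ^ m) = 1 := by
    intro m
    induction m with
    | zero => simpa using hη.map_unit
    | succ m ih =>
      have : v ^ (m + 1) * p * w ^ (m + 1) = v * (v ^ m * p * w ^ m) * w := by
        rw [pow_succ', pow_succ]; simp only [mul_assoc]
      rw [this, hη.map_mul _ _ (hv.mul (hfc m)) hw, hη.map_mul _ _ hv (hfc m), ih, mul_one, ηvw]
  have ηF : ∀ m, (F m).map η = 1 := by
    intro m
    ext i j
    by_cases h : i = j
    · subst h; simp [F, ηf]
    · simp [F, h]
  have hmid : MatCorner p (X' * P * Y') := (hX'c.mul hPc).mul hY'c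
  have ηmid : (X' * P * Y').map η = 1 := by
    rw [hη.map_matrix_mul (hX'c.mul hPc) hY'c, hη.map_matrix_mul hX'c hPc, hX'η, hY'η, ← hYX,
      Matrix.mul_assoc, Matrix.mul_assoc, hXY, Matrix.mul_one, hXY]
  -- Left multiplication by `v^m p w^m` makes the error `X' P Y' - p`, which has symbol zero, tend
  -- to zero; the right factor is harmless because its norm is at most one.
  have hlim : Tendsto (fun m => 1 - F m + (F m * X' * P) * (P * Y' * F m)) atTop (𝓝 1) := by
    have h1 : ∀ m, 1 - F m + (F m * X' * P) * (P * Y' * F m) =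
        1 + F m * ((X' * P * Y') - constDiag (Fin k) p) * F m := by
      intro m
      have e1 : (F m * X' * P) * (P * Y' * F m) = F m * (X' * (P * P) * Y') * F m := by
        simp only [Matrix.mul_assoc]
      rw [e1, hP.eq, Matrix.mul_sub, Matrix.sub_mul, (hFc m).mul_constDiag, (hFi m).eq]
      abel
    simp only [h1]
    have h2 : Tendsto (fun m => F m * ((X' * P * Y') - constDiag (Fin k) p) * F m) atTop
        (𝓝 0) := by
      refine tendsto_pi_nhds.2 fun i => tendsto_pi_nhds.2 fun j => ?_
      simp only [F, Matrix.mul_diagonal, Matrix.diagonal_mul]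
      have hc := (hmid.sub (MatCorner.constDiag (ι := Fin k) (InCorner.self hp))) i j
      have h0 : η (((X' * P * Y') - constDiag (Fin k) p) i j) = 0 := by
        have := congrFun (congrFun ηmid i) j
        rw [Matrix.map_apply] at this
        rw [Matrix.sub_apply, map_sub, this]
        by_cases h : i = j
        · subst h; simp [hη.map_unit]
        · simp [h]
      have ht := hker _ hc h0
      refine squeeze_zero_norm (fun m => ?_) (tendsto_zero_iff_norm_tendsto_zero.1 ht)
      exact (norm_mul_le _ _).trans (mul_le_of_le_one_right (norm_nonneg _) (hb m))
    simpa using tendsto_const_nhds.add h2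
  obtain ⟨m, u, hu⟩ := (eventually_isUnit_matrix hlim).exists
  have hX1 : (P * Y' * F m) * F m = P * Y' * F m := by rw [Matrix.mul_assoc, (hFi m).eq]
  have hY1 : F m * (F m * X' * P) = F m * X' * P := by
    rw [← Matrix.mul_assoc, ← Matrix.mul_assoc, (hFi m).eq]
  obtain ⟨hFu, hcYX, h3, h4⟩ := idemEquiv_of_isUnit (hFi m) hX1 hY1 (c := (u⁻¹).1)
    (by rw [← hu]; exact u.mul_inv) (by rw [← hu]; exact u.inv_mul)
  set c := (u⁻¹).1
  -- A subidempotent of `P` equivalent to `F m`, hence to `k` copies of `p`.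
  set F' := P * Y' * F m * c * (F m * X' * P) with hF'
  have hcc : MatCorner p (F m * c * F m) := by
    intro i j
    simp only [F, Matrix.mul_diagonal, Matrix.diagonal_mul]
    exact (hfc m).mul_mul (hfc m) _
  have hF'eq : F' = P * Y' * (F m * c * F m) * (X' * P) := by
    rw [hF']; simp only [Matrix.mul_assoc]
  have hF'c : MatCorner p F' := by
    rw [hF'eq]
    exact ((hPc.mul hY'c).mul hcc).mul (hX'c.mul hPc)
  -- The entries of `c` need not lie in the corner, so only its compression has a usable symbol.
  -- That symbol is `1`, because the compression inverts a matrix of symbol `1` on `F m`.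
  have ηc : (F m * c * F m).map η = 1 := by
    have e : (F m * c * F m) * (X' * P * Y') * F m = F m := by
      calc (F m * c * F m) * (X' * P * Y') * F m
          = F m * (c * ((F m * X' * (P * P) * Y') * F m)) := by
            rw [hP.eq]; simp only [Matrix.mul_assoc]
        _ = F m * (c * ((F m * X' * P) * (P * Y' * F m))) := by simp only [Matrix.mul_assoc]
        _ = F m := by rw [hcYX, (hFi m).eq]
    have := congrArg (fun M => Matrix.map M η) e
    rw [hη.map_matrix_mul (hcc.mul hmid) (hFc m), hη.map_matrix_mul hcc hmid, ηF, ηmid] at this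
    simpa using this
  have ηF' : F'.map η = P.map η := by
    rw [hF'eq, hη.map_matrix_mul ((hPc.mul hY'c).mul hcc) (hX'c.mul hPc),
      hη.map_matrix_mul (hPc.mul hY'c) hcc, ηc, hη.map_matrix_mul hPc hY'c,
      hη.map_matrix_mul hX'c hPc, hX'η, hY'η, ← hYX, Matrix.mul_one]
    calc Y * X * Y * (X * (Y * X)) = Y * (X * Y) * (X * Y) * X := by
          simp only [Matrix.mul_assoc]
      _ = Y * X := by rw [hXY, Matrix.mul_one, Matrix.mul_one]
  have hPF' : P * F' = F' := by
    rw [hF'eq]; simp only [← Matrix.mul_assoc]; rw [hP.eq]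
  have hF'P : F' * P = F' := by
    rw [hF'eq, Matrix.mul_assoc, Matrix.mul_assoc X', hP.eq]
  -- `P` and `F'` have the same symbol, so this complementary idempotent lies over the kernel of `η`
  -- and can be moved to the corner of `p - v w`.
  set G := P - F' with hGdef
  have hG : IsIdempotentElem G := by
    unfold IsIdempotentElem
    rw [hGdef, sub_mul, mul_sub, mul_sub, hP.eq, hPF', hF'P, h3.eq, sub_self, sub_zero]
  have hGc : MatCorner p G := hPc.sub hF'c
  have hF'G : F' * G = 0 := by rw [hGdef, mul_sub, hF'P, h3.eq, sub_self]
  have hGF' : G * F' = 0 := by rw [hGdef, sub_mul, hPF', h3.eq, sub_self]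
  have hPsum : IdemEquiv P (blockSum F' G) := by
    have := IdemEquiv.of_orthogonal h3 hG hF'G hGF'
    rwa [hGdef, add_sub_cancel] at this
  obtain ⟨κ, _, _, Q, hQ, hQc, hGQ⟩ := exists_idemEquiv_corner hp hv hw hwv hG hGc fun i j => by
    refine hker _ (hGc i j) ?_
    have := congrFun (congrFun ηF' i) j
    simp only [Matrix.map_apply] at this
    rw [hGdef, Matrix.sub_apply, map_sub, this, sub_self]
  obtain ⟨r, -, hr⟩ := habs κ Q hQ hQc
  have ip : IsIdempotentElem (constDiag (Fin k) p) := isIdempotentElem_constDiag hp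
  have hFp : IdemEquiv (F m) (constDiag (Fin k) p) := by
    refine ⟨constDiag (Fin k) (p * w ^ m), constDiag (Fin k) (v ^ m * p), ?_, ?_⟩
    · simp only [F, Matrix.diagonal_mul_diagonal]
      congr 1
      funext
      rw [← mul_assoc, mul_assoc (v ^ m), hp.eq]
    · simp only [Matrix.diagonal_mul_diagonal, isIdempotentElem_pow_mul_pow hp hv hwv]
  have habsorb := IdemEquiv.absorb hp hwv hv.1 hv.2 hw.1 hw.2
  set p' := p - v * w with hp'
  have ip' : IsIdempotentElem p' := by
    have e1 : w * p' = 0 := by rw [hp', mul_sub, hw.2, ← mul_assoc, hwv, hw.1, sub_self]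
    unfold IsIdempotentElem
    nth_rewrite 1 [hp']
    rw [sub_mul p, mul_assoc, e1, mul_zero, sub_zero, hp', mul_sub, hp.eq, ← mul_assoc, hv.1]
  have iu' : IsIdempotentElem (constDiag Unit p') := isIdempotentElem_constDiag ip'
  -- The chain is `P ∼ p^k ⊕ Q ∼ p^k ⊕ p' ⊕ Q ∼ p^k ⊕ p'^r ∼ p^k`: a copy of `p'` is split off from
  -- `p^k` so that the absorption hypothesis applies to `Q`, and is swallowed again at the end.
  have g1 : IdemEquiv P (blockSum (constDiag (Fin k) p) Q) :=
    hPsum.trans ((h4.symm.trans hFp h3 ip).sum hGQ) hP (isIdempotentElem_blockSum ip hQ)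
  have g2 := g1.trans ((idemEquiv_absorb_unit hp ip' habsorb hk).symm.sum (.refl hQ)) hP
    (isIdempotentElem_blockSum (isIdempotentElem_blockSum ip iu') hQ)
  have g3 := g2.trans (.sum_assoc ip iu' hQ) hP
    (isIdempotentElem_blockSum ip (isIdempotentElem_blockSum iu' hQ))
  have ir : IsIdempotentElem (constDiag (Fin r) p') := isIdempotentElem_constDiag ip'
  have g4 := g3.trans ((IdemEquiv.refl ip).sum ((IdemEquiv.sum_comm iu' hQ).trans hr
    (isIdempotentElem_blockSum iu' hQ) ir)) hP (isIdempotentElem_blockSum ip ir)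
  exact g4.trans (idemEquiv_absorb hp ip' habsorb hk r) hP ip

end Step

/-! ### Functional calculus of isometries -/

/-- The coordinate function of the circle. -/
def circleId : C(Circle, ℂ) := ⟨fun t => (t : ℂ), by fun_prop⟩

theorem circleId_mul_star : circleId * star circleId = 1 := by
  ext t
  change (t : ℂ) * (starRingEnd ℂ) (t : ℂ) = 1
  rw [Complex.mul_conj, Circle.normSq_coe, Complex.ofReal_one]

/-- The trigonometric monomials span a dense subspace. -/
theorem mem_of_monomials_mem {S : Submodule ℂ C(Circle, ℂ)} (hS : IsClosed (S : Set C(Circle, ℂ)))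
    (h₁ : ∀ k : ℕ, circleId ^ k ∈ S) (h₂ : ∀ k : ℕ, star circleId ^ k ∈ S) (f : C(Circle, ℂ)) :
    f ∈ S := by
  let B : StarSubalgebra ℂ C(Circle, ℂ) := StarAlgebra.adjoin ℂ {circleId}
  have hB : B.topologicalClosure = ⊤ := by
    refine ContinuousMap.starSubalgebra_topologicalClosure_eq_top_of_separatesPoints B ?_
    intro x y hxy
    exact ⟨_, ⟨circleId, StarAlgebra.subset_adjoin ℂ _ rfl, rfl⟩, fun h => hxy (Circle.ext h)⟩
  have hle : (B : Set C(Circle, ℂ)) ⊆ S := by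
    intro g hg
    have hg' : g ∈ Algebra.adjoin ℂ ({circleId} ∪ star {circleId} : Set C(Circle, ℂ)) := hg
    rw [← Subalgebra.mem_toSubmodule, Algebra.adjoin_eq_span] at hg'
    refine Submodule.span_le.2 ?_ hg'
    intro z hz
    rw [Set.star_singleton, Set.singleton_union, SetLike.mem_coe,
      Submonoid.mem_closure_pair] at hz
    obtain ⟨m, k, rfl⟩ := hz
    rcases le_total m k with h | h
    · obtain ⟨l, rfl⟩ := Nat.exists_eq_add_of_le h
      rw [pow_add, ← mul_assoc, ← mul_pow, circleId_mul_star, one_pow, one_mul]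
      exact h₂ l
    · obtain ⟨l, rfl⟩ := Nat.exists_eq_add_of_le h
      rw [pow_add, mul_right_comm, ← mul_pow, circleId_mul_star, one_pow, one_mul]
      exact h₁ l
  have : f ∈ (B.topologicalClosure : Set C(Circle, ℂ)) := by rw [hB]; trivial
  exact closure_minimal hle hS this

section Section

variable {A : Type*} [CStarAlgebra A]

/-- The functional calculus of a unitary element, on the whole circle. -/
theorem exists_circle_calculus {W : A} (hW : W ∈ unitary A) :
    ∃ Φ : C(Circle, ℂ) →⋆ₐ[ℂ] A, Φ circleId = W := by
  have hn : IsStarNormal W := 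
    ⟨by rw [commute_iff_eq, (Unitary.mem_iff.1 hW).1, (Unitary.mem_iff.1 hW).2]⟩
  have hs := spectrum.subset_circle_of_unitary (𝕜 := ℂ) hW
  let j : C(spectrum ℂ W, Circle) :=
    ⟨fun x => (⟨x.1, hs x.2⟩ : Submonoid.unitSphere ℂ), by
      exact Continuous.subtype_mk continuous_subtype_val _⟩
  refine ⟨(cfcHom hn).comp (ContinuousMap.compStarAlgHom' ℂ ℂ j), ?_⟩
  rw [StarAlgHom.comp_apply]
  convert cfcHom_id hn
  ext x
  rfl

theorem norm_le_one_of_isStarProjection {p : A} (hp : IsStarProjection p) : ‖p‖ ≤ 1 := by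
  have h := CStarRing.norm_star_mul_self (x := p)
  rw [hp.isSelfAdjoint.star_eq, hp.isIdempotentElem.eq] at h
  by_contra! h1
  nlinarith

/-- The Toeplitz calculus of an isometry of the corner `p A p`. -/
theorem exists_toeplitz {p v : A} (hp : IsStarProjection p) (hv : InCorner p v)
    (hvv : star v * v = p) :
    ∃ s : C(Circle, ℂ) →L[ℂ] A, (∀ f, InCorner p (s f)) ∧
      (∀ k : ℕ, s (circleId ^ k) = v ^ k * p) ∧ ∀ k : ℕ, s (star circleId ^ k) = p * star v ^ k := by
  let _ : PartialOrder A := CStarAlgebra.spectralOrder A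
  have _ : StarOrderedRing A := CStarAlgebra.spectralOrderedRing A
  -- Extending by the identity on the complement of `p` turns the isometry of the corner into an
  -- isometry of `A`.
  set V := v + (1 - p) with hV
  have hpi := hp.isIdempotentElem.eq
  have hps := hp.isSelfAdjoint.star_eq
  have hvs : star v * p = star v := by
    have := congrArg star hv.1
    rwa [star_mul, hps] at this
  have hVs : star V = star v + (1 - p) := by rw [hV, star_add, star_sub, star_one, hps]
  have hVV : star V * V = 1 := by
    have e1 : (1 - p) * v = 0 := by rw [sub_mul, one_mul, hv.1, sub_self]
    have e2 : star v * (1 - p) = 0 := by rw [mul_sub, mul_one, hvs, sub_self]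
    rw [hVs, hV, add_mul, mul_add, mul_add, hvv, e1, e2, hp.isIdempotentElem.one_sub.eq]
    abel
  have hVd : (1 - V * star V) * V = 0 := by
    rw [sub_mul, one_mul, mul_assoc, hVV, mul_one, sub_self]
  have hVd' : star V * (1 - V * star V) = 0 := by
    rw [mul_sub, mul_one, ← mul_assoc, hVV, one_mul, sub_self]
  have hVdi : (1 - V * star V) * (1 - V * star V) = 1 - V * star V := by
    rw [mul_sub (1 - V * star V), mul_one, ← mul_assoc, hVd, zero_mul, sub_zero]
  -- The unitary dilation of `V`. Being upper triangular, it has `V ^ k` in the upper left place of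
  -- `W ^ k`, so compressing its functional calculus to that place gives Toeplitz operators.
  let W : CStarMatrix (Fin 2) (Fin 2) A :=
    CStarMatrix.ofMatrix !![V, 1 - V * star V; 0, star V]
  have hWs : star W = CStarMatrix.ofMatrix !![star V, 0; 1 - V * star V, V] := by
    ext i j
    fin_cases i <;> fin_cases j <;> simp [W, CStarMatrix.star_apply]
  have hWW : star W * W = 1 := by
    rw [hWs]
    ext i j
    fin_cases i <;> fin_cases j <;>
      simp [W, CStarMatrix.mul_apply, hVV, hVd, hVd', hVdi]
  have hWW' : W * star W = 1 := by
    rw [hWs]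
    ext i j
    fin_cases i <;> fin_cases j <;>
      simp [W, CStarMatrix.mul_apply, hVV, hVd, hVd', hVdi]
  obtain ⟨Φ, hΦ⟩ := exists_circle_calculus (W := W) (Unitary.mem_iff.2 ⟨hWW, hWW'⟩)
  have hpow : ∀ k : ℕ, (W ^ k) 0 0 = V ^ k ∧ (W ^ k) 1 0 = 0 := by
    intro k
    induction k with
    | zero => simp
    | succ k ih =>
      rw [pow_succ, CStarMatrix.mul_apply, CStarMatrix.mul_apply, Fin.sum_univ_two,
        Fin.sum_univ_two, ih.1, ih.2]
      simp [W, pow_succ]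
  have hpow' : ∀ k : ℕ, (star W ^ k) 0 0 = star V ^ k := by
    intro k
    rw [← star_pow, CStarMatrix.star_apply, (hpow k).1, star_pow]
  have hpV : ∀ k : ℕ, p * V ^ k * p = v ^ k * p := by
    intro k
    have h0 : ∀ k : ℕ, V ^ k * p = v ^ k * p := by
      intro k
      induction k with
      | zero => simp
      | succ k ih =>
        have : V * (v ^ k * p) = v * (v ^ k * p) := by
          have e : (1 - p) * (v ^ k * p) = 0 := by
            cases k with
            | zero => simp [sub_mul, hpi]
            | succ k => rw [pow_succ', sub_mul, one_mul, ← mul_assoc, ← mul_assoc, hv.1, sub_self]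
          rw [hV, add_mul, e, add_zero]
        rw [pow_succ', mul_assoc, ih, this, ← mul_assoc, ← pow_succ']
    rw [mul_assoc, h0, ← mul_assoc]
    cases k with
    | zero => simp [hpi]
    | succ k => rw [pow_succ', ← mul_assoc, hv.1]
  have hpV' : ∀ k : ℕ, p * star V ^ k * p = p * star v ^ k := by
    intro k
    have := congrArg star (hpV k)
    rw [star_mul, star_mul, star_mul, star_pow, star_pow, hps] at this
    rw [mul_assoc, this]
  have hΦn : ∀ f, ‖Φ f‖ ≤ ‖f‖ := fun f => NonUnitalStarAlgHom.norm_apply_le Φ f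
  let s₀ : C(Circle, ℂ) →ₗ[ℂ] A :=
    { toFun := fun f => p * (Φ f) 0 0 * p
      map_add' := fun f g => by simp [mul_add, add_mul]
      map_smul' := fun c f => by simp }
  refine ⟨s₀.mkContinuous 1 fun f => ?_, fun f => InCorner.compress hp.isIdempotentElem _,
    fun k => ?_, fun k => ?_⟩
  · have h1 := norm_le_one_of_isStarProjection hp
    calc ‖p * (Φ f) 0 0 * p‖ ≤ ‖p‖ * ‖(Φ f) 0 0‖ * ‖p‖ :=
          (norm_mul_le _ _).trans (mul_le_mul_of_nonneg_right (norm_mul_le _ _) (norm_nonneg _))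
      _ ≤ 1 * ‖f‖ * 1 := by
          have : ‖(Φ f) 0 0‖ ≤ ‖f‖ := CStarMatrix.norm_entry_le_norm.trans (hΦn f)
          gcongr
      _ = 1 * ‖f‖ := mul_one _
  · change p * (Φ (circleId ^ k)) 0 0 * p = _
    rw [map_pow, hΦ, (hpow k).1, hpV]
  · change p * (Φ (star circleId ^ k)) 0 0 * p = _
    rw [map_pow, map_star, hΦ, hpow', hpV']

end Section

/-! ### The relations in a corner -/

section Corner

variable {A : Type*} [CStarAlgebra A]

/-- The relations of the quantum sphere for elements `y 0, …, y (m - 1)` of the corner `p A p`. -/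
structure CornerRelations (q : ℝ) (m : ℕ) (p : A) (y : ℕ → A) : Prop where
  proj : IsStarProjection p
  mem : ∀ i < m, InCorner p (y i)
  mul_comm : ∀ i j, i < j → j < m → y j * y i = (q : ℂ) • (y i * y j)
  star_mul_comm : ∀ i j, i < m → j < m → i ≠ j →
    star (y i) * y j = (q : ℂ) • (y j * star (y i))
  star_mul_self : ∀ i < m, star (y i) * y i =
    y i * star (y i) + (1 - (q : ℂ) ^ 2) • (p - ∑ j ∈ Finset.range (i + 1), y j * star (y j))
  sum_eq : ∑ i ∈ Finset.range m, y i * star (y i) = p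

/-- The corner `p A p` is generated by `y 0, …, y (m - 1)` as a C⋆-algebra. -/
def Generates (m : ℕ) (p : A) (y : ℕ → A) : Prop :=
  ∀ S : NonUnitalSubalgebra ℂ A, IsClosed (S : Set A) →
    (∀ i < m, y i ∈ S ∧ star (y i) ∈ S) → ∀ x, InCorner p x → x ∈ S

/-- The elements that map a subspace into itself by left multiplication. -/
def leftStabilizer (T : Submodule ℂ A) : NonUnitalSubalgebra ℂ A where
  carrier := {a | ∀ x ∈ T, a * x ∈ T}
  add_mem' ha hb x hx := by rw [add_mul]; exact T.add_mem (ha x hx) (hb x hx)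
  zero_mem' x _ := by rw [zero_mul]; exact T.zero_mem
  mul_mem' ha hb x hx := by rw [mul_assoc]; exact ha _ (hb x hx)
  smul_mem' c a ha x hx := by rw [smul_mul_assoc]; exact T.smul_mem c (ha x hx)

theorem isClosed_leftStabilizer {T : Submodule ℂ A} (hT : IsClosed (T : Set A)) :
    IsClosed (leftStabilizer T : Set A) := by
  have : (leftStabilizer T : Set A) = ⋂ x ∈ T, (fun a => a * x) ⁻¹' (T : Set A) := by
    ext a
    simp only [Set.mem_iInter, Set.mem_preimage]
    rfl
  rw [this]
  exact isClosed_biInter fun x _ => hT.preimage (by fun_prop)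

theorem Generates.mul_mem {m : ℕ} {p : A} {y : ℕ → A} (h : Generates m p y)
    {T : Submodule ℂ A} (hT : IsClosed (T : Set A))
    (hy : ∀ i < m, ∀ x ∈ T, y i * x ∈ T ∧ star (y i) * x ∈ T) {a x : A} (ha : InCorner p a)
    (hx : x ∈ T) : a * x ∈ T :=
  h (leftStabilizer T) (isClosed_leftStabilizer hT)
    (fun i hi => ⟨fun x hx => (hy i hi x hx).1, fun x hx => (hy i hi x hx).2⟩) a ha x hx

theorem InCorner.star {p x : A} (hp : IsStarProjection p) (h : InCorner p x) :
    InCorner p (star x) := by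
  constructor
  · have := congrArg Star.star h.2
    rwa [star_mul, hp.isSelfAdjoint.star_eq] at this
  · have := congrArg Star.star h.1
    rwa [star_mul, hp.isSelfAdjoint.star_eq] at this

/-- The defect of a generator. -/
def defect (p y : A) : A := p - y * star y

/-- The projection onto the complement of the range of a generator. -/
def nextProj (p y : A) : A := limUnder atTop fun k : ℕ => defect p y ^ k

/-- The inverse square root of `1 - q² d`. -/
def invSqrt (q : ℝ) (d : A) : A := cfc (fun x : ℝ => (√(1 - q ^ 2 * x))⁻¹) d

/-- The isometric part of a generator. -/
def isoPart (q : ℝ) (p y : A) : A := y * invSqrt q (defect p y)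

/-! ### The element `(1 - q² d)^(-1/2)` -/

section InvSqrt

variable {q : ℝ} {d : A}

theorem one_sub_pos_of_mem_spectrum (hq0 : 0 < q) (hq1 : q < 1) (hn : ‖d‖ ≤ 1) {x : ℝ}
    (hx : x ∈ spectrum ℝ d) : 0 < 1 - q ^ 2 * x := by
  have h1 := spectrum.norm_le_norm_mul_of_mem hx
  have h2 : ‖(1 : A)‖ ≤ 1 := norm_le_one_of_isStarProjection (p := 1) ⟨one_mul 1, star_one A⟩
  have h3 : |x| ≤ 1 := by
    rw [← Real.norm_eq_abs]
    exact h1.trans (mul_le_one₀ hn (norm_nonneg _) h2)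
  have h4 := (abs_le.1 h3).2
  nlinarith [pow_pos hq0 2, mul_pos (sub_pos.2 hq1) (by linarith : 0 < 1 + q)]

theorem continuousOn_sqrt_spectrum (q : ℝ) (d : A) :
    ContinuousOn (fun x : ℝ => √(1 - q ^ 2 * x)) (spectrum ℝ d) := by fun_prop

theorem continuousOn_invSqrt (hq0 : 0 < q) (hq1 : q < 1) (hn : ‖d‖ ≤ 1) :
    ContinuousOn (fun x : ℝ => (√(1 - q ^ 2 * x))⁻¹) (spectrum ℝ d) :=
  (continuousOn_sqrt_spectrum q d).inv₀ fun _ hx =>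
    (Real.sqrt_pos.2 (one_sub_pos_of_mem_spectrum hq0 hq1 hn hx)).ne'

theorem isSelfAdjoint_invSqrt : IsSelfAdjoint (invSqrt q d) := cfc_predicate _ d

theorem commute_invSqrt {x : A} (h : Commute d x) : Commute (invSqrt q d) x := h.cfc_real _

theorem invSqrt_mul_self (hq0 : 0 < q) (hq1 : q < 1) (hd : IsSelfAdjoint d) (hn : ‖d‖ ≤ 1) :
    invSqrt q d * invSqrt q d * (1 - (q : ℂ) ^ 2 • d) = 1 := by
  have hc := continuousOn_invSqrt hq0 hq1 hn
  have e : 1 - (q : ℂ) ^ 2 • d = cfc (fun x : ℝ => 1 - q ^ 2 * x) d := by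
    rw [cfc_sub (fun _ => 1) (fun x => q ^ 2 * x) d, cfc_const_one ℝ d, cfc_const_mul_id _ d hd]
    congr 1
    rw [← Complex.coe_smul]
    simp
  have hcc : ContinuousOn (fun x : ℝ => (√(1 - q ^ 2 * x))⁻¹ * (√(1 - q ^ 2 * x))⁻¹)
      (spectrum ℝ d) := hc.mul hc
  rw [e, invSqrt, ← cfc_mul _ _ d hc hc, ← cfc_mul _ _ d hcc (by fun_prop),
    ← cfc_const_one ℝ d]
  refine cfc_congr fun x hx => ?_
  have h0 := one_sub_pos_of_mem_spectrum hq0 hq1 hn hx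
  rw [← mul_inv, Real.mul_self_sqrt h0.le, inv_mul_cancel₀ h0.ne']

/-- `invSqrt q d - 1` is a multiple of `d`. -/
theorem exists_invSqrt_eq (hq0 : 0 < q) (hq1 : q < 1) (hd : IsSelfAdjoint d) (hn : ‖d‖ ≤ 1) :
    ∃ c : A, invSqrt q d = 1 + d * c ∧ ∀ x, Commute d x → Commute c x := by
  have hc := continuousOn_invSqrt hq0 hq1 hn
  have hc' : ContinuousOn (fun x : ℝ => q ^ 2 * (√(1 - q ^ 2 * x) * (1 + √(1 - q ^ 2 * x)))⁻¹)
      (spectrum ℝ d) := by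
    refine continuousOn_const.mul (ContinuousOn.inv₀ (by fun_prop) fun x hx => ?_)
    have := Real.sqrt_pos.2 (one_sub_pos_of_mem_spectrum hq0 hq1 hn hx)
    positivity
  -- With `s = √(1 - q² x)`: `1/s - 1 = (1 - s²)/(s (1 + s)) = x · q²/(s (1 + s))`.
  refine ⟨cfc (fun x : ℝ => q ^ 2 * (√(1 - q ^ 2 * x) * (1 + √(1 - q ^ 2 * x)))⁻¹) d, ?_,
    fun x hx => hx.cfc_real _⟩
  nth_rewrite 2 [← cfc_id ℝ d]
  have hc'' : ContinuousOn (fun x : ℝ => id x *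
      (q ^ 2 * (√(1 - q ^ 2 * x) * (1 + √(1 - q ^ 2 * x)))⁻¹)) (spectrum ℝ d) :=
    continuousOn_id.mul hc'
  rw [← cfc_mul _ _ d continuousOn_id hc', ← cfc_const_one ℝ d,
    ← cfc_add d (fun _ => (1 : ℝ)) _ continuousOn_const hc'', invSqrt]
  refine cfc_congr fun x hx => ?_
  have h0 := one_sub_pos_of_mem_spectrum hq0 hq1 hn hx
  have h1 := Real.sqrt_pos.2 h0
  have h2 := Real.sq_sqrt h0.le
  simp only [id]
  field_simp
  nlinarith

end InvSqrt

/-! ### Splitting off the first generator of a corner -/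

namespace CornerRelations

variable {q : ℝ} {m : ℕ} {p : A} {y : ℕ → A} (h : CornerRelations q (m + 1) p y)
include h

theorem mem_zero : InCorner p (y 0) := h.mem 0 m.succ_pos

theorem mem_star_zero : InCorner p (star (y 0)) := h.mem_zero.star h.proj

theorem defect_mem : InCorner p (defect p (y 0)) :=
  (InCorner.self h.proj.isIdempotentElem).sub (h.mem_zero.mul h.mem_star_zero)

theorem isSelfAdjoint_defect : IsSelfAdjoint (defect p (y 0)) := by
  unfold IsSelfAdjoint defect
  rw [star_sub, star_mul, star_star, h.proj.isSelfAdjoint.star_eq]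

theorem defect_eq_sum :
    defect p (y 0) = ∑ i ∈ Finset.range m, y (i + 1) * star (y (i + 1)) := by
  rw [defect, ← h.sum_eq, Finset.sum_range_succ', add_sub_cancel_right]

theorem star_zero_mul_zero :
    star (y 0) * y 0 = p - (q : ℂ) ^ 2 • defect p (y 0) := by
  rw [h.star_mul_self 0 m.succ_pos, zero_add, Finset.sum_range_one]
  simp only [defect, sub_smul, one_smul]
  abel

/-- From `(p - y₀ y₀*) y₀ = y₀ (p - y₀* y₀)` and the quadratic relation. The factor `q²` is what
makes the powers of the defect converge. -/
theorem defect_mul_zero :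
    defect p (y 0) * y 0 = (q : ℂ) ^ 2 • (y 0 * defect p (y 0)) := by
  conv_lhs => rw [defect]
  rw [sub_mul, mul_assoc, h.star_zero_mul_zero, mul_sub, h.mem_zero.1, h.mem_zero.2,
    sub_sub_cancel, mul_smul_comm]

theorem defect_pow_mul_zero (k : ℕ) :
    defect p (y 0) ^ k * y 0 = ((q : ℂ) ^ 2) ^ k • (y 0 * defect p (y 0) ^ k) := by
  induction k with
  | zero => simp
  | succ k ih =>
    rw [pow_succ, mul_assoc, h.defect_mul_zero, mul_smul_comm, ← mul_assoc, ih, smul_mul_assoc,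
      smul_smul, mul_assoc, ← pow_succ']

theorem star_zero_pow_mul_defect (k : ℕ) :
    star (y 0) ^ k * defect p (y 0) =
      ((q : ℂ) ^ 2) ^ k • (defect p (y 0) * star (y 0) ^ k) := by
  have h1 : star (y 0) * defect p (y 0) = (q : ℂ) ^ 2 • (defect p (y 0) * star (y 0)) := by
    have := congrArg star h.defect_mul_zero
    rw [star_smul, star_mul, star_mul, h.isSelfAdjoint_defect.star_eq] at this
    simpa using this
  induction k with
  | zero => simp
  | succ k ih =>
    rw [pow_succ (star (y 0)), mul_assoc, h1, mul_smul_comm, ← mul_assoc, ih, smul_mul_assoc,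
      smul_smul, mul_assoc, ← pow_succ']

theorem norm_unit_le : ‖p‖ ≤ 1 := norm_le_one_of_isStarProjection h.proj

theorem norm_gen_le {i : ℕ} (hi : i < m + 1) : ‖y i‖ ≤ 1 := by
  let _ : PartialOrder A := CStarAlgebra.spectralOrder A
  have _ : StarOrderedRing A := CStarAlgebra.spectralOrderedRing A
  have h1 : y i * star (y i) ≤ p := by
    rw [← h.sum_eq]
    exact Finset.single_le_sum (f := fun i => y i * star (y i))
      (fun j _ => mul_star_self_nonneg (y j)) (Finset.mem_range.2 hi)
  have h2 : ‖y i * star (y i)‖ ≤ 1 :=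
    (CStarAlgebra.norm_le_norm_of_nonneg_of_le (mul_star_self_nonneg (y i)) h1).trans
      h.norm_unit_le
  rw [CStarRing.norm_self_mul_star] at h2
  nlinarith [norm_nonneg (y i)]

theorem norm_defect_le : ‖defect p (y 0)‖ ≤ 1 := by
  let _ : PartialOrder A := CStarAlgebra.spectralOrder A
  have _ : StarOrderedRing A := CStarAlgebra.spectralOrderedRing A
  have h0 : 0 ≤ defect p (y 0) := by
    rw [h.defect_eq_sum]
    exact Finset.sum_nonneg fun j _ => mul_star_self_nonneg (y (j + 1))
  have h1 : defect p (y 0) ≤ p := sub_le_self _ (mul_star_self_nonneg (y 0))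
  exact (CStarAlgebra.norm_le_norm_of_nonneg_of_le h0 h1).trans h.norm_unit_le

theorem norm_defect_pow_le (k : ℕ) : ‖defect p (y 0) ^ (k + 1)‖ ≤ 1 :=
  (norm_pow_le' _ k.succ_pos).trans (pow_le_one₀ (norm_nonneg _) h.norm_defect_le)

/-- With `y = y (i + 1)`, both `y₀ y₀* y` and `y y₀ y₀*` equal `q y₀ y y₀*`. -/
theorem commute_defect_succ {i : ℕ} (hi : i < m) : Commute (defect p (y 0)) (y (i + 1)) := by
  have h1 := h.mul_comm 0 (i + 1) i.succ_pos (Nat.succ_lt_succ hi)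
  have h2 := h.star_mul_comm 0 (i + 1) m.succ_pos (Nat.succ_lt_succ hi) i.succ_ne_zero.symm
  have h3 := h.mem (i + 1) (Nat.succ_lt_succ hi)
  unfold defect
  rw [commute_iff_eq, sub_mul, mul_sub, h3.1, h3.2, mul_assoc, h2, ← mul_assoc (y (i + 1)), h1,
    mul_smul_comm, smul_mul_assoc, mul_assoc]

theorem commute_defect_star_succ {i : ℕ} (hi : i < m) :
    Commute (defect p (y 0)) (star (y (i + 1))) := by
  have := (h.commute_defect_succ hi).star_star
  rwa [h.isSelfAdjoint_defect.star_eq] at this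

theorem commute_defect_unit : Commute (defect p (y 0)) p := by
  rw [commute_iff_eq, h.defect_mem.1, h.defect_mem.2]

variable (hq0 : 0 < q) (hq1 : q < 1)
include hq0 hq1

/-- Consecutive powers differ by `d^(k+1) y₀ y₀* = q^(2(k+1)) y₀ d^(k+1) y₀*`, so the sequence is
Cauchy with a geometric bound. The estimate starts at exponent one because `d ^ 0 = 1` need not lie
in the corner. -/
theorem tendsto_defect_pow :
    Tendsto (fun k : ℕ => defect p (y 0) ^ k) atTop (𝓝 (nextProj p (y 0))) := by
  set d := defect p (y 0) with hd
  have hdist : ∀ k : ℕ, dist (d ^ (k + 1)) (d ^ (k + 1 + 1)) ≤ 1 * (q ^ 2) ^ k := by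
    intro k
    have e : d ^ (k + 1) - d ^ (k + 1 + 1) =
        ((q : ℂ) ^ 2) ^ (k + 1) • (y 0 * d ^ (k + 1) * star (y 0)) := by
      rw [← smul_mul_assoc, ← h.defect_pow_mul_zero, mul_assoc]
      have : y 0 * star (y 0) = p - d := by rw [hd, defect, sub_sub_cancel]
      rw [this, mul_sub, ← pow_succ, pow_succ d k, mul_assoc, h.defect_mem.2, ← pow_succ]
    rw [dist_eq_norm, e, norm_smul]
    have h1 := h.norm_gen_le m.succ_pos
    have h2 := h.norm_defect_pow_le k
    have h3 : ‖y 0 * d ^ (k + 1) * star (y 0)‖ ≤ 1 := by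
      calc ‖y 0 * d ^ (k + 1) * star (y 0)‖ ≤ ‖y 0‖ * ‖d ^ (k + 1)‖ * ‖star (y 0)‖ :=
            (norm_mul_le _ _).trans (mul_le_mul_of_nonneg_right (norm_mul_le _ _) (norm_nonneg _))
        _ ≤ 1 * 1 * 1 := by rw [norm_star]; gcongr
        _ = 1 := by norm_num
    have h4 : ‖((q : ℂ) ^ 2) ^ (k + 1)‖ ≤ (q ^ 2) ^ k := by
      rw [norm_pow, norm_pow, Complex.norm_real, Real.norm_of_nonneg hq0.le]
      exact pow_le_pow_of_le_one (by positivity) (by nlinarith) (Nat.le_succ k)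
    rw [one_mul]
    calc _ ≤ (q ^ 2) ^ k * 1 := by gcongr
      _ = _ := mul_one _
  have hC : CauchySeq fun k : ℕ => d ^ (k + 1) :=
    cauchySeq_of_le_geometric _ _ (by nlinarith) hdist
  obtain ⟨x, hx⟩ := cauchySeq_tendsto_of_complete hC
  exact tendsto_nhds_limUnder ⟨x, (tendsto_add_atTop_iff_nat 1).1 hx⟩

theorem nextProj_mul_defect : nextProj p (y 0) * defect p (y 0) = nextProj p (y 0) := by
  have ht := h.tendsto_defect_pow hq0 hq1
  refine tendsto_nhds_unique (ht.mul_const _) ?_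
  simp only [← pow_succ]
  exact (tendsto_add_atTop_iff_nat 1).2 ht

theorem isSelfAdjoint_nextProj : IsSelfAdjoint (nextProj p (y 0)) := by
  have ht := h.tendsto_defect_pow hq0 hq1
  refine tendsto_nhds_unique ?_ ht
  have := (continuous_star.tendsto _).comp ht
  refine this.congr fun k => ?_
  rw [Function.comp_apply, star_pow, h.isSelfAdjoint_defect.star_eq]

theorem defect_mul_nextProj : defect p (y 0) * nextProj p (y 0) = nextProj p (y 0) := by
  have := congrArg star (h.nextProj_mul_defect hq0 hq1)
  rwa [star_mul, h.isSelfAdjoint_defect.star_eq,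
    (h.isSelfAdjoint_nextProj hq0 hq1).star_eq] at this

theorem isStarProjection_nextProj : IsStarProjection (nextProj p (y 0)) := by
  refine ⟨?_, h.isSelfAdjoint_nextProj hq0 hq1⟩
  have ht := (h.tendsto_defect_pow hq0 hq1).const_mul (nextProj p (y 0))
  refine tendsto_nhds_unique ht ?_
  refine tendsto_const_nhds.congr fun k => ?_
  induction k with
  | zero => simp
  | succ k ih => rw [pow_succ, ← mul_assoc, ← ih, h.nextProj_mul_defect hq0 hq1]

theorem nextProj_mem : InCorner p (nextProj p (y 0)) := by
  constructor
  · rw [← h.defect_mul_nextProj hq0 hq1, ← mul_assoc, h.defect_mem.1]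
  · rw [← h.nextProj_mul_defect hq0 hq1, mul_assoc, h.defect_mem.2]

/-- The limit of `d^k y₀ = q^(2k) y₀ d^k`. -/
theorem nextProj_mul_zero : nextProj p (y 0) * y 0 = 0 := by
  have ht := (h.tendsto_defect_pow hq0 hq1).mul_const (y 0)
  refine tendsto_nhds_unique ht ?_
  have hz : Tendsto (fun k : ℕ => ((q : ℂ) ^ 2) ^ k) atTop (𝓝 0) := by
    refine tendsto_pow_atTop_nhds_zero_of_norm_lt_one ?_
    rw [norm_pow, Complex.norm_real, Real.norm_of_nonneg hq0.le]
    nlinarith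
  have := hz.smul ((h.tendsto_defect_pow hq0 hq1).const_mul (y 0))
  rw [zero_smul] at this
  exact this.congr fun k => (h.defect_pow_mul_zero k).symm

theorem star_zero_mul_nextProj : star (y 0) * nextProj p (y 0) = 0 := by
  have := congrArg star (h.nextProj_mul_zero hq0 hq1)
  rwa [star_mul, (h.isSelfAdjoint_nextProj hq0 hq1).star_eq, star_zero] at this

theorem commute_nextProj {x : A} (hx : Commute (defect p (y 0)) x) :
    Commute (nextProj p (y 0)) x := by
  have ht := h.tendsto_defect_pow hq0 hq1
  refine tendsto_nhds_unique (ht.mul_const x) ?_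
  exact (ht.const_mul x).congr fun k => (hx.pow_left k).eq.symm

theorem next_mul_star {i : ℕ} (hi : i < m) :
    y (i + 1) * nextProj p (y 0) * star (y (i + 1) * nextProj p (y 0)) =
      y (i + 1) * star (y (i + 1)) * nextProj p (y 0) := by
  have c := h.commute_nextProj hq0 hq1 (h.commute_defect_star_succ hi)
  have hp' := h.isStarProjection_nextProj hq0 hq1
  rw [star_mul, hp'.isSelfAdjoint.star_eq, mul_assoc, ← mul_assoc (nextProj p (y 0)),
    hp'.isIdempotentElem.eq, c.eq, mul_assoc]

/-- The relations in the corner of the next projection. -/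
theorem next : CornerRelations q m (nextProj p (y 0))
    (fun i => y (i + 1) * nextProj p (y 0)) := by
  set p' := nextProj p (y 0)
  have hp' := h.isStarProjection_nextProj hq0 hq1
  have hi := hp'.isIdempotentElem.eq
  have hs := hp'.isSelfAdjoint.star_eq
  have c : ∀ i < m, p' * y (i + 1) = y (i + 1) * p' := fun i hi =>
    (h.commute_nextProj hq0 hq1 (h.commute_defect_succ hi)).eq
  have c' : ∀ i < m, p' * star (y (i + 1)) = star (y (i + 1)) * p' := fun i hi =>
    (h.commute_nextProj hq0 hq1 (h.commute_defect_star_succ hi)).eq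
  have mm : ∀ a b : A, p' * b = b * p' → (a * p') * (b * p') = a * b * p' := by
    intro a b hb
    rw [mul_assoc, ← mul_assoc p', hb, mul_assoc b, hi, mul_assoc]
  refine ⟨hp', fun i him => ⟨?_, ?_⟩, ?_, ?_, ?_, ?_⟩
  · rw [← mul_assoc, c i him, mul_assoc, hi]
  · rw [mul_assoc, hi]
  · intro i j hij hj
    rw [mm _ _ (c i (hij.trans hj)), mm _ _ (c j hj),
      h.mul_comm (i + 1) (j + 1) (Nat.succ_lt_succ hij) (Nat.succ_lt_succ hj), smul_mul_assoc]
  · intro i j him hjm hij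
    rw [star_mul, hs, c' i him, mm _ _ (c j hjm), mm _ _ (c' i him),
      h.star_mul_comm (i + 1) (j + 1) (Nat.succ_lt_succ him) (Nat.succ_lt_succ hjm)
        (fun e => hij (Nat.succ_injective e)), smul_mul_assoc]
  · intro i him
    -- The term of index zero on the right is lost because `star (y 0) * p' = 0`; this accounts for
    -- the shift of the range.
    have e : ∑ j ∈ Finset.range (i + 1), y (j + 1) * p' * star (y (j + 1) * p') =
        (∑ j ∈ Finset.range (i + 1 + 1), y j * star (y j)) * p' := by
      rw [Finset.sum_range_succ' _ (i + 1), add_mul, mul_assoc (y 0),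
        h.star_zero_mul_nextProj hq0 hq1, mul_zero, add_zero, Finset.sum_mul]
      exact Finset.sum_congr rfl fun j hj =>
        h.next_mul_star hq0 hq1 (by have := Finset.mem_range.1 hj; omega)
    rw [e, h.next_mul_star hq0 hq1 him, star_mul, hs, c' i him, mm _ _ (c i him),
      h.star_mul_self (i + 1) (Nat.succ_lt_succ him), add_mul, smul_mul_assoc, sub_mul,
      (h.nextProj_mem hq0 hq1).1]
  · calc _ = (∑ i ∈ Finset.range m, y (i + 1) * star (y (i + 1))) * p' := by
          rw [Finset.sum_mul]
          exact Finset.sum_congr rfl fun j hj =>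
            h.next_mul_star hq0 hq1 (Finset.mem_range.1 hj)
      _ = p' := by rw [← h.defect_eq_sum, h.defect_mul_nextProj hq0 hq1]

/-- The corner of the next projection is generated by the next generators. -/
theorem generates_next (hg : Generates (m + 1) p y) :
    Generates m (nextProj p (y 0)) (fun i => y (i + 1) * nextProj p (y 0)) := by
  intro S hS hyS x hx
  have hn := h.next hq0 hq1
  have hpp := h.nextProj_mem hq0 hq1
  have hyp := h.nextProj_mul_zero hq0 hq1
  have hsp := h.star_zero_mul_nextProj hq0 hq1
  have hnd := h.nextProj_mul_defect hq0 hq1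
  have hp' := h.isStarProjection_nextProj hq0 hq1
  have cy : ∀ i < m, Commute (nextProj p (y 0)) (y (i + 1)) := fun i hi =>
    h.commute_nextProj hq0 hq1 (h.commute_defect_succ hi)
  have cs : ∀ i < m, Commute (nextProj p (y 0)) (star (y (i + 1))) := fun i hi =>
    h.commute_nextProj hq0 hq1 (h.commute_defect_star_succ hi)
  set p' := nextProj p (y 0)
  have hi := hp'.isIdempotentElem.eq
  -- An element of the small corner is only known as a limit of polynomials in all the generators.
  -- `M` collects the `x` whose coefficients `p' y₀*^a x` all lie in `S`. Multiplication by `y 0`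
  -- lowers `a` up to a scalar, `star (y 0)` raises it, and the other generators act through `y (i +
  -- 1) * p'` up to a power of `q`. So `M` is stable on the left and contains `p'`, and `a = 0`
  -- gives the claim.
  let M : Submodule ℂ A :=
    { carrier := {x | ∀ a : ℕ, p' * star (y 0) ^ a * x ∈ S}
      add_mem' := fun hx hy a => by rw [mul_add]; exact S.add_mem (hx a) (hy a)
      zero_mem' := fun a => by rw [mul_zero]; exact S.zero_mem
      smul_mem' := fun c x hx a => by rw [mul_smul_comm]; exact S.smul_mem c (hx a) }
  have hM : IsClosed (M : Set A) := by
    have : (M : Set A) = ⋂ a : ℕ, (fun x => p' * star (y 0) ^ a * x) ⁻¹' (S : Set A) := by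
      ext x; simp [M]
    rw [this]
    exact isClosed_iInter fun a => hS.preimage (by fun_prop)
  have hpS : p' ∈ S := by
    rw [← hn.sum_eq]
    exact sum_mem fun i hi => S.mul_mem (hyS i (Finset.mem_range.1 hi)).1
      (hyS i (Finset.mem_range.1 hi)).2
  have hpM : p' ∈ M := by
    intro a
    cases a with
    | zero => simpa [hi] using hpS
    | succ a =>
      rw [pow_succ, mul_assoc, mul_assoc, hsp, mul_zero, mul_zero]
      exact S.zero_mem
  have hsu : ∀ a : ℕ, p' * star (y 0) ^ a * p = p' * star (y 0) ^ a := by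
    intro a
    cases a with
    | zero => simpa using hpp.2
    | succ a => rw [pow_succ, mul_assoc, mul_assoc, h.mem_star_zero.2]
  have key : x * p' ∈ M := by
    refine hg.mul_mem hM ?_ ⟨?_, ?_⟩ hpM
    · intro i him x hx
      cases i with
      | zero =>
        refine ⟨fun a => ?_, fun a => ?_⟩
        · cases a with
          | zero =>
            rw [pow_zero, mul_one, ← mul_assoc, hyp, zero_mul]
            exact S.zero_mem
          | succ a =>
            have e : p' * star (y 0) ^ (a + 1) * (y 0 * x) =
                (1 - (q : ℂ) ^ 2 * ((q : ℂ) ^ 2) ^ a) • (p' * star (y 0) ^ a * x) := by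
              calc p' * star (y 0) ^ (a + 1) * (y 0 * x)
                  = p' * star (y 0) ^ a * (star (y 0) * y 0) * x := by
                    rw [pow_succ]; simp only [mul_assoc]
                _ = _ := by
                    rw [h.star_zero_mul_zero, mul_sub, hsu, mul_smul_comm, mul_assoc p',
                      h.star_zero_pow_mul_defect, mul_smul_comm, ← mul_assoc, hnd, smul_smul,
                      sub_mul, smul_mul_assoc, sub_smul, one_smul]
            rw [e]
            exact S.smul_mem _ (hx a)
        · rw [← mul_assoc, mul_assoc p', ← pow_succ]
          exact hx (a + 1)
      | succ i =>
        have him' : i < m := Nat.lt_of_succ_lt_succ him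
        have e1 : ∀ a : ℕ, star (y 0) ^ a * y (i + 1) =
            (q : ℂ) ^ a • (y (i + 1) * star (y 0) ^ a) := by
          intro a
          induction a with
          | zero => simp
          | succ a ih =>
            rw [pow_succ, mul_assoc, h.star_mul_comm 0 (i + 1) m.succ_pos him
              i.succ_ne_zero.symm, mul_smul_comm, ← mul_assoc, ih, smul_mul_assoc, smul_smul,
              mul_assoc, ← pow_succ']
        have e2 : ∀ a : ℕ, star (y 0) ^ a * star (y (i + 1)) =
            (q : ℂ) ^ a • (star (y (i + 1)) * star (y 0) ^ a) := by
          intro a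
          have h1 : star (y 0) * star (y (i + 1)) =
              (q : ℂ) • (star (y (i + 1)) * star (y 0)) := by
            have := congrArg star (h.mul_comm 0 (i + 1) i.succ_pos him)
            rw [star_mul, star_smul, star_mul] at this
            simpa using this
          induction a with
          | zero => simp
          | succ a ih =>
            rw [pow_succ, mul_assoc, h1, mul_smul_comm, ← mul_assoc, ih, smul_mul_assoc,
              smul_smul, mul_assoc, ← pow_succ']
        refine ⟨fun a => ?_, fun a => ?_⟩
        · have e : p' * star (y 0) ^ a * (y (i + 1) * x) =
              (q : ℂ) ^ a • ((y (i + 1) * p') * (p' * star (y 0) ^ a * x)) := by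
            calc p' * star (y 0) ^ a * (y (i + 1) * x)
                = p' * (star (y 0) ^ a * y (i + 1)) * x := by simp only [mul_assoc]
              _ = (q : ℂ) ^ a • ((p' * p' * y (i + 1)) * (star (y 0) ^ a * x)) := by
                rw [e1, hi]; simp only [mul_smul_comm, smul_mul_assoc, mul_assoc]
              _ = _ := by
                have : p' * p' * y (i + 1) = y (i + 1) * p' * p' := by
                  rw [mul_assoc, (cy i him').eq, ← mul_assoc, (cy i him').eq]
                rw [this]
                simp only [mul_assoc]
          rw [e]
          exact S.smul_mem _ (S.mul_mem (hyS i him').1 (hx a))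
        · have e : p' * star (y 0) ^ a * (star (y (i + 1)) * x) =
              (q : ℂ) ^ a • (star (y (i + 1) * p') * (p' * star (y 0) ^ a * x)) := by
            calc p' * star (y 0) ^ a * (star (y (i + 1)) * x)
                = p' * (star (y 0) ^ a * star (y (i + 1))) * x := by simp only [mul_assoc]
              _ = (q : ℂ) ^ a • ((p' * p' * star (y (i + 1))) * (star (y 0) ^ a * x)) := by
                rw [e2, hi]; simp only [mul_smul_comm, smul_mul_assoc, mul_assoc]
              _ = _ := by
                rw [mul_assoc p', (cs i him').eq, ← mul_assoc, star_mul,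
                  hp'.isSelfAdjoint.star_eq]
                simp only [mul_assoc]
          rw [e]
          exact S.smul_mem _ (S.mul_mem (hyS i him').2 (hx a))
    · rw [← hx.1, ← mul_assoc, hpp.1]
    · rw [← hx.2, mul_assoc, hpp.2]
  have := key 0
  rwa [pow_zero, mul_one, hx.2, hx.1] at this

end CornerRelations

end Corner

/-! ### The symbol map and its kernel -/

section Symbol

variable {A : Type*} [CStarAlgebra A]

/-- A symbol map for generators of a corner: the ⋆-homomorphism from the corner to the continuous
functions on the circle which sends the first generator to the coordinate function and the other
generators to zero. -/
structure IsSymbol (m : ℕ) (p : A) (y : ℕ → A) (η : A →L[ℂ] C(Circle, ℂ)) : Prop where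
  map_mul : ∀ x y, InCorner p x → InCorner p y → η (x * y) = η x * η y
  map_star : ∀ x, InCorner p x → η (star x) = star (η x)
  map_unit : η p = 1
  map_zero : η (y 0) = circleId
  map_succ : ∀ i, i + 1 < m → η (y (i + 1)) = 0

/-- The elements that vanish under left multiplication by a sequence asymptotically. -/
def vanishing (f : ℕ → A) : Submodule ℂ A where
  carrier := {x | Tendsto (fun k => f k * x) atTop (𝓝 0)}
  add_mem' {x y} hx hy := by
    have : Tendsto _ atTop _ := Tendsto.add hx hy
    simpa [mul_add] using this
  zero_mem' := by simp
  smul_mem' c x hx := by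
    have : Tendsto _ atTop _ := Tendsto.const_smul hx c
    simpa [mul_smul_comm] using this

theorem mem_vanishing {f : ℕ → A} {x : A} :
    x ∈ vanishing f ↔ Tendsto (fun k => f k * x) atTop (𝓝 0) := Iff.rfl

theorem isClosed_vanishing {f : ℕ → A} (hf : ∀ k, ‖f k‖ ≤ 1) :
    IsClosed (vanishing f : Set A) := by
  refine isClosed_of_closure_subset fun x hx => ?_
  rw [SetLike.mem_coe, mem_vanishing, Metric.tendsto_atTop]
  intro ε hε
  obtain ⟨z, hz, hxz⟩ := Metric.mem_closure_iff.1 hx (ε / 2) (by positivity)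
  obtain ⟨N, hN⟩ := Metric.tendsto_atTop.1 (mem_vanishing.1 hz) (ε / 2) (by positivity)
  refine ⟨N, fun k hk => ?_⟩
  have h1 := hN k hk
  rw [dist_zero_right] at h1 ⊢
  have h2 : f k * x = f k * z + f k * (x - z) := by rw [← mul_add, add_sub_cancel]
  have h3 : ‖f k * (x - z)‖ ≤ ‖x - z‖ :=
    (norm_mul_le _ _).trans (mul_le_of_le_one_left (norm_nonneg _) (hf k))
  rw [dist_eq_norm] at hxz
  rw [h2]
  exact (norm_add_le _ _).trans_lt (by linarith)

theorem mul_mem_vanishing {f : ℕ → A} {x : A} (hx : x ∈ vanishing f) (z : A) :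
    x * z ∈ vanishing f := by
  have := (mem_vanishing.1 hx).mul_const z
  rw [zero_mul] at this
  exact this.congr fun k => mul_assoc _ _ _

/-- The range projections of the powers of an isometry of the corner `p A p`. -/
def rangeProj (p v : A) (k : ℕ) : A := v ^ k * p * star v ^ k

variable {p v : A}

theorem norm_rangeProj_le (hp : IsStarProjection p) (hvv : star v * v = p) (k : ℕ) :
    ‖rangeProj p v k‖ ≤ 1 := by
  have h1 := norm_le_one_of_isStarProjection hp
  have hv : ‖v‖ ≤ 1 := by
    have := CStarRing.norm_star_mul_self (x := v)
    rw [hvv] at this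
    nlinarith [norm_nonneg v]
  induction k with
  | zero => simpa [rangeProj] using h1
  | succ k ih =>
    have e : rangeProj p v (k + 1) = v * rangeProj p v k * star v := by
      rw [rangeProj, rangeProj, pow_succ', pow_succ]; simp only [mul_assoc]
    calc ‖rangeProj p v (k + 1)‖ ≤ ‖v‖ * ‖rangeProj p v k‖ * ‖star v‖ := by
          rw [e]
          exact (norm_mul_le _ _).trans
            (mul_le_mul_of_nonneg_right (norm_mul_le _ _) (norm_nonneg _))
      _ ≤ 1 * 1 * 1 := by rw [norm_star]; gcongr
      _ = 1 := by norm_num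

/-- The range projections `f k` satisfy `f (k + 1) * v = v * f k`, and likewise `star v * f (k + 1)
= f k * star v`; so the right ideal of vanishing elements is also stable under `v` and `star v` on
the left. -/
theorem iso_mul_mem_vanishing (hp : IsStarProjection p) (hv : InCorner p v)
    (hvv : star v * v = p) {x : A} (hx : x ∈ vanishing (rangeProj p v)) :
    v * x ∈ vanishing (rangeProj p v) := by
  rw [mem_vanishing] at *
  refine (tendsto_add_atTop_iff_nat 1).1 ?_
  have := hx.const_mul v
  rw [mul_zero] at this
  refine this.congr fun k => ?_
  have hc := InCorner.pow_mul_mul_pow hp.isIdempotentElem hv (hv.star hp) k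
  have e : rangeProj p v (k + 1) * v = v * rangeProj p v k := by
    calc rangeProj p v (k + 1) * v = v * (v ^ k * p * star v ^ k * (star v * v)) := by
          rw [rangeProj, pow_succ', pow_succ]; simp only [mul_assoc]
      _ = v * rangeProj p v k := by rw [hvv, hc.2]; rfl
  rw [← mul_assoc, ← mul_assoc, e]

theorem star_iso_mul_mem_vanishing (hp : IsStarProjection p) (hv : InCorner p v)
    (hvv : star v * v = p) {x : A} (hx : x ∈ vanishing (rangeProj p v)) :
    star v * x ∈ vanishing (rangeProj p v) := by
  rw [mem_vanishing] at *
  have := ((tendsto_add_atTop_iff_nat 1).2 hx).const_mul (star v)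
  rw [mul_zero] at this
  refine this.congr fun k => ?_
  have hc := InCorner.pow_mul_mul_pow hp.isIdempotentElem hv (hv.star hp) k
  have e : star v * rangeProj p v (k + 1) = rangeProj p v k * star v := by
    calc star v * rangeProj p v (k + 1) =
          (star v * v) * (v ^ k * p * star v ^ k) * star v := by
          rw [rangeProj, pow_succ', pow_succ]; simp only [mul_assoc]
      _ = rangeProj p v k * star v := by rw [hvv, hc.1]; rfl
  rw [← mul_assoc, ← mul_assoc, e]

theorem compl_mem_vanishing (hp : IsStarProjection p) (hv : InCorner p v)
    (hvv : star v * v = p) : p - v * star v ∈ vanishing (rangeProj p v) := by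
  rw [mem_vanishing]
  refine (tendsto_add_atTop_iff_nat 1).1 (tendsto_const_nhds.congr fun k => ?_)
  have hs := hv.star hp
  have : star v * (p - v * star v) = 0 := by
    rw [mul_sub, hs.2, ← mul_assoc, hvv, hs.1, sub_self]
  rw [rangeProj, pow_succ (star v), mul_assoc, mul_assoc (star v ^ k), this, mul_zero, mul_zero]

theorem star_isoPart (q : ℝ) (p y : A) :
    star (isoPart q p y) = invSqrt q (defect p y) * star y := by
  rw [isoPart, star_mul, isSelfAdjoint_invSqrt.star_eq]

theorem IsSymbol.isIdempotentElem {m : ℕ} {p : A} {y : ℕ → A} {η : A →L[ℂ] C(Circle, ℂ)}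
    (hη : IsSymbol m p y η) {ι : Type} [Fintype ι] {P : Matrix ι ι A}
    (hP : IsIdempotentElem P) (hPc : MatCorner p P) : IsIdempotentElem (P.map η) := by
  have hη' : IsCornerHom p (η : A →+ C(Circle, ℂ)) := ⟨hη.map_mul, hη.map_unit⟩
  have := hη'.map_matrix_mul hPc hPc
  rw [hP.eq] at this
  exact this.symm

namespace CornerRelations

variable {q : ℝ} {m : ℕ} {y : ℕ → A} (h : CornerRelations q (m + 1) p y)
include h

theorem isoPart_mem : InCorner p (isoPart q p (y 0)) := by
  have hc : Commute (invSqrt q (defect p (y 0))) p := commute_invSqrt h.commute_defect_unit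
  constructor
  · rw [isoPart, ← mul_assoc, h.mem_zero.1]
  · rw [isoPart, mul_assoc, hc.eq, ← mul_assoc, h.mem_zero.2]

theorem star_isoPart_mul_succ {i : ℕ} (hi : i < m) :
    star (isoPart q p (y 0)) * y (i + 1) = (q : ℂ) • (y (i + 1) * star (isoPart q p (y 0))) := by
  have hc : Commute (invSqrt q (defect p (y 0))) (y (i + 1)) := 
    commute_invSqrt (h.commute_defect_succ hi)
  rw [star_isoPart, mul_assoc, h.star_mul_comm 0 (i + 1) m.succ_pos (Nat.succ_lt_succ hi)
    i.succ_ne_zero.symm, mul_smul_comm, ← mul_assoc, hc.eq, mul_assoc]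

theorem star_isoPart_mul_star_succ {i : ℕ} (hi : i < m) :
    star (isoPart q p (y 0)) * star (y (i + 1)) =
      (q : ℂ) • (star (y (i + 1)) * star (isoPart q p (y 0))) := by
  have hc : Commute (invSqrt q (defect p (y 0))) (star (y (i + 1))) :=
    commute_invSqrt (h.commute_defect_star_succ hi)
  have h1 : star (y 0) * star (y (i + 1)) = (q : ℂ) • (star (y (i + 1)) * star (y 0)) := by
    have := congrArg star (h.mul_comm 0 (i + 1) i.succ_pos (Nat.succ_lt_succ hi))
    rw [star_mul, star_smul, star_mul] at this
    simpa using this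
  rw [star_isoPart, mul_assoc, h1, mul_smul_comm, ← mul_assoc, hc.eq, mul_assoc]

variable (hq0 : 0 < q) (hq1 : q < 1)
include hq0 hq1

theorem invSqrt_mul_invSqrt_mul :
    invSqrt q (defect p (y 0)) * invSqrt q (defect p (y 0)) *
      (p - (q : ℂ) ^ 2 • defect p (y 0)) = p := by
  have e := invSqrt_mul_self hq0 hq1 h.isSelfAdjoint_defect h.norm_defect_le
  have e' : p - (q : ℂ) ^ 2 • defect p (y 0) = (1 - (q : ℂ) ^ 2 • defect p (y 0)) * p := by
    rw [sub_mul, one_mul, smul_mul_assoc, h.defect_mem.2]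
  rw [e', ← mul_assoc, e, one_mul]

theorem star_isoPart_mul_isoPart : star (isoPart q p (y 0)) * isoPart q p (y 0) = p := by
  set r := invSqrt q (defect p (y 0)) with hr
  have hc : Commute r (p - (q : ℂ) ^ 2 • defect p (y 0)) :=
    commute_invSqrt (h.commute_defect_unit.sub_right ((Commute.refl _).smul_right _))
  calc star (isoPart q p (y 0)) * isoPart q p (y 0) = r * (star (y 0) * y 0) * r := by
        rw [star_isoPart, isoPart]; simp only [mul_assoc]; rfl
    _ = r * r * (p - (q : ℂ) ^ 2 • defect p (y 0)) := by
        rw [h.star_zero_mul_zero, mul_assoc, ← hc.eq, mul_assoc]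
    _ = p := h.invSqrt_mul_invSqrt_mul hq0 hq1

/-- `p - v v*` kills `y₀` from the left, so right multiplication by the defect, and by the limit of
its powers, fixes it. As `v*` annihilates this limit, the same product is the limit itself. -/
theorem nextProj_eq : nextProj p (y 0) = p - isoPart q p (y 0) * star (isoPart q p (y 0)) := by
  set v := isoPart q p (y 0) with hv
  set r := invSqrt q (defect p (y 0)) with hr
  have h1 : (p - v * star v) * y 0 = 0 := by
    have : v * star v * y 0 = y 0 := by
      calc v * star v * y 0 = y 0 * (r * r * (star (y 0) * y 0)) := by
            rw [hv, star_isoPart, isoPart]; simp only [mul_assoc]; rfl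
        _ = y 0 := by
            rw [h.star_zero_mul_zero, h.invSqrt_mul_invSqrt_mul hq0 hq1, h.mem_zero.2]
    rw [sub_mul, h.mem_zero.1, this, sub_self]
  have hc : InCorner p (p - v * star v) :=
    (InCorner.self h.proj.isIdempotentElem).sub (h.isoPart_mem.mul (h.isoPart_mem.star h.proj))
  have h2 : (p - v * star v) * defect p (y 0) = p - v * star v := by
    rw [defect, mul_sub, ← mul_assoc, h1, zero_mul, sub_zero, hc.2]
  have h3 : (p - v * star v) * nextProj p (y 0) = p - v * star v := by
    refine tendsto_nhds_unique ((h.tendsto_defect_pow hq0 hq1).const_mul _) ?_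
    refine tendsto_const_nhds.congr fun k => ?_
    induction k with
    | zero => simp
    | succ k ih => rw [pow_succ, ← mul_assoc, ← ih, h2]
  have h4 : star v * nextProj p (y 0) = 0 := by
    rw [hv, star_isoPart, mul_assoc, h.star_zero_mul_nextProj hq0 hq1, mul_zero]
  rw [← h3, sub_mul, mul_assoc, h4, mul_zero, sub_zero, (h.nextProj_mem hq0 hq1).1]

/-- Each passage of `v*` across `x` costs a factor `q`, so `v^k p v*^k x` has norm at most `q^k
‖x‖`. -/
theorem mem_vanishing_of_star_mul {x : A} (hx : star (isoPart q p (y 0)) * x =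
    (q : ℂ) • (x * star (isoPart q p (y 0)))) :
    x ∈ vanishing (rangeProj p (isoPart q p (y 0))) := by
  set v := isoPart q p (y 0)
  have hvv := h.star_isoPart_mul_isoPart hq0 hq1
  have hnv : ‖v‖ ≤ 1 := by
    have := CStarRing.norm_star_mul_self (x := v)
    rw [hvv] at this
    nlinarith [norm_nonneg v, h.norm_unit_le]
  have e : ∀ k : ℕ, star v ^ k * x = (q : ℂ) ^ k • (x * star v ^ k) := by
    intro k
    induction k with
    | zero => simp
    | succ k ih =>
      rw [pow_succ, mul_assoc, hx, mul_smul_comm, ← mul_assoc, ih, smul_mul_assoc, smul_smul,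
        mul_assoc, ← pow_succ']
  rw [mem_vanishing]
  have hz : Tendsto (fun k : ℕ => q ^ k * ‖x‖) atTop (𝓝 0) := by
    simpa using (tendsto_pow_atTop_nhds_zero_of_lt_one hq0.le hq1).mul_const ‖x‖
  refine squeeze_zero_norm' ?_ hz
  filter_upwards [eventually_ge_atTop 1] with k hk
  rw [rangeProj, mul_assoc, e, mul_smul_comm, norm_smul, norm_pow, Complex.norm_real,
    Real.norm_of_nonneg hq0.le]
  gcongr
  have n1 : ‖v ^ k‖ ≤ 1 := (norm_pow_le' _ hk).trans (pow_le_one₀ (norm_nonneg _) hnv)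
  have n2 : ‖star v ^ k‖ ≤ 1 := (norm_pow_le' _ hk).trans
    (pow_le_one₀ (norm_nonneg _) (by rwa [norm_star]))
  calc ‖v ^ k * p * (x * star v ^ k)‖ ≤ (‖v ^ k‖ * ‖p‖) * (‖x‖ * ‖star v ^ k‖) :=
        (norm_mul_le _ _).trans (mul_le_mul (norm_mul_le _ _) (norm_mul_le _ _) (norm_nonneg _)
          (by positivity))
    _ ≤ (1 * 1) * (‖x‖ * 1) := by
        have := h.norm_unit_le
        gcongr
    _ = ‖x‖ := by ring

theorem succ_mem_vanishing {i : ℕ} (hi : i < m) :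
    y (i + 1) ∈ vanishing (rangeProj p (isoPart q p (y 0))) :=
  h.mem_vanishing_of_star_mul hq0 hq1 (h.star_isoPart_mul_succ hi)

theorem star_succ_mem_vanishing {i : ℕ} (hi : i < m) :
    star (y (i + 1)) ∈ vanishing (rangeProj p (isoPart q p (y 0))) :=
  h.mem_vanishing_of_star_mul hq0 hq1 (h.star_isoPart_mul_star_succ hi)

theorem defect_mem_vanishing :
    defect p (y 0) ∈ vanishing (rangeProj p (isoPart q p (y 0))) := by
  rw [h.defect_eq_sum]
  exact Submodule.sum_mem _ fun i hi =>
    mul_mem_vanishing (h.succ_mem_vanishing hq0 hq1 (Finset.mem_range.1 hi)) _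

/-- The two elements differ by a multiple of `y₀ d c`; the relation between `d` and `y₀` brings the
defect to the left, where membership in a right ideal can be read off. -/
theorem zero_sub_isoPart_mem_vanishing :
    y 0 - isoPart q p (y 0) ∈ vanishing (rangeProj p (isoPart q p (y 0))) := by
  obtain ⟨c, hc, -⟩ := exists_invSqrt_eq hq0 hq1 h.isSelfAdjoint_defect h.norm_defect_le
  have hq2 : (q : ℂ) ^ 2 ≠ 0 := pow_ne_zero _ (Complex.ofReal_ne_zero.2 hq0.ne')
  have e : y 0 * defect p (y 0) = ((q : ℂ) ^ 2)⁻¹ • (defect p (y 0) * y 0) := by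
    rw [h.defect_mul_zero, smul_smul, inv_mul_cancel₀ hq2, one_smul]
  have : y 0 - isoPart q p (y 0) =
      -(((q : ℂ) ^ 2)⁻¹ • (defect p (y 0) * (y 0 * c))) := by
    rw [← mul_assoc, ← smul_mul_assoc, ← e, isoPart, hc, mul_add, mul_one, mul_assoc]
    abel
  rw [this]
  exact Submodule.neg_mem _ (Submodule.smul_mem _ _
    (mul_mem_vanishing (h.defect_mem_vanishing hq0 hq1) _))

theorem star_zero_sub_mem_vanishing :
    star (y 0) - star (isoPart q p (y 0)) ∈ vanishing (rangeProj p (isoPart q p (y 0))) := by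
  obtain ⟨c, hc, -⟩ := exists_invSqrt_eq hq0 hq1 h.isSelfAdjoint_defect h.norm_defect_le
  have : star (y 0) - star (isoPart q p (y 0)) = -(defect p (y 0) * (c * star (y 0))) := by
    rw [star_isoPart, hc, add_mul, one_mul, mul_assoc]
    abel
  rw [this]
  exact Submodule.neg_mem _ (mul_mem_vanishing (h.defect_mem_vanishing hq0 hq1) _)

variable {η : A →L[ℂ] C(Circle, ℂ)} (hη : IsSymbol (m + 1) p y η)
include hη

theorem symbol_isoPart : η (isoPart q p (y 0)) = circleId := by
  obtain ⟨c, hc, hcc⟩ := exists_invSqrt_eq hq0 hq1 h.isSelfAdjoint_defect h.norm_defect_le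
  have hpi := h.proj.isIdempotentElem
  have hd : η (defect p (y 0)) = 0 := by
    rw [defect, map_sub, hη.map_unit, hη.map_mul _ _ h.mem_zero h.mem_star_zero,
      hη.map_star _ h.mem_zero, hη.map_zero, circleId_mul_star, sub_self]
  have hpc : InCorner p (p * c * p) := InCorner.compress hpi c
  -- `c` is replaced by its compression, since `η` is multiplicative only on the corner.
  have e : isoPart q p (y 0) = y 0 + y 0 * (defect p (y 0) * (p * c * p)) := by
    have : defect p (y 0) * (p * c * p) = defect p (y 0) * c * p := by
      rw [← mul_assoc, ← mul_assoc, h.defect_mem.2]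
    rw [this, isoPart, hc, mul_add, mul_one, mul_assoc, (hcc p h.commute_defect_unit).eq,
      ← mul_assoc (defect p (y 0)), h.defect_mem.2]
  rw [e, map_add, hη.map_mul _ _ h.mem_zero (h.defect_mem.mul hpc),
    hη.map_mul _ _ h.defect_mem hpc, hd, zero_mul, mul_zero, add_zero, hη.map_zero]

/-- The symbol map is surjective, and its kernel on the corner consists of the elements that
vanish asymptotically under the range projections of the powers of the isometric part. -/
theorem symbol_surjective_and_ker (hg : Generates (m + 1) p y) :
    (∀ f, ∃ x, InCorner p x ∧ η x = f) ∧
      ∀ x, InCorner p x → η x = 0 → x ∈ vanishing (rangeProj p (isoPart q p (y 0))) := by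
  have hvm : InCorner p (isoPart q p (y 0)) := h.isoPart_mem
  have hvv := h.star_isoPart_mul_isoPart hq0 hq1
  have hηv := h.symbol_isoPart hq0 hq1 hη
  have hd0 := h.zero_sub_isoPart_mem_vanishing hq0 hq1
  have hd1 := h.star_zero_sub_mem_vanishing hq0 hq1
  have hs0 := fun i hi => h.succ_mem_vanishing hq0 hq1 (i := i) hi
  have hs1 := fun i hi => h.star_succ_mem_vanishing hq0 hq1 (i := i) hi
  set v := isoPart q p (y 0)
  have hvs := hvm.star h.proj
  have hpi := h.proj.isIdempotentElem
  -- The Toeplitz map is a linear section of the symbol. Modulo vanishing elements it turns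
  -- multiplication by `circleId` into multiplication by `v`, so `x - s (η x)` remains vanishing
  -- when `x` is multiplied by a generator.
  obtain ⟨s, hsc, hs₁, hs₂⟩ := exists_toeplitz h.proj hvm hvv
  have hηs : ∀ f, η (s f) = f := by
    have key : ∀ f, f ∈ LinearMap.eqLocus ((η.comp s : C(Circle, ℂ) →L[ℂ] C(Circle, ℂ)) :
        C(Circle, ℂ) →ₗ[ℂ] C(Circle, ℂ)) LinearMap.id := by
      refine mem_of_monomials_mem ?_ (fun k => ?_) (fun k => ?_)
      · exact isClosed_eq (η.comp s).continuous continuous_id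
      · change η (s (circleId ^ k)) = circleId ^ k
        rw [hs₁]
        induction k with
        | zero => simpa using hη.map_unit
        | succ k ih =>
          have hc : InCorner p (v ^ k * p) := by rw [← hs₁]; exact hsc _
          rw [pow_succ', mul_assoc, hη.map_mul _ _ hvm hc, ih, hηv, ← pow_succ']
      · change η (s (star circleId ^ k)) = star circleId ^ k
        rw [hs₂]
        induction k with
        | zero => simpa using hη.map_unit
        | succ k ih =>
          have hc : InCorner p (p * star v ^ k) := by rw [← hs₂]; exact hsc _
          rw [pow_succ, ← mul_assoc, hη.map_mul _ _ hc hvs, ih, hη.map_star _ hvm, hηv,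
            ← pow_succ]
    exact key
  refine ⟨fun f => ⟨s f, hsc f, hηs f⟩, ?_⟩
  set I := vanishing (rangeProj p v)
  have hIc : IsClosed (I : Set A) := isClosed_vanishing (norm_rangeProj_le h.proj hvv)
  have hvI : ∀ x ∈ I, v * x ∈ I := fun x hx => iso_mul_mem_vanishing h.proj hvm hvv hx
  have hvI' : ∀ x ∈ I, star v * x ∈ I := fun x hx =>
    star_iso_mul_mem_vanishing h.proj hvm hvv hx
  have hmul : ∀ f, v * s f - s (circleId * f) ∈ I := by
    let L : C(Circle, ℂ) →L[ℂ] A :=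
      (ContinuousLinearMap.mul ℂ A v).comp s -
        s.comp (ContinuousLinearMap.mul ℂ C(Circle, ℂ) circleId)
    have key : ∀ f, f ∈ I.comap (L : C(Circle, ℂ) →ₗ[ℂ] A) := by
      refine mem_of_monomials_mem (hIc.preimage L.continuous) (fun k => ?_) (fun k => ?_)
      · change v * s (circleId ^ k) - s (circleId * circleId ^ k) ∈ I
        rw [← pow_succ', hs₁, hs₁, pow_succ', mul_assoc, sub_self]
        exact I.zero_mem
      · change v * s (star circleId ^ k) - s (circleId * star circleId ^ k) ∈ I
        cases k with
        | zero =>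
          have e1 : s (star circleId ^ 0) = p := by simpa using hs₂ 0
          have e2 : s (circleId * star circleId ^ 0) = v := by simpa [hvm.2] using hs₁ 1
          rw [e1, e2, hvm.2, sub_self]
          exact I.zero_mem
        | succ k =>
          have e1 : circleId * star circleId ^ (k + 1) = star circleId ^ k := by
            rw [pow_succ', ← mul_assoc, circleId_mul_star, one_mul]
          have hc : InCorner p (p * star v ^ k) := by rw [← hs₂]; exact hsc _
          have e2 : v * (p * star v ^ (k + 1)) = v * star v * (p * star v ^ k) := by
            rw [pow_succ', ← mul_assoc v, hvm.2, mul_assoc v, ← mul_assoc (star v) p, hvs.2]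
          rw [e1, hs₂, hs₂, e2]
          -- Negative powers are the only monomials with an error, and the error is a multiple of `p
          -- - v v*`, which the range projections eventually kill.
          have e3 : v * star v * (p * star v ^ k) - p * star v ^ k =
              -((p - v * star v) * (p * star v ^ k)) := by
            rw [sub_mul, hc.1, neg_sub]
          rw [e3]
          exact I.neg_mem (mul_mem_vanishing (compl_mem_vanishing h.proj hvm hvv) _)
    exact key
  have hmul' : ∀ f, star v * s f - s (star circleId * f) ∈ I := by
    let L : C(Circle, ℂ) →L[ℂ] A :=
      (ContinuousLinearMap.mul ℂ A (star v)).comp s -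
        s.comp (ContinuousLinearMap.mul ℂ C(Circle, ℂ) (star circleId))
    have key : ∀ f, f ∈ I.comap (L : C(Circle, ℂ) →ₗ[ℂ] A) := by
      refine mem_of_monomials_mem (hIc.preimage L.continuous) (fun k => ?_) (fun k => ?_)
      · change star v * s (circleId ^ k) - s (star circleId * circleId ^ k) ∈ I
        cases k with
        | zero =>
          have e1 : s (circleId ^ 0) = p := by simpa using hs₁ 0
          have e2 : s (star circleId * circleId ^ 0) = star v := by
            simpa [hvs.1] using hs₂ 1
          rw [e1, e2, hvs.2, sub_self]
          exact I.zero_mem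
        | succ k =>
          have e1 : star circleId * circleId ^ (k + 1) = circleId ^ k := by
            rw [pow_succ', ← mul_assoc, _root_.mul_comm (star circleId), circleId_mul_star, one_mul]
          have hc : InCorner p (v ^ k * p) := by rw [← hs₁]; exact hsc _
          rw [e1, hs₁, hs₁, pow_succ', mul_assoc, ← mul_assoc (star v), hvv, hc.1, sub_self]
          exact I.zero_mem
      · change star v * s (star circleId ^ k) - s (star circleId * star circleId ^ k) ∈ I
        rw [← pow_succ', hs₂, hs₂, ← mul_assoc, hvs.2, pow_succ', ← mul_assoc, hvs.1, sub_self]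
        exact I.zero_mem
    exact key
  -- A closed subspace containing `p` and stable under the generators from the left; since these
  -- generate the corner, it is the whole corner.
  let T : Submodule ℂ A :=
    { carrier := {x | InCorner p x ∧ x - s (η x) ∈ I}
      add_mem' := fun {x z} hx hz => ⟨hx.1.add hz.1, by
        have : x + z - s (η (x + z)) = (x - s (η x)) + (z - s (η z)) := by
          rw [map_add, map_add]; abel
        rw [this]
        exact I.add_mem hx.2 hz.2⟩
      zero_mem' := ⟨InCorner.zero, by simp⟩
      smul_mem' := fun c x hx => ⟨⟨by rw [mul_smul_comm, hx.1.1], by rw [smul_mul_assoc, hx.1.2]⟩,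
        by rw [map_smul, map_smul, ← smul_sub]; exact I.smul_mem c hx.2⟩ }
  have hT : IsClosed (T : Set A) := by
    have : (T : Set A) = ({x | p * x = x} ∩ {x | x * p = x}) ∩
        (fun x => x - s (η x)) ⁻¹' (I : Set A) := rfl
    rw [this]
    exact ((isClosed_eq (by fun_prop) continuous_id).inter
      (isClosed_eq (by fun_prop) continuous_id)).inter (hIc.preimage (by fun_prop))
  have hpT : p ∈ T := ⟨InCorner.self hpi, by
    have : s 1 = p := by simpa using hs₁ 0
    rw [hη.map_unit, this, sub_self]
    exact I.zero_mem⟩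
  have hstab : ∀ i < m + 1, ∀ x ∈ T, y i * x ∈ T ∧ star (y i) * x ∈ T := by
    rintro i him x ⟨hxc, hxI⟩
    have hyc := h.mem i him
    have hyc' := hyc.star h.proj
    refine ⟨⟨hyc.mul hxc, ?_⟩, ⟨hyc'.mul hxc, ?_⟩⟩
    · rw [hη.map_mul _ _ hyc hxc]
      cases i with
      | zero =>
        have e : y 0 * x - s (η (y 0) * η x) =
            (y 0 - v) * x + v * (x - s (η x)) + (v * s (η x) - s (circleId * η x)) := by
          rw [hη.map_zero, sub_mul, mul_sub]; abel
        rw [e]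
        exact I.add_mem (I.add_mem (mul_mem_vanishing hd0 _) (hvI _ hxI)) (hmul _)
      | succ i =>
        rw [hη.map_succ i him, zero_mul, map_zero, sub_zero]
        exact mul_mem_vanishing (hs0 i (Nat.lt_of_succ_lt_succ him)) _
    · rw [hη.map_mul _ _ hyc' hxc, hη.map_star _ hyc]
      cases i with
      | zero =>
        have e : star (y 0) * x - s (star (η (y 0)) * η x) =
            (star (y 0) - star v) * x + star v * (x - s (η x)) +
              (star v * s (η x) - s (star circleId * η x)) := by
          rw [hη.map_zero, sub_mul, mul_sub]; abel
        rw [e]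
        exact I.add_mem (I.add_mem (mul_mem_vanishing hd1 _) (hvI' _ hxI)) (hmul' _)
      | succ i =>
        rw [hη.map_succ i him, star_zero, zero_mul, map_zero, sub_zero]
        exact mul_mem_vanishing (hs1 i (Nat.lt_of_succ_lt_succ him)) _
  intro x hx h0
  have hxT := (hg.mul_mem hT hstab hx hpT).2
  rwa [hx.2, h0, map_zero, sub_zero] at hxT

/-- Over a corner with a symbol map, triviality of an idempotent is detected by the symbol. -/
theorem idemEquiv_of_symbol (hg : Generates (m + 1) p y) (habs : Absorbing (nextProj p (y 0)))
    {ι : Type} [Fintype ι] [DecidableEq ι] {P : Matrix ι ι A} (hP : IsIdempotentElem P)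
    (hPc : MatCorner p P) {k : ℕ} (hk : 0 < k) {X : Matrix (Fin k) ι C(Circle, ℂ)}
    {Y : Matrix ι (Fin k) C(Circle, ℂ)} (hYX : Y * X = P.map η) (hXY : X * Y = 1) :
    IdemEquiv P (constDiag (Fin k) p) := by
  have hvm : InCorner p (isoPart q p (y 0)) := h.isoPart_mem
  obtain ⟨h1, h2⟩ := h.symbol_surjective_and_ker hq0 hq1 hη hg
  rw [h.nextProj_eq hq0 hq1] at habs
  exact idemEquiv_constDiag_of_map (η := (η : A →+ C(Circle, ℂ))) h.proj.isIdempotentElem hvm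
    (hvm.star h.proj) (h.star_isoPart_mul_isoPart hq0 hq1)
    (norm_rangeProj_le h.proj (h.star_isoPart_mul_isoPart hq0 hq1))
    ⟨hη.map_mul, hη.map_unit⟩ h1 h2 habs hP hPc hk hYX hXY

/-- Absorption passes from the next projection to the present one. -/
theorem absorbing (hg : Generates (m + 1) p y) (habs : Absorbing (nextProj p (y 0))) :
    Absorbing p := by
  intro ι _ _ Q hQ hQc
  have hpi := h.proj.isIdempotentElem
  have iu : IsIdempotentElem (constDiag Unit p) := isIdempotentElem_constDiag hpi
  have hP := isIdempotentElem_blockSum hQ iu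
  have hPc : MatCorner p (blockSum Q (constDiag Unit p)) :=
    hQc.blockSum (MatCorner.constDiag (InCorner.self hpi))
  have he := hη.isIdempotentElem hP hPc
  obtain ⟨X, Y, hYX, hXY⟩ := exists_trivialization he
  set k := (((blockSum Q (constDiag Unit p)).map η).map fun f => f 1).rank
  -- The added summand `p` has symbol `1`, whereas `k = 0` would make `Y X` vanish.
  have hk : 0 < k := by
    rcases Nat.eq_zero_or_pos k with h0 | h0
    · exfalso
      have : IsEmpty (Fin k) := by rw [h0]; infer_instance
      have e := congrFun (congrFun hYX (Sum.inr ())) (Sum.inr ())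
      rw [Matrix.mul_apply] at e
      simp [hη.map_unit] at e
    · exact h0
  exact ⟨k, hk, h.idemEquiv_of_symbol hq0 hq1 hη hg habs hP hPc hk hYX hXY⟩

end CornerRelations

end Symbol

/-! ### Weighted shifts on `ℓ²` -/

/-- The Hilbert space of square summable functions on `S`. -/
abbrev L2 (S : Type*) : Type _ := lp (fun _ : S => ℂ) 2

section WeightedShift

variable {S : Type*}

/-- Only indices with nonzero weight contribute, and on those injectivity of `ψ` turns the sum into
a partial sum for `f`. -/
theorem sum_weighted_comp_le {b : S → ℝ} {ψ : S → S} (hb : ∀ s, |b s| ≤ 1)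
    (hψ : Set.InjOn ψ {s | b s ≠ 0}) (f : L2 S) (t : Finset S) :
    ∑ s ∈ t, ‖(b s : ℂ) * f (ψ s)‖ ^ (2 : ℝ≥0∞).toReal ≤ ‖f‖ ^ (2 : ℝ≥0∞).toReal := by
  classical
  have h2 : 0 < (2 : ℝ≥0∞).toReal := by norm_num
  calc ∑ s ∈ t, ‖(b s : ℂ) * f (ψ s)‖ ^ (2 : ℝ≥0∞).toReal
      = ∑ s ∈ t with b s ≠ 0, ‖(b s : ℂ) * f (ψ s)‖ ^ (2 : ℝ≥0∞).toReal := by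
        rw [Finset.sum_filter]
        refine Finset.sum_congr rfl fun s _ => ?_
        split_ifs with h
        · rfl
        · rw [not_not] at h
          simp [h]
    _ ≤ ∑ s ∈ t with b s ≠ 0, ‖f (ψ s)‖ ^ (2 : ℝ≥0∞).toReal := by
        refine Finset.sum_le_sum fun s _ => ?_
        refine Real.rpow_le_rpow (norm_nonneg _) ?_ h2.le
        rw [norm_mul, Complex.norm_real, Real.norm_eq_abs]
        exact mul_le_of_le_one_left (norm_nonneg _) (hb s)
    _ = ∑ u ∈ (t.filter fun s => b s ≠ 0).image ψ, ‖f u‖ ^ (2 : ℝ≥0∞).toReal := by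
        rw [Finset.sum_image]
        intro s hs s' hs' h
        exact hψ (Finset.mem_filter.1 hs).2 (Finset.mem_filter.1 hs').2 h
    _ ≤ ‖f‖ ^ (2 : ℝ≥0∞).toReal := lp.sum_rpow_le_norm_rpow h2 f _

/-- The weighted composition operator `(T f) s = b s * f (ψ s)`. -/
def weightedComp (b : S → ℝ) (ψ : S → S) (hb : ∀ s, |b s| ≤ 1)
    (hψ : Set.InjOn ψ {s | b s ≠ 0}) : L2 S →L[ℂ] L2 S :=
  LinearMap.mkContinuous
    { toFun := fun f => ⟨fun s => (b s : ℂ) * f (ψ s),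
        memℓp_gen' (sum_weighted_comp_le hb hψ f)⟩
      map_add' := fun f g => by
        ext s
        exact mul_add (b s : ℂ) (f (ψ s)) (g (ψ s))
      map_smul' := fun c f => by
        ext s
        simp only [lp.coeFn_smul, Pi.smul_apply, smul_eq_mul, RingHom.id_apply]
        ring } 1 fun f => by
      rw [one_mul]
      exact lp.norm_le_of_forall_sum_le (by norm_num) (norm_nonneg _)
        (sum_weighted_comp_le hb hψ f)

theorem weightedComp_apply {b : S → ℝ} {ψ : S → S} (hb : ∀ s, |b s| ≤ 1)
    (hψ : Set.InjOn ψ {s | b s ≠ 0}) (f : L2 S) (s : S) :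
    weightedComp b ψ hb hψ f s = (b s : ℂ) * f (ψ s) := rfl

/-- The sum defining the inner product may be reindexed along `φ`, because outside the range of `φ`
the weight is zero. -/
theorem star_weightedComp {b : S → ℝ} {φ ψ : S → S} (hb : ∀ s, |b s| ≤ 1)
    (hψ : Set.InjOn ψ {s | b s ≠ 0}) (hψφ : ∀ s, ψ (φ s) = s)
    (hφψ : ∀ s, b s ≠ 0 → φ (ψ s) = s) :
    star (weightedComp b ψ hb hψ) =
      weightedComp (fun s => b (φ s)) φ (fun _ => hb _)
        (Function.LeftInverse.injective hψφ).injOn := by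
  rw [ContinuousLinearMap.star_eq_adjoint, eq_comm, ContinuousLinearMap.eq_adjoint_iff]
  intro f g
  rw [lp.inner_eq_tsum, lp.inner_eq_tsum,
    ← (Function.LeftInverse.injective hψφ).tsum_eq (f := fun s =>
      inner ℂ (f s) (weightedComp b ψ hb hψ g s))]
  · refine tsum_congr fun s => ?_
    rw [weightedComp_apply, weightedComp_apply, hψφ]
    simp
    ring
  · intro s hs
    have : b s ≠ 0 := by
      rintro h0
      simp [weightedComp_apply, h0] at hs
    exact ⟨ψ s, hφψ s this⟩

end WeightedShift

/-! ### Realizations by weighted shifts -/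

/-- Combinatorial data for a realization of the relations by commuting weighted shifts: `φ i` is the
`i`-th shift, `ψ i` its inverse, and the weight of the `i`-th generator is the square root of
`C i - C (i + 1)`. -/
structure ShiftSystem (n : ℕ) (q : ℝ) (S : Type) where
  φ : ℕ → S → S
  ψ : ℕ → S → S
  C : ℕ → S → ℝ
  ψ_φ : ∀ i s, ψ i (φ i s) = s
  φ_φ : ∀ i j s, φ i (φ j s) = φ j (φ i s)
  ψ_ψ : ∀ i j s, ψ i (ψ j s) = ψ j (ψ i s)
  φ_ψ : ∀ i j s, i ≠ j → φ i (ψ j s) = ψ j (φ i s)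
  φ_ψ_self : ∀ i s, C i s ≠ C (i + 1) s → φ i (ψ i s) = s
  C_zero : ∀ s, C 0 s = 1
  C_last : ∀ s, C (n + 1) s = 0
  C_nonneg : ∀ i s, 0 ≤ C i s
  C_anti : ∀ i s, C (i + 1) s ≤ C i s
  C_φ_of_lt : ∀ i j s, i < j → C j (φ i s) = q ^ 2 * C j s
  C_φ_of_le : ∀ i j s, j ≤ i → C j (φ i s) = C j s

namespace ShiftSystem

variable {n : ℕ} {q : ℝ} {S : Type} (D : ShiftSystem n q S)

/-- The weights. -/
def b (i : ℕ) (s : S) : ℝ := √(D.C i s - D.C (i + 1) s)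

theorem C_le_one (i : ℕ) (s : S) : D.C i s ≤ 1 := by
  induction i with
  | zero => exact (D.C_zero s).le
  | succ i ih => exact (D.C_anti i s).trans ih

theorem abs_b_le (i : ℕ) (s : S) : |D.b i s| ≤ 1 := by
  rw [b, abs_of_nonneg (Real.sqrt_nonneg _), Real.sqrt_le_iff]
  constructor <;> linarith [D.C_le_one i s, D.C_nonneg (i + 1) s]

theorem b_mul_b (i : ℕ) (s : S) : D.b i s * D.b i s = D.C i s - D.C (i + 1) s :=
  Real.mul_self_sqrt (sub_nonneg.2 (D.C_anti i s))

theorem φ_ψ_of_b_ne_zero {i : ℕ} {s : S} (h : D.b i s ≠ 0) : D.φ i (D.ψ i s) = s :=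
  D.φ_ψ_self i s fun e => h (by rw [b, e, sub_self, Real.sqrt_zero])

theorem injOn_ψ (i : ℕ) : Set.InjOn (D.ψ i) {s | D.b i s ≠ 0} := fun s hs s' hs' h => by
  rw [← D.φ_ψ_of_b_ne_zero hs, h, D.φ_ψ_of_b_ne_zero hs']

theorem b_φ_of_lt (hq0 : 0 < q) {i j : ℕ} (h : i < j) (s : S) :
    D.b j (D.φ i s) = q * D.b j s := by
  rw [b, b, D.C_φ_of_lt i j s h, D.C_φ_of_lt i (j + 1) s (h.trans j.lt_succ_self), ← mul_sub,
    Real.sqrt_mul (by positivity), Real.sqrt_sq hq0.le]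

theorem b_φ_of_gt {i j : ℕ} (h : j < i) (s : S) : D.b j (D.φ i s) = D.b j s := by
  rw [b, b, D.C_φ_of_le i j s h.le, D.C_φ_of_le i (j + 1) s h]

/-- The operators of the realization. -/
def op (i : ℕ) : L2 S →L[ℂ] L2 S := weightedComp (D.b i) (D.ψ i) (D.abs_b_le i) (D.injOn_ψ i)

theorem op_apply (i : ℕ) (f : L2 S) (s : S) : D.op i f s = (D.b i s : ℂ) * f (D.ψ i s) := rfl

theorem star_op_apply (i : ℕ) (f : L2 S) (s : S) :
    star (D.op i) f s = (D.b i (D.φ i s) : ℂ) * f (D.φ i s) := by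
  rw [op, star_weightedComp _ _ (D.ψ_φ i) (fun s hs => D.φ_ψ_of_b_ne_zero hs),
    weightedComp_apply]

theorem op_mul_star_apply (i : ℕ) (f : L2 S) (s : S) :
    (D.op i * star (D.op i)) f s = ((D.C i s - D.C (i + 1) s : ℝ) : ℂ) * f s := by
  rw [mul_apply_eq_comp, op_apply, star_op_apply]
  by_cases h : D.b i s = 0
  · rw [← b_mul_b]; simp [h]
  · rw [D.φ_ψ_of_b_ne_zero h, ← b_mul_b]
    push_cast
    ring

theorem sum_Ioi (i : Fin (n + 1)) (s : S) :
    ∑ j ∈ Finset.Ioi i, (D.C j.1 s - D.C (j.1 + 1) s) = D.C (i.1 + 1) s := by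
  have e : ∑ j ∈ Finset.Ioi i, (D.C j.1 s - D.C (j.1 + 1) s) =
      ∑ k ∈ Finset.Ico (i.1 + 1) (n + 1), (D.C k s - D.C (k + 1) s) := by
    refine (Finset.sum_map (Finset.Ioi i) Fin.valEmbedding
      (fun k => D.C k s - D.C (k + 1) s)).symm.trans ?_
    congr 1
    ext k
    simp only [Fin.map_valEmbedding_Ioi, Finset.mem_Ioo, Finset.mem_Ico]
    omega
  rw [e, ← neg_inj, ← Finset.sum_neg_distrib]
  simp only [neg_sub]
  rw [Finset.sum_Ico_sub (fun k => D.C k s) (by omega), D.C_last, zero_sub]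

/-- `op i * star (op i)` multiplies by `C i - C (i + 1)`, so the sphere relation telescopes. The
commutation relations say how the shift `φ i` rescales the weight `b j`: by `q` if `i < j`, not at
all if `j < i`. Where a weight vanishes `φ` need not invert `ψ`, but then both sides are zero. -/
theorem relations (hq0 : 0 < q) :
    Relations q (fun i : Fin (n + 1) => D.op i.1) where
  mul_comm i j hij := by
    ext f s
    have hij' : i.1 < j.1 := hij
    simp only [mul_apply_eq_comp, smul_apply, lp.coeFn_smul,
      Pi.smul_apply, smul_eq_mul, op_apply]
    rw [D.ψ_ψ i.1 j.1]
    have e1 : D.b j s * D.b i (D.ψ j s) = D.b i s * D.b j s := by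
      by_cases h : D.b j s = 0
      · simp [h]
      · rw [← D.b_φ_of_gt hij' (D.ψ j s), D.φ_ψ_of_b_ne_zero h, mul_comm]
    have e2 : q * (D.b i s * D.b j (D.ψ i s)) = D.b i s * D.b j s := by
      by_cases h : D.b i s = 0
      · simp [h]
      · rw [mul_left_comm, ← D.b_φ_of_lt hq0 hij' (D.ψ i s), D.φ_ψ_of_b_ne_zero h]
    rw [← mul_assoc, ← mul_assoc (D.b i s : ℂ), ← mul_assoc (q : ℂ), ← Complex.ofReal_mul,
      ← Complex.ofReal_mul, ← Complex.ofReal_mul, e1, e2]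
  star_mul_comm i j hij := by
    ext f s
    have hij' : i.1 ≠ j.1 := fun h => hij (Fin.ext h)
    simp only [mul_apply_eq_comp, smul_apply, lp.coeFn_smul,
      Pi.smul_apply, smul_eq_mul, op_apply, star_op_apply]
    rw [D.φ_ψ i.1 j.1 s hij', ← mul_assoc, ← mul_assoc (D.b j s : ℂ), ← mul_assoc (q : ℂ),
      ← Complex.ofReal_mul, ← Complex.ofReal_mul, ← Complex.ofReal_mul]
    congr 2
    rw [← D.φ_ψ i.1 j.1 s hij']
    rcases lt_or_gt_of_ne hij' with h | h
    · rw [D.b_φ_of_lt hq0 h]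
      by_cases h0 : D.b j s = 0
      · simp [h0]
      · rw [← D.b_φ_of_gt h (D.φ i (D.ψ j s)), D.φ_φ, D.φ_ψ_of_b_ne_zero h0]
        ring
    · rw [D.b_φ_of_gt h]
      by_cases h0 : D.b j s = 0
      · simp [h0]
      · have : D.b i (D.φ i s) = q * D.b i (D.φ i (D.ψ j s)) := by
          rw [← D.b_φ_of_lt hq0 h, D.φ_φ, D.φ_ψ_of_b_ne_zero h0]
        rw [this]
        ring
  star_mul_self i := by
    ext f s
    rw [add_apply, lp.coeFn_add, Pi.add_apply, op_mul_star_apply,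
      smul_apply, lp.coeFn_smul, Pi.smul_apply,
      sum_apply, lp.coeFn_sum, Finset.sum_apply]
    simp only [op_mul_star_apply]
    rw [← Finset.sum_mul, ← Complex.ofReal_sum, D.sum_Ioi, mul_apply_eq_comp,
      star_op_apply, op_apply, D.ψ_φ, ← mul_assoc, ← Complex.ofReal_mul, b_mul_b,
      D.C_φ_of_le _ _ _ le_rfl, D.C_φ_of_lt _ _ _ (Nat.lt_succ_self _), smul_eq_mul]
    push_cast
    ring
  sum_eq_one := by
    ext f s
    rw [sum_apply, lp.coeFn_sum, Finset.sum_apply]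
    simp only [op_mul_star_apply]
    rw [← Finset.sum_mul, ← Complex.ofReal_sum,
      Fin.sum_univ_eq_sum_range (fun i => D.C i s - D.C (i + 1) s), Finset.sum_range_sub',
      D.C_zero, D.C_last]
    simp

/-- The realization of the relations. -/
def realization [Nonempty S] (hq0 : 0 < q) : Realization n q where
  carrier := L2 S →L[ℂ] L2 S
  cstar := inferInstance
  nontrivial := by
    classical
    obtain ⟨s⟩ := ‹Nonempty S›
    have : Nontrivial (L2 S) := ⟨⟨lp.single 2 s 1, 0, fun h => by
      have := congrArg (fun f : L2 S => f s) h
      simp at this⟩⟩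
    infer_instance
  z i := D.op i.1
  rel := D.relations hq0

theorem op_single [DecidableEq S] (i : ℕ) (u : S) :
    D.op i (lp.single 2 u 1) = (D.b i (D.φ i u) : ℂ) • lp.single 2 (D.φ i u) 1 := by
  ext s
  rw [op_apply, lp.coeFn_smul, Pi.smul_apply, smul_eq_mul]
  simp only [lp.single_apply, Pi.single_apply]
  by_cases h : s = D.φ i u
  · subst h
    simp [D.ψ_φ]
  · rw [if_neg h]
    by_cases h' : D.ψ i s = u
    · have : D.b i s = 0 := by
        by_contra h0
        exact h (by rw [← h', D.φ_ψ_of_b_ne_zero h0])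
      simp [this]
    · simp [h']

theorem star_op_single [DecidableEq S] (i : ℕ) (u : S) :
    star (D.op i) (lp.single 2 u 1) = (D.b i u : ℂ) • lp.single 2 (D.ψ i u) 1 := by
  ext s
  rw [star_op_apply, lp.coeFn_smul, Pi.smul_apply, smul_eq_mul]
  simp only [lp.single_apply, Pi.single_apply]
  by_cases h : D.φ i s = u
  · subst h
    simp [D.ψ_φ]
  · rw [if_neg h]
    by_cases h' : s = D.ψ i u
    · have : D.b i u = 0 := by
        by_contra h0
        exact h (by rw [h', D.φ_ψ_of_b_ne_zero h0])
      simp [this]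
    · simp [h']

end ShiftSystem

/-! ### The shift systems of the quantum sphere -/

section CubeSystem

variable {n : ℕ} (q : ℝ) {X : Type} (σ : Equiv.Perm X) (J : ℕ)

/-- The multi-index by which the `i`-th generator shifts in the system with `J` unilateral
shifts. -/
def bump (n J i : ℕ) (s : Fin n) : ℕ := if s.1 = i ∧ i < J then 1 else 0

/-- The product of the `q ^ (2 * w s)` over `s < i`, cut off at `i = J`. -/
def cubeWeight (i : ℕ) (w : Fin n → ℕ) : ℝ :=
  if i ≤ J then ∏ s, (if s.1 < i then (q ^ 2) ^ w s else 1) else 0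

variable {q J}

theorem cubeWeight_nonneg (i : ℕ) (w : Fin n → ℕ) : 0 ≤ cubeWeight q J i w := by
  unfold cubeWeight
  split_ifs
  · exact Finset.prod_nonneg fun s _ => by split_ifs <;> positivity
  · exact le_rfl

theorem cubeWeight_succ {i : ℕ} (hi : i < J) (hn : i < n) (w : Fin n → ℕ) :
    cubeWeight q J (i + 1) w = cubeWeight q J i w * (q ^ 2) ^ w ⟨i, hn⟩ := by
  rw [cubeWeight, if_pos (by omega), cubeWeight, if_pos hi.le]
  have : (q ^ 2) ^ w ⟨i, hn⟩ = ∏ s : Fin n, (if s = ⟨i, hn⟩ then (q ^ 2) ^ w s else 1) := by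
    rw [Finset.prod_ite_eq' Finset.univ (⟨i, hn⟩ : Fin n) fun s => (q ^ 2) ^ w s,
      if_pos (Finset.mem_univ _)]
  rw [this, ← Finset.prod_mul_distrib]
  refine Finset.prod_congr rfl fun s _ => ?_
  rcases lt_trichotomy s.1 i with h | h | h
  · rw [if_pos (by omega), if_pos h, if_neg (by rintro rfl; exact h.ne rfl), mul_one]
  · rw [if_pos (by omega), if_neg (by omega), if_pos (Fin.ext h), one_mul]
  · rw [if_neg (by omega), if_neg (by omega), if_neg (by rintro rfl; exact h.ne rfl), mul_one]

theorem cubeWeight_anti (hq0 : 0 < q) (hq1 : q < 1) (hJ : J ≤ n) (i : ℕ) (w : Fin n → ℕ) :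
    cubeWeight q J (i + 1) w ≤ cubeWeight q J i w := by
  by_cases hi : i < J
  · rw [cubeWeight_succ hi (hi.trans_le hJ)]
    exact mul_le_of_le_one_right (cubeWeight_nonneg i w)
      (pow_le_one₀ (by positivity) (pow_le_one₀ hq0.le hq1.le))
  · rw [cubeWeight, if_neg (by omega)]
    exact cubeWeight_nonneg i w

theorem cubeWeight_add_bump_of_lt (hJ : J ≤ n) {i j : ℕ} (h : i < j) (w : Fin n → ℕ) :
    cubeWeight q J j (w + bump n J i) = q ^ 2 * cubeWeight q J j w := by
  unfold cubeWeight
  split_ifs with hj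
  · have hi : i < n := by omega
    have : q ^ 2 = ∏ s : Fin n, (if s = ⟨i, hi⟩ then q ^ 2 else 1) := by
      rw [Finset.prod_ite_eq' Finset.univ (⟨i, hi⟩ : Fin n) fun _ => q ^ 2,
        if_pos (Finset.mem_univ _)]
    refine Eq.trans ?_ (congrArg (· * _) this.symm)
    rw [← Finset.prod_mul_distrib]
    refine Finset.prod_congr rfl fun s _ => ?_
    by_cases hs : s.1 = i
    · rw [if_pos (by omega), if_pos (Fin.ext hs), if_pos (by omega), Pi.add_apply, bump,
        if_pos ⟨hs, by omega⟩, pow_succ, mul_comm]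
    · rw [if_neg (c := s = ⟨i, hi⟩) (by rintro rfl; exact hs rfl), one_mul, Pi.add_apply, bump,
        if_neg (c := s.1 = i ∧ i < J) (fun h => hs h.1), add_zero]
  · rw [mul_zero]

theorem cubeWeight_add_bump_of_le {i j : ℕ} (h : j ≤ i) (w : Fin n → ℕ) :
    cubeWeight q J j (w + bump n J i) = cubeWeight q J j w := by
  unfold cubeWeight
  congr 1
  refine Finset.prod_congr rfl fun s _ => ?_
  split_ifs with hs
  · rw [Pi.add_apply, bump, if_neg (by omega), add_zero]
  · rfl

/-- Subtraction is truncated, so a unilateral shift is undone only where the entry is nonzero; at a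
zero entry the weight vanishes. -/
theorem sub_bump_add_bump {i : ℕ} {w : Fin n → ℕ} (h : ∀ (_ : i < J) (hn : i < n), w ⟨i, hn⟩ ≠ 0) :
    w - bump n J i + bump n J i = w := by
  funext s
  simp only [Pi.add_apply, Pi.sub_apply, bump]
  split_ifs with hs
  · obtain ⟨rfl, hs⟩ := hs
    have := h hs s.2
    simp only [Fin.eta] at this
    omega
  · rfl

/-- The shift system on `X × ℕⁿ` with one bilateral shift `σ` and `J` unilateral shifts. -/
def cubeSystem (hq0 : 0 < q) (hq1 : q < 1) (hJ : J ≤ n) :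
    ShiftSystem n q (X × (Fin n → ℕ)) where
  φ i s := (σ s.1, s.2 + bump n J i)
  ψ i s := (σ.symm s.1, s.2 - bump n J i)
  C i s := cubeWeight q J i s.2
  ψ_φ i s := by simp
  φ_φ i j s := by rw [Prod.mk.injEq]; exact ⟨rfl, add_right_comm _ _ _⟩
  ψ_ψ i j s := by rw [Prod.mk.injEq]; exact ⟨rfl, tsub_right_comm⟩
  φ_ψ i j s hij := by
    rw [Prod.mk.injEq]
    refine ⟨by simp, funext fun s' => ?_⟩
    simp only [Pi.add_apply, Pi.sub_apply, bump]
    split_ifs <;> omega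
  φ_ψ_self i s h := by
    rw [Prod.ext_iff]
    refine ⟨by simp, sub_bump_add_bump fun hi hn h0 => h ?_⟩
    rw [cubeWeight_succ hi hn, h0, pow_zero, mul_one]
  C_zero s := by simp [cubeWeight]
  C_last s := by rw [cubeWeight, if_neg (by omega)]
  C_nonneg i s := cubeWeight_nonneg i s.2
  C_anti i s := cubeWeight_anti hq0 hq1 hJ i s.2
  C_φ_of_lt i j s h := cubeWeight_add_bump_of_lt hJ h s.2
  C_φ_of_le i j s h := cubeWeight_add_bump_of_le h s.2

end CubeSystem

/-! ### The standard representation -/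

section StandardRep

variable {n : ℕ} {q : ℝ}

/-- The shift system of the standard representation. -/
abbrev standardSystem (n : ℕ) (hq0 : 0 < q) (hq1 : q < 1) :
    ShiftSystem n q (ℤ × (Fin n → ℕ)) :=
  cubeSystem (Equiv.addRight (1 : ℤ)) hq0 hq1 le_rfl

/-- The standard representation. -/
def standardRep (n : ℕ) (hq0 : 0 < q) (hq1 : q < 1) :
    SphereAlgebra n q →⋆ₐ[ℂ] (Hilb n →L[ℂ] Hilb n) :=
  evalAt ((standardSystem n hq0 hq1).realization hq0)

theorem standardRep_gen (hq0 : 0 < q) (hq1 : q < 1) (i : Fin (n + 1)) :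
    standardRep n hq0 hq1 (gen n q i) = (standardSystem n hq0 hq1).op i.1 := rfl

theorem sqrt_cubeWeight (hq0 : 0 < q) {i : ℕ} (hi : i ≤ n) (w : Fin n → ℕ) :
    √(cubeWeight q n i w) = ∏ s, (if s.1 < i then q ^ w s else 1) := by
  rw [cubeWeight, if_pos hi]
  have : ∏ s : Fin n, (if s.1 < i then (q ^ 2) ^ w s else 1) =
      (∏ s : Fin n, (if s.1 < i then q ^ w s else 1)) ^ 2 := by
    rw [← Finset.prod_pow]
    refine Finset.prod_congr rfl fun s _ => ?_
    split_ifs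
    · rw [← pow_mul, ← pow_mul, mul_comm]
    · rw [one_pow]
  rw [this, Real.sqrt_sq]
  exact Finset.prod_nonneg fun s _ => by split_ifs <;> positivity

theorem isStandardRep_standardRep (hq0 : 0 < q) (hq1 : q < 1) :
    IsStandardRep (standardRep n hq0 hq1) where
  gen_castSucc i m w := by
    have hb : bump n n i.1 = Pi.single i 1 := by
      funext s
      rw [bump, Pi.single_apply]
      simp [Fin.ext_iff]
    have hC : cubeWeight q n i.1 (w + bump n n i.1) - cubeWeight q n (i.1 + 1) (w + bump n n i.1) =
        cubeWeight q n i.1 w * (1 - q ^ (2 * (w i + 1))) := by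
      rw [cubeWeight_add_bump_of_le le_rfl, cubeWeight_add_bump_of_lt le_rfl (Nat.lt_succ_self _),
        cubeWeight_succ i.2 i.2]
      ring
    rw [standardRep_gen, basisVec, ShiftSystem.op_single]
    change ((√(cubeWeight q n i.1 (w + bump n n i.1) -
      cubeWeight q n (i.1 + 1) (w + bump n n i.1)) : ℝ) : ℂ) •
        basisVec (m + 1) (w + bump n n i.1) = _
    rw [hC, hb, Real.sqrt_mul (cubeWeight_nonneg _ _), sqrt_cubeWeight hq0 i.2.le,
      Finset.prod_ite, Finset.prod_const_one, mul_one]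
    congr 5
    ext s
    simp
  gen_last m w := by
    have hb : bump n n n = 0 := by
      funext s
      simp [bump]
    rw [standardRep_gen, basisVec, ShiftSystem.op_single]
    change ((√(cubeWeight q n n (w + bump n n n) -
      cubeWeight q n (n + 1) (w + bump n n n)) : ℝ) : ℂ) •
        basisVec (m + 1) (w + bump n n n) = _
    rw [hb, add_zero, show cubeWeight q n (n + 1) w = 0 from if_neg (by omega), sub_zero,
      sqrt_cubeWeight hq0 le_rfl]
    simp

end StandardRep

/-! ### The gauge action and the circle of vacuum representations -/

section Gauge

variable {n : ℕ} {q : ℝ} {B : Type} [CStarAlgebra B]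

/-- The continuous function `t ↦ t • x` on the circle. -/
def gauge (x : B) : C(Circle, B) := ⟨fun t => (t : ℂ) • x, by fun_prop⟩

theorem gauge_apply (x : B) (t : Circle) : gauge x t = (t : ℂ) • x := rfl

theorem gauge_mul_star (x y : B) : gauge x * star (gauge y) = .const _ (x * star y) := by
  ext t
  simp only [ContinuousMap.mul_apply, ContinuousMap.star_apply, gauge_apply, star_smul,
    ContinuousMap.const_apply]
  rw [smul_mul_smul_comm, Complex.star_def, Complex.mul_conj, Circle.normSq_coe,
    Complex.ofReal_one, one_smul]

theorem star_gauge_mul (x y : B) : star (gauge x) * gauge y = .const _ (star x * y) := by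
  ext t
  simp only [ContinuousMap.mul_apply, ContinuousMap.star_apply, gauge_apply, star_smul,
    ContinuousMap.const_apply]
  rw [smul_mul_smul_comm, Complex.star_def, mul_comm, Complex.mul_conj, Circle.normSq_coe,
    Complex.ofReal_one, one_smul]

/-- Every relation is homogeneous when generators have degree one and their adjoints degree minus
one, so rotating all generators by a common phase preserves it. -/
theorem Relations.gauge {z : Fin (n + 1) → B} (h : Relations q z) :
    Relations q fun i => QSphere.gauge (z i) where
  mul_comm i j hij := by
    ext t
    simp only [ContinuousMap.mul_apply, ContinuousMap.smul_apply, gauge_apply,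
      smul_mul_smul_comm, h.mul_comm i j hij]
    rw [smul_comm]
  star_mul_comm i j hij := by
    rw [star_gauge_mul, gauge_mul_star, h.star_mul_comm i j hij]
    rfl
  star_mul_self i := by
    simp only [star_gauge_mul, gauge_mul_star]
    ext t
    simp [h.star_mul_self i]
  sum_eq_one := by
    simp only [gauge_mul_star]
    ext t
    simp [h.sum_eq_one]

/-- The realization with values in functions on the circle obtained from the gauge action. -/
def Realization.gauge (T : Realization n q) : Realization n q where
  carrier := C(Circle, T.carrier)
  z i := QSphere.gauge (T.z i)
  rel := T.rel.gauge

end Gauge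

/-! ### Absorption of one idempotent by another -/

section Absorbs

variable {A : Type*} [Ring A]

/-- `p` absorbs `p'`: the diagonal sum of `p` and `p'` is equivalent to `p`. -/
def Absorbs (p p' : A) : Prop :=
  IdemEquiv (blockSum (constDiag Unit p) (constDiag Unit p')) (constDiag Unit p)

theorem Absorbs.trans {p p' p'' : A} (h : Absorbs p p') (h' : Absorbs p' p'')
    (hp : IsIdempotentElem p) (hp' : IsIdempotentElem p') (hp'' : IsIdempotentElem p'') :
    Absorbs p p'' := by
  have i0 : IsIdempotentElem (constDiag Unit p) := isIdempotentElem_constDiag hp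
  have i1 : IsIdempotentElem (constDiag Unit p') := isIdempotentElem_constDiag hp'
  have i2 : IsIdempotentElem (constDiag Unit p'') := isIdempotentElem_constDiag hp''
  have i02 := isIdempotentElem_blockSum i0 i2
  have e1 := (h.symm.sum (IdemEquiv.refl i2)).trans (IdemEquiv.sum_assoc i0 i1 i2) i02
    (isIdempotentElem_blockSum i0 (isIdempotentElem_blockSum i1 i2))
  have e2 := e1.trans ((IdemEquiv.refl i0).sum h') i02 (isIdempotentElem_blockSum i0 i1)
  exact e2.trans h i02 i0

/-- `v ^ k` is again an isometry of the corner; `k > 0` keeps the power from being the unit of `A`.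
-/
theorem absorbs_sub_pow {p v w : A} (hp : IsIdempotentElem p) (hv : InCorner p v)
    (hw : InCorner p w) (hwv : w * v = p) {k : ℕ} (hk : 0 < k) :
    Absorbs p (p - v ^ k * w ^ k) := by
  obtain ⟨k, rfl⟩ : ∃ l, k = l + 1 := ⟨k - 1, by omega⟩
  refine IdemEquiv.absorb hp ?_ ?_ ?_ ?_ ?_
  · have := isIdempotentElem_pow_mul_pow hp hv hwv (k + 1)
    rwa [show p * w ^ (k + 1) = w ^ (k + 1) by rw [pow_succ', ← mul_assoc, hw.1],
      show v ^ (k + 1) * p = v ^ (k + 1) by rw [pow_succ, mul_assoc, hv.2]] at this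
  · rw [pow_succ', ← mul_assoc, hv.1]
  · rw [pow_succ, mul_assoc, hv.2]
  · rw [pow_succ', ← mul_assoc, hw.1]
  · rw [pow_succ, mul_assoc, hw.2]

theorem pow_mul_pow_eq {p v w : A} (hp : IsIdempotentElem p) (hv : InCorner p v)
    (hwv : w * v = p) (i j : ℕ) : w ^ i * (v ^ (i + j) * p) = p * v ^ j * p := by
  induction i generalizing j with
  | zero =>
    rw [pow_zero, one_mul, zero_add]
    cases j with
    | zero => simp [hp.eq]
    | succ j => rw [pow_succ', ← mul_assoc p, hv.1]
  | succ i ih =>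
    have : p * v ^ (i + j) * p = v ^ (i + j) * p := by
      cases i + j with
      | zero => simp [hp.eq]
      | succ l => rw [pow_succ', ← mul_assoc p, hv.1]
    rw [pow_succ, mul_assoc, add_right_comm, pow_succ', mul_assoc v, ← mul_assoc w, hwv,
      ← mul_assoc p, this, ih]

/-- The complement of the range of a power of an isometry is a sum of copies of the complement of
the range of the isometry. -/
theorem idemEquiv_sub_pow {p v w : A} (hp : IsIdempotentElem p) (hv : InCorner p v)
    (hw : InCorner p w) (hwv : w * v = p) {k : ℕ} (hk : 0 < k) :
    IdemEquiv (constDiag Unit (p - v ^ k * w ^ k)) (constDiag (Fin k) (p - v * w)) := by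
  set p' := p - v * w with hp'
  have hpp : p * p' = p' := by rw [hp', mul_sub, hp.eq, ← mul_assoc, hv.1]
  have hpp' : p' * p = p' := by rw [hp', sub_mul, hp.eq, mul_assoc, hw.2]
  have hpv : p' * v = 0 := by rw [hp', sub_mul, hv.1, mul_assoc, hwv, hv.2, sub_self]
  have hwp : w * p' = 0 := by rw [hp', mul_sub, hw.2, ← mul_assoc, hwv, hw.1, sub_self]
  have hii : p' * p' = p' := by
    nth_rewrite 2 [hp']
    rw [mul_sub, hpp', ← mul_assoc, hpv, zero_mul, sub_zero]
  have hpow : ∀ i, p' * w ^ i * (v ^ i * p') = p' := fun i => by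
    have := pow_mul_pow_eq hp hv hwv i 0
    rw [add_zero, pow_zero, mul_one, hp.eq] at this
    rw [← hpp, ← mul_assoc (v ^ i), mul_assoc (p * p'), ← mul_assoc (w ^ i), this, hpp, hii]
  have hsum : p - v ^ k * w ^ k = ∑ i : Fin k, v ^ i.1 * p' * w ^ i.1 := by
    rw [← sub_pow_mul_pow_eq_sum hv k]
    obtain ⟨k, rfl⟩ : ∃ l, k = l + 1 := ⟨k - 1, by omega⟩
    rw [pow_succ v, mul_assoc _ v p, hv.2]
  -- One product is the telescoping sum for `p - v^k w^k`; in the other, `p' w^i v^j p'` is `p'` if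
  -- `i = j` and zero otherwise.
  refine ⟨Matrix.of fun i _ => p' * w ^ i.1, Matrix.of fun _ i => v ^ i.1 * p', ?_, ?_⟩
  · ext i j
    rw [Matrix.mul_apply, constDiag, Matrix.diagonal_apply_eq, hsum]
    simp only [Matrix.of_apply]
    refine Finset.sum_congr rfl fun l _ => ?_
    rw [mul_assoc, ← mul_assoc p', hii, mul_assoc]
  · ext i j
    rw [Matrix.mul_apply, Fintype.sum_unique, constDiag, Matrix.diagonal_apply, Matrix.of_apply, Matrix.of_apply]
    split_ifs with h
    · rw [h, hpow]
    · rcases lt_or_gt_of_ne (fun e => h (Fin.ext e) : i.1 ≠ j.1) with hl | hl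
      · obtain ⟨l, hl⟩ := Nat.exists_eq_add_of_lt hl
        have := pow_mul_pow_eq hp hv hwv i.1 (l + 1)
        rw [← hpp, ← mul_assoc (v ^ _), mul_assoc (p * p'), ← mul_assoc (w ^ _),
          show j.1 = i.1 + (l + 1) by omega, this, hpp, pow_succ' v, mul_assoc p, mul_assoc p,
          ← mul_assoc p', hpp', ← mul_assoc p', ← mul_assoc p', ← mul_assoc p', hpv]
        simp
      · obtain ⟨l, hl⟩ := Nat.exists_eq_add_of_lt hl
        have h1 : w ^ j.1 * (v ^ j.1 * p) = p := by
          have := pow_mul_pow_eq hp hv hwv j.1 0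
          rwa [add_zero, pow_zero, mul_one, hp.eq] at this
        have h2 : w ^ j.1 * (v ^ j.1 * p') = p' := by
          rw [← hpp, ← mul_assoc (v ^ _), ← mul_assoc, h1]
        rw [show i.1 = l + 1 + j.1 by omega, pow_add, mul_assoc, mul_assoc, h2, pow_succ,
          mul_assoc, hwp, mul_zero, mul_zero]

/-- Multiplicities of an idempotent with a symbol in a commutative ring are well defined. -/
theorem eq_of_idemEquiv_constDiag {D : Type*} [CommRing D] [Nontrivial D] {p : A} {η : A →+ D}
    (hp : IsIdempotentElem p) (hη : IsCornerHom p η) {k l : ℕ}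
    (h : IdemEquiv (constDiag (Fin k) p) (constDiag (Fin l) p)) : k = l := by
  obtain ⟨X, Y, hYX, hXY⟩ := h
  -- Compression puts `X` and `Y` into the corner. Then `η` turns them into mutually inverse
  -- matrices over a nontrivial commutative ring, which have to be square.
  have hc : ∀ {a b : ℕ} (Z : Matrix (Fin a) (Fin b) A),
      MatCorner p (constDiag (Fin a) p * Z * constDiag (Fin b) p) := fun Z i j => by
    rw [Matrix.mul_diagonal, Matrix.diagonal_mul]
    exact InCorner.compress hp _
  have ik : IsIdempotentElem (constDiag (Fin k) p) := isIdempotentElem_constDiag hp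
  have il : IsIdempotentElem (constDiag (Fin l) p) := isIdempotentElem_constDiag hp
  set P := constDiag (Fin k) p
  set Q := constDiag (Fin l) p
  have h1 : P * Y * Q * (Q * X * P) = P := by
    calc P * Y * Q * (Q * X * P) = P * Y * (Q * Q) * X * P := by simp only [Matrix.mul_assoc]
      _ = P * ((Y * X) * (Y * X)) * P := by rw [il.eq, ← hXY]; simp only [Matrix.mul_assoc]
      _ = P := by rw [hYX, ik.eq, ik.eq, ik.eq]
  have h2 : Q * X * P * (P * Y * Q) = Q := by
    calc Q * X * P * (P * Y * Q) = Q * X * (P * P) * Y * Q := by simp only [Matrix.mul_assoc]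
      _ = Q * ((X * Y) * (X * Y)) * Q := by rw [ik.eq, ← hYX]; simp only [Matrix.mul_assoc]
      _ = Q := by rw [hXY, il.eq, il.eq, il.eq]
  have hone : ∀ a : ℕ, (constDiag (Fin a) p).map η = 1 := fun a => by
    rw [constDiag, Matrix.diagonal_map (map_zero η)]
    simp only [hη.map_unit]
    exact Matrix.diagonal_one
  have h1' := congrArg (fun M => M.map η) h1
  have h2' := congrArg (fun M => M.map η) h2
  simp only [hη.map_matrix_mul (hc Y) (hc X), hη.map_matrix_mul (hc X) (hc Y), P, Q, hone] at h1' h2'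
  simpa using Matrix.square_of_invertible _ _ h1' h2'

end Absorbs

/-! ### The tower of corners -/

section Tower

variable {A : Type*} [CStarAlgebra A]

/-- The decreasing sequence of projections obtained by splitting off the generators one by one. -/
def towerProj (z : ℕ → A) : ℕ → A
  | 0 => 1
  | J + 1 => nextProj (towerProj z J) (z J * towerProj z J)

/-- The generators of the corner of `towerProj z J`. -/
def towerGen (z : ℕ → A) (J i : ℕ) : A := z (J + i) * towerProj z J

/-- The isometry of the corner of `towerProj z J`. -/
def towerIso (q : ℝ) (z : ℕ → A) (J : ℕ) : A := isoPart q (towerProj z J) (towerGen z J 0)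

theorem towerProj_succ (z : ℕ → A) (J : ℕ) :
    towerProj z (J + 1) = nextProj (towerProj z J) (towerGen z J 0) := rfl

variable {q : ℝ} {N : ℕ} {z : ℕ → A}

theorem tower_relations (hq0 : 0 < q) (hq1 : q < 1) (h : CornerRelations q N 1 z)
    (hg : Generates N 1 z) {J m : ℕ} (hJ : J + m = N) :
    CornerRelations q m (towerProj z J) (towerGen z J) ∧
      Generates m (towerProj z J) (towerGen z J) := by
  induction J generalizing m with
  | zero =>
    obtain rfl : m = N := by omega
    have : towerGen z 0 = z := funext fun i => by rw [towerGen, zero_add, towerProj, mul_one]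
    rw [this]
    exact ⟨h, hg⟩
  | succ J ih =>
    obtain ⟨h1, h2⟩ := ih (m := m + 1) (by omega)
    have e : (fun i => towerGen z J (i + 1) * nextProj (towerProj z J) (towerGen z J 0)) =
        towerGen z (J + 1) := funext fun i => by
      rw [towerGen, mul_assoc, (h1.nextProj_mem hq0 hq1).1, ← towerProj_succ, towerGen,
        show J + (i + 1) = J + 1 + i by omega]
    have h3 := h1.next hq0 hq1
    have h4 := h1.generates_next hq0 hq1 h2
    rw [e] at h3 h4
    exact ⟨h3, h4⟩

/-- The end of the tower, where no generator is left. The multiplicity must be positive, so one copy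
of zero is taken. -/
theorem absorbing_zero : Absorbing (0 : A) := fun ι _ _ Q _ hQc => by
  have h0 : Q = 0 := by
    ext i j
    rw [← (hQc i j).1, zero_mul, Matrix.zero_apply]
  refine ⟨1, one_pos, 0, 0, ?_, ?_⟩
  · rw [h0, constDiag, Matrix.diagonal_zero, Matrix.zero_mul]
    exact (Matrix.fromBlocks_zero).symm
  · rw [constDiag, Matrix.diagonal_zero, Matrix.zero_mul]

/-- Induction on the number of remaining generators, from the top of the tower down to `J`. The
symbols are a hypothesis because they come from concrete representations. -/
theorem absorbing_towerProj (hq0 : 0 < q) (hq1 : q < 1) (h : CornerRelations q N 1 z)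
    (hg : Generates N 1 z) {J m : ℕ} (hJ : J + m = N)
    (hη : ∀ J' m', J ≤ J' → J' + (m' + 1) = N →
      ∃ η, IsSymbol (m' + 1) (towerProj z J') (towerGen z J') η) :
    Absorbing (towerProj z J) := by
  induction m generalizing J with
  | zero =>
    have := (tower_relations hq0 hq1 h hg hJ).1.sum_eq
    rw [Finset.sum_range_zero] at this
    rw [← this]
    exact absorbing_zero
  | succ m ih =>
    obtain ⟨η, hη'⟩ := hη J m le_rfl hJ
    obtain ⟨h1, h2⟩ := tower_relations hq0 hq1 h hg hJ
    exact h1.absorbing hq0 hq1 hη' h2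
      (ih (J := J + 1) (by omega) fun J' m' hJ' => hη J' m' (by omega))

theorem towerProj_absorbs (hq0 : 0 < q) (hq1 : q < 1) (h : CornerRelations q N 1 z)
    (hg : Generates N 1 z) {J l : ℕ} (hl : J + l + 1 ≤ N) :
    Absorbs (towerProj z J) (towerProj z (J + l + 1)) := by
  have hproj : ∀ J ≤ N, IsIdempotentElem (towerProj z J) := fun J hJ =>
    (tower_relations hq0 hq1 h hg (Nat.add_sub_of_le hJ)).1.proj.isIdempotentElem
  have hstep : ∀ J, J + 1 ≤ N → Absorbs (towerProj z J) (towerProj z (J + 1)) := fun J hJ => by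
    obtain ⟨m, rfl⟩ := Nat.exists_eq_add_of_le hJ
    obtain ⟨h1, h2⟩ := tower_relations hq0 hq1 h hg (J := J) (m := m + 1) (by omega)
    have hv := h1.isoPart_mem
    have hw := hv.star h1.proj
    rw [towerProj_succ, h1.nextProj_eq hq0 hq1]
    have := absorbs_sub_pow h1.proj.isIdempotentElem hv hw (h1.star_isoPart_mul_isoPart hq0 hq1)
      one_pos
    rwa [pow_one, pow_one] at this
  induction l with
  | zero => exact hstep J hl
  | succ l ih =>
    exact (ih (by omega)).trans (hstep (J + l + 1) hl) (hproj _ (by omega)) (hproj _ (by omega))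
      (hproj _ hl)

end Tower

/-! ### Joint eigenvectors of representations -/

section Eigenvector

variable {A : Type*} [CStarAlgebra A] {H : Type*} [NormedAddCommGroup H] [InnerProductSpace ℂ H]
  [CompleteSpace H] (R : A →⋆ₐ[ℂ] (H →L[ℂ] H)) {e : H}

theorem continuous_rep_apply (e : H) : Continuous fun x => R x e :=
  (ContinuousLinearMap.apply ℂ H e).continuous.comp (AddMonoidHomClass.continuous_of_bound R 1 fun x => by
    simpa using NonUnitalStarAlgHom.norm_apply_le R x)

theorem rep_pow_apply {d : A} {c : ℂ} (h : R d e = c • e) (k : ℕ) : R (d ^ k) e = c ^ k • e := by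
  induction k with
  | zero => simp
  | succ k ih => rw [pow_succ, map_mul, mul_apply_eq_comp, h, map_smul, ih, smul_smul, pow_succ']

/-- On an eigenvector the powers of the defect act by `c ^ k`, which tends to one or to zero. -/
theorem rep_nextProj_apply {q : ℝ} (hq0 : 0 < q) (hq1 : q < 1) {m : ℕ} {p : A} {y : ℕ → A}
    (h : CornerRelations q (m + 1) p y) {c : ℝ} (hc0 : 0 ≤ c) (hc1 : c ≤ 1)
    (he : R (defect p (y 0)) e = (c : ℂ) • e) :
    R (nextProj p (y 0)) e = if c = 1 then e else 0 := by
  have h1 := (((continuous_rep_apply R e).tendsto _).comp (h.tendsto_defect_pow hq0 hq1))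
  refine tendsto_nhds_unique h1 ?_
  have : ((fun x => R x e) ∘ fun k => defect p (y 0) ^ k) = fun k : ℕ => (c : ℂ) ^ k • e :=
    funext fun k => rep_pow_apply R he k
  rw [this]
  split_ifs with h
  · simp [h]
  · have h2 : Tendsto (fun k : ℕ => (c : ℂ) ^ k) atTop (𝓝 0) :=
      tendsto_pow_atTop_nhds_zero_of_norm_lt_one (by
        rw [Complex.norm_real, Real.norm_of_nonneg hc0]
        exact lt_of_le_of_ne hc1 h)
    simpa using h2.smul_const e

theorem exists_sqrt_invSqrt {q : ℝ} (hq0 : 0 < q) (hq1 : q < 1) {d : A} (hn : ‖d‖ ≤ 1) :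
    ∃ t : A, IsSelfAdjoint t ∧ t * t = invSqrt q d := by
  have hc : ContinuousOn (fun x : ℝ => √(√(1 - q ^ 2 * x))⁻¹) (spectrum ℝ d) :=
    (continuousOn_invSqrt hq0 hq1 hn).sqrt
  refine ⟨cfc (fun x : ℝ => √(√(1 - q ^ 2 * x))⁻¹) d, cfc_predicate _ d, ?_⟩
  rw [← cfc_mul _ _ d hc hc, invSqrt]
  exact cfc_congr fun x _ => Real.mul_self_sqrt (inv_nonneg.2 (Real.sqrt_nonneg _))

/-- `e` is an eigenvector of `S²` with eigenvalue `ν²`, and `S = R(t)²` is positive. For `x = S e -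
ν e` one gets `S x = -ν x`, hence `-ν ‖x‖² = ‖R(t) x‖² ≥ 0` and `x = 0`. No functional calculus has
to be carried through the representation. -/
theorem rep_invSqrt_apply {q : ℝ} (hq0 : 0 < q) (hq1 : q < 1) {d : A} (hd : IsSelfAdjoint d)
    (hn : ‖d‖ ≤ 1) {c : ℝ} (hc1 : c ≤ 1) (he : R d e = (c : ℂ) • e) :
    ∃ ν : ℂ, ν ≠ 0 ∧ R (invSqrt q d) e = ν • e := by
  set S := R (invSqrt q d) with hS
  have hpos : 0 < 1 - q ^ 2 * c := by nlinarith [mul_self_nonneg q, mul_pos hq0 hq0]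
  set ν : ℝ := √(1 - q ^ 2 * c)⁻¹ with hν
  have hν0 : 0 < ν := Real.sqrt_pos.2 (inv_pos.2 hpos)
  have hνν : ν * ν * (1 - q ^ 2 * c) = 1 := by
    rw [hν, Real.mul_self_sqrt (inv_pos.2 hpos).le, inv_mul_cancel₀ hpos.ne']
  have h1 : S (S e) = ((ν * ν : ℝ) : ℂ) • e := by
    have := congrArg (fun x => R x e) (invSqrt_mul_self hq0 hq1 hd hn)
    simp only [map_mul, map_sub, map_one, map_smul, mul_apply_eq_comp, sub_apply, smul_apply,
      one_apply_eq_self, he, ← hS] at this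
    have e1 : ∀ x : H, x - (q : ℂ) ^ 2 • (c : ℂ) • x = ((1 - q ^ 2 * c : ℝ) : ℂ) • x := by
      intro x
      push_cast
      rw [sub_smul, one_smul, smul_smul]
    rw [e1] at this
    have h2 := congrArg (fun x => ((ν * ν : ℝ) : ℂ) • x) this
    simp only [smul_smul, ← Complex.ofReal_mul, hνν, Complex.ofReal_one, one_smul] at h2
    exact h2
  obtain ⟨t, ht, htt⟩ := exists_sqrt_invSqrt hq0 hq1 hn
  set x := S e - (ν : ℂ) • e with hx
  have h2 : S x = -((ν : ℂ) • x) := by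
    rw [hx, map_sub, map_smul, h1, smul_sub, smul_smul, neg_sub, Complex.ofReal_mul]
  have h3 : inner ℂ x (S x) = inner ℂ (R t x) (R t x) := by
    have : star (R t) = R t := by rw [← map_star, ht.star_eq]
    rw [hS, ← htt, map_mul, mul_apply_eq_comp]
    nth_rewrite 1 [← this]
    rw [ContinuousLinearMap.star_eq_adjoint, ContinuousLinearMap.adjoint_inner_right]
  have h4 : x = 0 := by
    rw [h2, inner_neg_right, inner_smul_right, inner_self_eq_norm_sq_to_K,
      inner_self_eq_norm_sq_to_K] at h3
    have h5 : -(ν * ‖x‖ ^ 2) = ‖R t x‖ ^ 2 := by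
      apply Complex.ofReal_injective
      push_cast
      exact h3
    have h6 : ‖x‖ ^ 2 = 0 := by
      have := sq_nonneg ‖R t x‖
      have := sq_nonneg ‖x‖
      nlinarith
    exact norm_eq_zero.1 (pow_eq_zero_iff two_ne_zero |>.1 h6)
  exact ⟨ν, Complex.ofReal_ne_zero.2 hν0.ne', sub_eq_zero.1 h4⟩

/-- The vectors annihilated by the adjoints of the first generators are fixed by the projections of
the tower. -/
theorem rep_towerProj_apply {q : ℝ} (hq0 : 0 < q) (hq1 : q < 1) {N : ℕ} {z : ℕ → A}
    (h : CornerRelations q N 1 z) (hg : Generates N 1 z) {J : ℕ} (hJ : J ≤ N)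
    (he : ∀ l < J, R (star (z l)) e = 0) : R (towerProj z J) e = e := by
  induction J with
  | zero => simp [towerProj]
  | succ J ih =>
    have ih' := ih (by omega) fun l hl => he l (by omega)
    obtain ⟨m, rfl⟩ := Nat.exists_eq_add_of_le hJ
    obtain ⟨h1, -⟩ := tower_relations hq0 hq1 h hg (J := J) (m := m + 1) (by omega)
    have hd : R (defect (towerProj z J) (towerGen z J 0)) e = ((1 : ℝ) : ℂ) • e := by
      have h0 : R (star (z J)) e = 0 := he J (by omega)
      rw [defect, towerGen, star_mul, add_zero, map_sub, sub_apply, ih', map_mul, map_mul R (star _),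
        mul_apply_eq_comp, mul_apply_eq_comp, h0]
      simp
    rw [towerProj_succ, rep_nextProj_apply R hq0 hq1 h1 zero_le_one le_rfl hd, if_pos rfl]

end Eigenvector

/-! ### The tower of corners of the quantum sphere -/

section Sphere

variable {n : ℕ} {q : ℝ}

theorem sum_Ioi_eq_sub {M : Type*} [AddCommGroup M] (f : ℕ → M) (i : Fin (n + 1)) :
    ∑ j ∈ Finset.Ioi i, f j.1 = ∑ j ∈ Finset.range (n + 1), f j -
      ∑ j ∈ Finset.range (i.1 + 1), f j := by
  rw [← Finset.sum_Ico_eq_sub f (by omega)]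
  refine (Finset.sum_map (Finset.Ioi i) Fin.valEmbedding f).symm.trans ?_
  congr 1
  ext k
  simp only [Fin.map_valEmbedding_Ioi, Finset.mem_Ioo, Finset.mem_Ico]
  omega

variable (n q) in
/-- The generators of the quantum sphere, indexed by the natural numbers. -/
def sphereGen (i : ℕ) : SphereAlgebra n q := if h : i < n + 1 then gen n q ⟨i, h⟩ else 0

theorem sphereGen_of_lt {i : ℕ} (h : i < n + 1) : sphereGen n q i = gen n q ⟨i, h⟩ := dif_pos h

theorem sphereGen_val (i : Fin (n + 1)) : sphereGen n q i.1 = gen n q i := dif_pos i.2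

theorem sphereGen_relations : CornerRelations q (n + 1) 1 (sphereGen n q) := by
  have hsum : ∑ i ∈ Finset.range (n + 1), sphereGen n q i * star (sphereGen n q i) = 1 := by
    rw [← Fin.sum_univ_eq_sum_range (fun i => sphereGen n q i * star (sphereGen n q i))]
    simp only [sphereGen_val]
    exact (gen_relations n q).sum_eq_one
  refine ⟨.one _, fun i _ => ⟨one_mul _, mul_one _⟩, fun i j hij hj => ?_,
    fun i j hi hj hij => ?_, fun i hi => ?_, hsum⟩
  · rw [sphereGen_of_lt hj, sphereGen_of_lt (hij.trans hj)]
    exact (gen_relations n q).mul_comm ⟨i, _⟩ ⟨j, _⟩ hij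
  · rw [sphereGen_of_lt hj, sphereGen_of_lt hi]
    exact (gen_relations n q).star_mul_comm ⟨i, _⟩ ⟨j, _⟩ fun h => hij (congrArg Fin.val h)
  · have h1 := (gen_relations n q).star_mul_self ⟨i, hi⟩
    simp only [← sphereGen_val] at h1
    rw [sum_Ioi_eq_sub (fun j => sphereGen n q j * star (sphereGen n q j)), hsum] at h1
    rw [h1]
    push_cast
    rfl

/-- The unit is a sum of `z z*`, so a nonunital subalgebra containing the generators and their
adjoints contains the whole algebraic span. Closedness passes to the big product because the sphere
algebra is closed in it. -/
theorem sphereGen_generates : Generates (n + 1) 1 (sphereGen n q) := by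
  intro S hS hz x _
  have h1 : (1 : SphereAlgebra n q) ∈ S := by
    rw [← sphereGen_relations.sum_eq]
    exact S.sum_mem fun i hi =>
      S.mul_mem (hz i (Finset.mem_range.1 hi)).1 (hz i (Finset.mem_range.1 hi)).2
  have hK : IsClosed (Subtype.val '' (S : Set (SphereAlgebra n q))) :=
    (StarSubalgebra.isClosed_topologicalClosure
      (StarAlgebra.adjoin ℂ (Set.range (bigGen n q)))).isClosedEmbedding_subtypeVal.isClosedMap _ hS
  have hsub : (StarAlgebra.adjoin ℂ (Set.range (bigGen n q)) : Set (BigProduct n q)) ⊆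
      Subtype.val '' (S : Set (SphereAlgebra n q)) := by
    intro y hy
    have hy' : y ∈ Algebra.adjoin ℂ (Set.range (bigGen n q) ∪ star (Set.range (bigGen n q))) := by
      rw [← StarAlgebra.adjoin_toSubalgebra]
      exact hy
    clear hy
    induction hy' using Algebra.adjoin_induction with
    | mem y hy =>
      rcases hy with ⟨i, rfl⟩ | ⟨i, hi⟩
      · exact ⟨gen n q i, by rw [← sphereGen_val]; exact (hz i.1 i.2).1, rfl⟩
      · refine ⟨star (gen n q i), by rw [← sphereGen_val]; exact (hz i.1 i.2).2, ?_⟩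
        rw [← star_star y, ← hi]
        rfl
    | algebraMap r => exact ⟨algebraMap ℂ _ r, by
        rw [Algebra.algebraMap_eq_smul_one]; exact S.smul_mem r h1, rfl⟩
    | add a b _ _ ha hb =>
      obtain ⟨a, ha, rfl⟩ := ha
      obtain ⟨b, hb, rfl⟩ := hb
      exact ⟨a + b, S.add_mem ha hb, rfl⟩
    | mul a b _ _ ha hb =>
      obtain ⟨a, ha, rfl⟩ := ha
      obtain ⟨b, hb, rfl⟩ := hb
      exact ⟨a * b, S.mul_mem ha hb, rfl⟩
  obtain ⟨x', hx', e⟩ := closure_minimal hsub hK x.2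
  rwa [Subtype.ext e] at hx'

end Sphere

/-! ### Symbol maps -/

/-- A ⋆-homomorphism of C⋆-algebras as a continuous linear map. -/
def repCLM {A B : Type*} [CStarAlgebra A] [CStarAlgebra B] (R : A →⋆ₐ[ℂ] B) : A →L[ℂ] B :=
  LinearMap.mkContinuous R.toAlgHom.toLinearMap 1 fun x => by
    simpa using NonUnitalStarAlgHom.norm_apply_le R x

/-- Evaluation at a point of the circle. -/
def evalCircle {B : Type*} [CStarAlgebra B] (t : Circle) : C(Circle, B) →⋆ₐ[ℂ] B where
  toFun f := f t
  map_one' := rfl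
  map_mul' _ _ := rfl
  map_zero' := rfl
  map_add' _ _ := rfl
  commutes' _ := rfl
  map_star' _ := rfl

section VacuumSymbol

variable {A : Type*} [CStarAlgebra A] {H : Type*} [NormedAddCommGroup H] [InnerProductSpace ℂ H]
  [CompleteSpace H]

/-- The vector functional of a family of representations parametrized by the circle. -/
def expectation (R : A →⋆ₐ[ℂ] C(Circle, H →L[ℂ] H)) (e : H) : A →L[ℂ] C(Circle, ℂ) :=
  LinearMap.mkContinuous
    { toFun := fun x => ⟨fun t => inner ℂ e (R x t e), by fun_prop⟩
      map_add' := fun x y => by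
        ext t
        simp only [map_add, ContinuousMap.add_apply, add_apply, inner_add_right,
          ContinuousMap.coe_mk]
      map_smul' := fun c x => by
        ext t
        simp only [map_smul, ContinuousMap.smul_apply, smul_apply, inner_smul_right,
          ContinuousMap.coe_mk, RingHom.id_apply, smul_eq_mul] } (‖e‖ * ‖e‖) fun x => by
    refine (ContinuousMap.norm_le _ (by positivity)).2 fun t => ?_
    calc ‖inner ℂ e (R x t e)‖ ≤ ‖e‖ * ‖R x t e‖ := norm_inner_le_norm _ _
      _ ≤ ‖e‖ * (‖R x‖ * ‖e‖) := by
        gcongr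
        exact (R x t).le_of_opNorm_le ((R x).norm_coe_le_norm t) e
      _ ≤ ‖e‖ * (‖x‖ * ‖e‖) := by
        gcongr
        exact NonUnitalStarAlgHom.norm_apply_le R x
      _ = ‖e‖ * ‖e‖ * ‖x‖ := by ring

/-- The elements that act by a scalar on a vector. -/
def scalarOn (R : A →⋆ₐ[ℂ] (H →L[ℂ] H)) (e : H) : Submodule ℂ A where
  carrier := {x | R x e = inner ℂ e (R x e) • e}
  add_mem' {x y} hx hy := by
    rw [Set.mem_ofPred_eq] at *
    rw [map_add, add_apply, inner_add_right, add_smul, ← hx, ← hy]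
  zero_mem' := by simp
  smul_mem' c x hx := by
    rw [Set.mem_ofPred_eq] at *
    rw [map_smul, smul_apply, inner_smul_right, mul_smul, ← hx]

theorem mem_scalarOn {R : A →⋆ₐ[ℂ] (H →L[ℂ] H)} {e : H} {x : A} :
    x ∈ scalarOn R e ↔ R x e = inner ℂ e (R x e) • e := Iff.rfl

theorem mem_scalarOn_of_eq {R : A →⋆ₐ[ℂ] (H →L[ℂ] H)} {e : H} (he : ‖e‖ = 1) {x : A} {c : ℂ}
    (h : R x e = c • e) : x ∈ scalarOn R e := by
  rw [mem_scalarOn, h, inner_smul_right, inner_self_eq_norm_sq_to_K, he]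
  simp

theorem isClosed_scalarOn (R : A →⋆ₐ[ℂ] (H →L[ℂ] H)) (e : H) :
    IsClosed (scalarOn R e : Set A) := by
  have h := continuous_rep_apply R e
  exact isClosed_eq h ((continuous_const.inner h).smul continuous_const)

/-- A vector functional is in general not multiplicative. Here `e` is a joint eigenvector of the
generators of the corner and of their adjoints, so the whole corner acts on it by scalars, and the
expectation restricted to the corner is a character for each `t`. -/
theorem isSymbol_of_vacuum {q : ℝ} (hq0 : 0 < q) (hq1 : q < 1) {N : ℕ} {z : ℕ → A}
    (h : CornerRelations q N 1 z) (hg : Generates N 1 z) {J m : ℕ} (hJ : J + (m + 1) = N)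
    {R : Circle → A →⋆ₐ[ℂ] (H →L[ℂ] H)} {e : H} (he : ‖e‖ = 1) {η : A →L[ℂ] C(Circle, ℂ)}
    (hη : ∀ x t, η x t = inner ℂ e (R t x e))
    (hlt : ∀ t, ∀ l < J, R t (star (z l)) e = 0)
    (heq : ∀ t, R t (z J) e = (t : ℂ) • e)
    (heq' : ∀ t, R t (star (z J)) e = star (t : ℂ) • e)
    (hgt : ∀ t l, J < l → l < N → R t (z l) e = 0 ∧ R t (star (z l)) e = 0) :
    IsSymbol (m + 1) (towerProj z J) (towerGen z J) η := by
  obtain ⟨h1, h2⟩ := tower_relations hq0 hq1 h hg hJ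
  have hee : inner ℂ e e = (1 : ℂ) := by rw [inner_self_eq_norm_sq_to_K, he]; simp
  have hp : ∀ t, R t (towerProj z J) e = e := fun t =>
    rep_towerProj_apply (R t) hq0 hq1 h hg (by omega) (hlt t)
  have hgen : ∀ t, ∀ i < m + 1, ∃ c c' : ℂ, R t (towerGen z J i) e = c • e ∧
      R t (star (towerGen z J i)) e = c' • e := by
    intro t i hi
    have key : ∃ c c' : ℂ, R t (z (J + i)) e = c • e ∧ R t (star (z (J + i))) e = c' • e := by
      cases i with
      | zero => exact ⟨_, _, heq t, heq' t⟩
      | succ i =>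
        obtain ⟨h3, h4⟩ := hgt t (J + (i + 1)) (by omega) (by omega)
        exact ⟨0, 0, by rw [h3, zero_smul], by rw [h4, zero_smul]⟩
    obtain ⟨c, c', h3, h4⟩ := key
    refine ⟨c, c', ?_, ?_⟩
    · rw [towerGen, map_mul, mul_apply_eq_comp, hp, h3]
    · rw [towerGen, star_mul, h1.proj.isSelfAdjoint.star_eq, map_mul, mul_apply_eq_comp, h4,
        map_smul, hp]
  have hscal : ∀ t x, InCorner (towerProj z J) x → R t x e = η x t • e := by
    intro t x hx
    have hstab : ∀ i < m + 1, ∀ x ∈ scalarOn (R t) e, towerGen z J i * x ∈ scalarOn (R t) e ∧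
        star (towerGen z J i) * x ∈ scalarOn (R t) e := by
      intro i hi x hx
      obtain ⟨c, c', h3, h4⟩ := hgen t i hi
      constructor
      · refine mem_scalarOn_of_eq he (c := inner ℂ e (R t x e) * c) ?_
        rw [map_mul, mul_apply_eq_comp, mem_scalarOn.1 hx, map_smul, h3, smul_smul,
          ← mem_scalarOn.1 hx]
      · refine mem_scalarOn_of_eq he (c := inner ℂ e (R t x e) * c') ?_
        rw [map_mul, mul_apply_eq_comp, mem_scalarOn.1 hx, map_smul, h4, smul_smul,
          ← mem_scalarOn.1 hx]
    have hpm : towerProj z J ∈ scalarOn (R t) e :=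
      mem_scalarOn_of_eq he (c := 1) (by rw [hp, one_smul])
    have := h2.mul_mem (isClosed_scalarOn (R t) e) hstab hx hpm
    rw [hx.2] at this
    rw [hη]
    exact mem_scalarOn.1 this
  refine ⟨fun x y hx hy => ?_, fun x _ => ?_, ?_, ?_, fun i hi => ?_⟩
  · ext t
    rw [hη, map_mul, mul_apply_eq_comp, hscal t y hy, map_smul, hscal t x hx, inner_smul_right,
      inner_smul_right, hee, mul_one, ContinuousMap.mul_apply, mul_comm]
  · ext t
    rw [hη, map_star, ContinuousLinearMap.star_eq_adjoint,
      ContinuousLinearMap.adjoint_inner_right, ← inner_conj_symm, ContinuousMap.star_apply, hη]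
    rfl
  · ext t
    rw [hη, hp, hee, ContinuousMap.one_apply]
  · ext t
    rw [hη, towerGen, map_mul, mul_apply_eq_comp, hp, add_zero, heq, inner_smul_right, hee,
      mul_one]
    rfl
  · ext t
    rw [hη, towerGen, map_mul, mul_apply_eq_comp, hp, (hgt t _ (by omega) (by omega)).1,
      inner_zero_right, ContinuousMap.zero_apply]

end VacuumSymbol

/-! ### Symbols along the tower, and triviality in positive rank -/

section SphereSymbol

variable {n : ℕ} {q : ℝ}

/-- The quotient map onto the functions on the circle, as a continuous linear map. -/
def etaCLM (n : ℕ) (q : ℝ) : SphereAlgebra n q →L[ℂ] C(Circle, ℂ) := repCLM (eta n q)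

theorem etaCLM_apply (x : SphereAlgebra n q) : etaCLM n q x = eta n q x := rfl

theorem isSymbol_eta : IsSymbol (n + 1) 1 (sphereGen n q) (etaCLM n q) where
  map_mul x y _ _ := map_mul (eta n q) x y
  map_star x _ := map_star (eta n q) x
  map_unit := map_one (eta n q)
  map_zero := by
    rw [etaCLM_apply, sphereGen_of_lt n.succ_pos]
    rfl
  map_succ i hi := by
    rw [etaCLM_apply, sphereGen_of_lt hi]
    have h0 : (⟨i + 1, hi⟩ : Fin (n + 1)) ≠ 0 := fun h => Nat.succ_ne_zero i (congrArg Fin.val h)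
    exact if_neg (t := circleId) h0

/-- The shift system with `J` unilateral shifts and no bilateral shift. -/
abbrev vacuumSystem (hq0 : 0 < q) (hq1 : q < 1) {J : ℕ} (hJ : J ≤ n) :
    ShiftSystem n q (Unit × (Fin n → ℕ)) := cubeSystem 1 hq0 hq1 hJ

/-- The family of representations, parametrized by the circle, obtained from `vacuumSystem` by the
gauge action. -/
def vacuumRep (hq0 : 0 < q) (hq1 : q < 1) {J : ℕ} (hJ : J ≤ n) :
    SphereAlgebra n q →⋆ₐ[ℂ]
      C(Circle, L2 (Unit × (Fin n → ℕ)) →L[ℂ] L2 (Unit × (Fin n → ℕ))) :=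
  evalAt ((vacuumSystem hq0 hq1 hJ).realization hq0).gauge

/-- The vacuum vector. -/
def vacuum (n : ℕ) : L2 (Unit × (Fin n → ℕ)) := lp.single 2 ((), 0) 1

theorem norm_vacuum : ‖vacuum n‖ = 1 := by
  rw [vacuum, lp.norm_single (by norm_num)]
  exact norm_one

/-- The representation at a point of the circle. -/
def vacuumRepAt (hq0 : 0 < q) (hq1 : q < 1) {J : ℕ} (hJ : J ≤ n) (t : Circle) :
    SphereAlgebra n q →⋆ₐ[ℂ] (L2 (Unit × (Fin n → ℕ)) →L[ℂ] L2 (Unit × (Fin n → ℕ))) :=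
  (evalCircle t).comp (vacuumRep hq0 hq1 hJ)

theorem vacuumRepAt_gen (hq0 : 0 < q) (hq1 : q < 1) {J : ℕ} (hJ : J ≤ n) {i : ℕ}
    (hi : i < n + 1) (t : Circle) :
    vacuumRepAt hq0 hq1 hJ t (sphereGen n q i) = (t : ℂ) • (vacuumSystem hq0 hq1 hJ).op i := by
  rw [sphereGen_of_lt hi]
  rfl

theorem cubeWeight_zero (J i : ℕ) :
    cubeWeight q J i (0 : Fin n → ℕ) = if i ≤ J then 1 else 0 := by
  simp [cubeWeight]

/-- At the origin `C i` drops from one to zero exactly between `J` and `J + 1`. Hence the adjoints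
of all other generators kill the vacuum. -/
theorem vacuumSystem_b (hq0 : 0 < q) (hq1 : q < 1) {J : ℕ} (hJ : J ≤ n) (i : ℕ) :
    (vacuumSystem hq0 hq1 hJ).b i ((), 0) = if i = J then 1 else 0 := by
  change √(cubeWeight q J i 0 - cubeWeight q J (i + 1) 0) = _
  rw [cubeWeight_zero, cubeWeight_zero]
  rcases lt_trichotomy i J with h | h | h
  · rw [if_pos h.le, if_pos (by omega), if_neg h.ne, sub_self, Real.sqrt_zero]
  · rw [if_pos h.le, if_neg (by omega), if_pos h, sub_zero, Real.sqrt_one]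
  · rw [if_neg (by omega), if_neg (by omega), if_neg (by omega), sub_zero, Real.sqrt_zero]

theorem bump_of_le {J i : ℕ} (h : J ≤ i) : bump n J i = 0 :=
  funext fun _ => if_neg (by omega)

theorem vacuumSystem_φ (hq0 : 0 < q) (hq1 : q < 1) {J : ℕ} (hJ : J ≤ n) {i : ℕ} (hi : J ≤ i) :
    (vacuumSystem hq0 hq1 hJ).φ i ((), 0) = ((), 0) := by
  change (_, (0 : Fin n → ℕ) + bump n J i) = _
  rw [bump_of_le hi]
  rfl

theorem vacuumSystem_ψ (hq0 : 0 < q) (hq1 : q < 1) {J : ℕ} (hJ : J ≤ n) {i : ℕ} (hi : J ≤ i) :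
    (vacuumSystem hq0 hq1 hJ).ψ i ((), 0) = ((), 0) := by
  change (_, (0 : Fin n → ℕ) - bump n J i) = _
  rw [bump_of_le hi]
  rfl

theorem vacuumRepAt_gen_vacuum (hq0 : 0 < q) (hq1 : q < 1) {J : ℕ} (hJ : J ≤ n) {i : ℕ}
    (hi : J ≤ i) (hin : i < n + 1) (t : Circle) :
    vacuumRepAt hq0 hq1 hJ t (sphereGen n q i) (vacuum n) =
      if i = J then (t : ℂ) • vacuum n else 0 := by
  rw [vacuumRepAt_gen hq0 hq1 hJ hin, smul_apply, vacuum, ShiftSystem.op_single,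
    vacuumSystem_φ hq0 hq1 hJ hi, vacuumSystem_b]
  split_ifs <;> simp

theorem vacuumRepAt_star_gen_vacuum (hq0 : 0 < q) (hq1 : q < 1) {J : ℕ} (hJ : J ≤ n) {i : ℕ}
    (hin : i < n + 1) (t : Circle) :
    vacuumRepAt hq0 hq1 hJ t (star (sphereGen n q i)) (vacuum n) =
      if i = J then star (t : ℂ) • vacuum n else 0 := by
  rw [map_star, vacuumRepAt_gen hq0 hq1 hJ hin, star_smul, smul_apply, vacuum,
    ShiftSystem.star_op_single, vacuumSystem_b]
  split_ifs with h
  · rw [vacuumSystem_ψ hq0 hq1 hJ h.ge]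
    simp
  · simp

/-- The vacuum expectation, as a function on the circle. -/
def vacuumSymbol (hq0 : 0 < q) (hq1 : q < 1) {J : ℕ} (hJ : J ≤ n) :
    SphereAlgebra n q →L[ℂ] C(Circle, ℂ) :=
  expectation (vacuumRep hq0 hq1 hJ) (vacuum n)

theorem vacuumSymbol_apply (hq0 : 0 < q) (hq1 : q < 1) {J : ℕ} (hJ : J ≤ n)
    (x : SphereAlgebra n q) (t : Circle) : vacuumSymbol hq0 hq1 hJ x t =
      inner ℂ (vacuum n) (vacuumRepAt hq0 hq1 hJ t x (vacuum n)) := rfl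

theorem isSymbol_vacuumSymbol (hq0 : 0 < q) (hq1 : q < 1) {J m : ℕ} (hJ : J ≤ n)
    (hm : J + (m + 1) = n + 1) :
    IsSymbol (m + 1) (towerProj (sphereGen n q) J) (towerGen (sphereGen n q) J)
      (vacuumSymbol hq0 hq1 hJ) := by
  refine isSymbol_of_vacuum hq0 hq1 sphereGen_relations sphereGen_generates hm norm_vacuum
    (vacuumSymbol_apply hq0 hq1 hJ) (fun t l hl => ?_) (fun t => ?_) (fun t => ?_)
    fun t l hl hl' => ⟨?_, ?_⟩
  · rw [vacuumRepAt_star_gen_vacuum hq0 hq1 hJ (by omega), if_neg hl.ne]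
  · rw [vacuumRepAt_gen_vacuum hq0 hq1 hJ le_rfl (by omega), if_pos rfl]
  · rw [vacuumRepAt_star_gen_vacuum hq0 hq1 hJ (by omega), if_pos rfl]
  · rw [vacuumRepAt_gen_vacuum hq0 hq1 hJ hl.le hl', if_neg hl.ne']
  · rw [vacuumRepAt_star_gen_vacuum hq0 hq1 hJ hl', if_neg hl.ne']

theorem absorbing_sphere (hq0 : 0 < q) (hq1 : q < 1) {J : ℕ} (hJ : J ≤ n + 1) :
    Absorbing (towerProj (sphereGen n q) J) :=
  absorbing_towerProj hq0 hq1 sphereGen_relations sphereGen_generates (Nat.add_sub_of_le hJ)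
    fun _ _ _ h => ⟨_, isSymbol_vacuumSymbol hq0 hq1 (by omega) h⟩

/-- Idempotents of positive rank are trivial. -/
theorem idemEquiv_one_of_rank_pos (hq0 : 0 < q) (hq1 : q < 1) {a : ℕ}
    {P : Matrix (Fin a) (Fin a) (SphereAlgebra n q)} (hP : IsIdempotentElem P)
    (hr : 0 < rank P) :
    IdemEquiv P (1 : Matrix (Fin (rank P)) (Fin (rank P)) (SphereAlgebra n q)) := by
  have hc : MatCorner 1 P := fun i j => ⟨one_mul _, mul_one _⟩
  obtain ⟨X, Y, hYX, hXY⟩ := exists_trivialization (isSymbol_eta.isIdempotentElem hP hc)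
  -- At the bottom of the tower the symbol is `η` itself, so the multiplicity given by the
  -- trivialization is the rank by definition; absorption is needed only one step up.
  have habs := absorbing_sphere (n := n) hq0 hq1 (J := 1) (by omega)
  have e : towerProj (sphereGen n q) 1 = nextProj 1 (sphereGen n q 0) := by
    rw [towerProj, towerProj, mul_one]
  rw [e] at habs
  have := sphereGen_relations.idemEquiv_of_symbol hq0 hq1 isSymbol_eta sphereGen_generates habs hP
    hc hr hYX hXY
  rwa [constDiag, Matrix.diagonal_one] at this

end SphereSymbol

theorem pow_mul_pow_mul_compl {A : Type*} [Ring A] {p v w : A} (hp : IsIdempotentElem p)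
    (hv : InCorner p v) (hw : InCorner p w) (hwv : w * v = p) (l i : ℕ) :
    w ^ (i + 1 + l) * (v ^ l * (p - v * w)) = 0 := by
  have hwp : w * (p - v * w) = 0 := by rw [mul_sub, hw.2, ← mul_assoc, hwv, hw.1, sub_self]
  have hpp : p * (p - v * w) = p - v * w := by rw [mul_sub, hp.eq, ← mul_assoc, hv.1]
  have h1 := pow_mul_pow_eq hp hv hwv l 0
  rw [add_zero, pow_zero, mul_one, hp.eq] at h1
  rw [← hpp, ← mul_assoc (v ^ l), pow_add, mul_assoc, ← mul_assoc (w ^ l), h1, hpp, pow_succ,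
    mul_assoc, hwp, mul_zero]

theorem ShiftSystem.op_mul_star_single {n : ℕ} {q : ℝ} {S : Type} [DecidableEq S]
    (D : ShiftSystem n q S) (i : ℕ) (u : S) :
    (D.op i * star (D.op i)) (lp.single 2 u 1) =
      ((D.C i u - D.C (i + 1) u : ℝ) : ℂ) • lp.single 2 u (1 : ℂ) := by
  ext s
  rw [op_mul_star_apply, lp.coeFn_smul, Pi.smul_apply, smul_eq_mul]
  simp only [lp.single_apply, Pi.single_apply]
  split_ifs with h
  · rw [h]
  · simp

/-! ### The basic projections -/

section BasicProj

variable {n : ℕ} {q : ℝ}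

/-- The first `J` entries of a multi-index vanish. -/
def VanishesBelow (J : ℕ) (w : Fin n → ℕ) : Prop := ∀ s : Fin n, s.1 < J → w s = 0

theorem VanishesBelow.sub_bump {J i : ℕ} {w : Fin n → ℕ} (h : J ≤ i) :
    VanishesBelow J (w - bump n n i) ↔ VanishesBelow J w := by
  refine forall_congr' fun s => forall_congr' fun hs => ?_
  rw [Pi.sub_apply, bump, if_neg (by omega), tsub_zero]

theorem VanishesBelow.cubeWeight {J : ℕ} {w : Fin n → ℕ} (h : VanishesBelow J w) (hJ : J ≤ n) :
    cubeWeight q n J w = 1 := by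
  rw [QSphere.cubeWeight, if_pos hJ]
  refine Finset.prod_eq_one fun s _ => ?_
  split_ifs with hs
  · rw [h s hs, pow_zero]
  · rfl

theorem vanishesBelow_succ {J : ℕ} (hJ : J < n) {w : Fin n → ℕ} :
    VanishesBelow (J + 1) w ↔ VanishesBelow J w ∧ w ⟨J, hJ⟩ = 0 := by
  constructor
  · exact fun h => ⟨fun s hs => h s (by omega), h ⟨J, hJ⟩ (Nat.lt_succ_self J)⟩
  · rintro ⟨h, h0⟩ s hs
    rcases Nat.lt_succ_iff_lt_or_eq.1 hs with h' | h'
    · exact h s h'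
    · rwa [show s = ⟨J, hJ⟩ from Fin.ext h']

/-! ### The tower in the standard representation -/

section StandardAction

variable (hq0 : 0 < q) (hq1 : q < 1)
include hq0 hq1

theorem standardRep_sphereGen {i : ℕ} (hi : i < n + 1) :
    standardRep n hq0 hq1 (sphereGen n q i) = (standardSystem n hq0 hq1).op i := by
  rw [sphereGen_of_lt hi]
  rfl

theorem sphere_tower {J m : ℕ} (hJ : J + m = n + 1) :
    CornerRelations q m (towerProj (sphereGen n q) J) (towerGen (sphereGen n q) J) :=
  (tower_relations hq0 hq1 sphereGen_relations sphereGen_generates hJ).1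

theorem isStarProjection_towerProj {J : ℕ} (hJ : J ≤ n + 1) :
    IsStarProjection (towerProj (sphereGen n q) J) :=
  (sphere_tower hq0 hq1 (Nat.add_sub_of_le hJ)).proj

-- The defect is diagonal, with eigenvalue `q^(2 w_J)` on the range of the present projection. This
-- equals one only for `w_J = 0`, so the limit of its powers imposes one more vanishing entry.
open Classical in
theorem standardRep_defect_apply {J : ℕ} (hJ : J < n)
    (ih : ∀ m w, standardRep n hq0 hq1 (towerProj (sphereGen n q) J) (basisVec m w) =
      if VanishesBelow J w then basisVec m w else 0) (m : ℤ) (w : Fin n → ℕ) :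
    standardRep n hq0 hq1 (defect (towerProj (sphereGen n q) J) (towerGen (sphereGen n q) J 0))
      (basisVec m w) =
      ((if VanishesBelow J w then (q ^ 2) ^ w ⟨J, hJ⟩ else 0 : ℝ) : ℂ) • basisVec m w := by
  have hp := isStarProjection_towerProj (n := n) hq0 hq1 (J := J) (by omega)
  set D := standardSystem n hq0 hq1 with hD
  have hψ : star (D.op J) (basisVec m w) =
      (D.b J (m, w) : ℂ) • basisVec (m - 1) (w - bump n n J) := by
    rw [basisVec, D.star_op_single]
    rfl
  have e : towerGen (sphereGen n q) J 0 * star (towerGen (sphereGen n q) J 0) =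
      sphereGen n q J * (towerProj (sphereGen n q) J * star (sphereGen n q J)) := by
    rw [towerGen, star_mul, hp.isSelfAdjoint.star_eq, mul_assoc, ← mul_assoc (towerProj _ _),
      hp.isIdempotentElem.eq, add_zero]
  rw [defect, e, map_sub, sub_apply, map_mul, map_mul, map_star, mul_apply_eq_comp,
    mul_apply_eq_comp, standardRep_sphereGen hq0 hq1 (by omega), ← hD, hψ, map_smul, ih, ih,
    VanishesBelow.sub_bump le_rfl]
  split_ifs with h
  · rw [← hψ, ← mul_apply_eq_comp, basisVec, D.op_mul_star_single]
    have h1 : D.C J (m, w) = 1 := h.cubeWeight hJ.le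
    have h2 : D.C (J + 1) (m, w) = (q ^ 2) ^ w ⟨J, hJ⟩ := by
      change cubeWeight q n (J + 1) w = _
      rw [cubeWeight_succ hJ hJ, h.cubeWeight hJ.le, one_mul]
    rw [h1, h2]
    push_cast
    rw [sub_smul, one_smul, sub_sub_cancel]
  · simp

open Classical in
theorem standardRep_towerProj_apply {J : ℕ} (hJ : J ≤ n) (m : ℤ) (w : Fin n → ℕ) :
    standardRep n hq0 hq1 (towerProj (sphereGen n q) J) (basisVec m w) =
      if VanishesBelow J w then basisVec m w else 0 := by
  induction J generalizing m w with
  | zero =>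
    have h0 : VanishesBelow 0 w := fun s hs => absurd hs (by omega)
    rw [if_pos h0, towerProj, map_one]
    rfl
  | succ J ih =>
    have hq2 : q ^ 2 < 1 := pow_lt_one₀ hq0.le hq1 two_ne_zero
    obtain ⟨l, hl⟩ : ∃ l, J + (l + 1) = n + 1 := ⟨n - J, by omega⟩
    have hd := standardRep_defect_apply hq0 hq1 hJ (ih (by omega)) m w
    rw [towerProj_succ, rep_nextProj_apply _ hq0 hq1 (sphere_tower hq0 hq1 hl) ?_ ?_ hd]
    · congr 1
      rw [vanishesBelow_succ hJ, eq_iff_iff]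
      split_ifs with h
      · refine ⟨fun h1 => ⟨h, by_contra fun h0 => ?_⟩, fun h1 => by rw [h1.2, pow_zero]⟩
        exact (pow_lt_one₀ (by positivity) hq2 h0).ne h1
      · simp [h]
    · split_ifs <;> positivity
    · split_ifs
      · exact pow_le_one₀ (by positivity) hq2.le
      · exact zero_le_one

/-- Only nonvanishing of the coefficient matters for identifying ranges, so its value is left open.
-/
theorem standardRep_towerIso_apply {J : ℕ} (hJ : J < n) (m : ℤ) {w : Fin n → ℕ}
    (hw : VanishesBelow J w) :
    ∃ a : ℂ, a ≠ 0 ∧ standardRep n hq0 hq1 (towerIso q (sphereGen n q) J) (basisVec m w) =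
      a • basisVec (m + 1) (w + Pi.single ⟨J, hJ⟩ 1) := by
  classical
  have hq2 : q ^ 2 < 1 := pow_lt_one₀ hq0.le hq1 two_ne_zero
  obtain ⟨l, hl⟩ : ∃ l, J + (l + 1) = n + 1 := ⟨n - J, by omega⟩
  have hr := sphere_tower hq0 hq1 hl
  have hd := standardRep_defect_apply hq0 hq1 hJ (standardRep_towerProj_apply hq0 hq1 hJ.le) m w
  rw [if_pos hw] at hd
  obtain ⟨ν, hν, e⟩ := rep_invSqrt_apply _ hq0 hq1 hr.isSelfAdjoint_defect hr.norm_defect_le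
    (pow_le_one₀ (by positivity) hq2.le) hd
  obtain ⟨b, hb, hgen⟩ : ∃ b : ℂ, b ≠ 0 ∧
      standardRep n hq0 hq1 (sphereGen n q (J + 0)) (basisVec m w) =
        b • basisVec (m + 1) (w + Pi.single (⟨J, hJ⟩ : Fin n) 1) := by
    have hgen := (isStandardRep_standardRep (n := n) hq0 hq1).gen_castSucc ⟨J, hJ⟩ m w
    rw [← sphereGen_val] at hgen
    refine ⟨_, Complex.ofReal_ne_zero.2 ?_, hgen⟩
    refine (mul_pos (Finset.prod_pos fun s _ => by positivity) (Real.sqrt_pos.2 ?_)).ne'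
    have : q ^ (2 * (w ⟨J, hJ⟩ + 1)) < 1 := pow_lt_one₀ hq0.le hq1 (by omega)
    linarith
  refine ⟨ν * b, mul_ne_zero hν hb, ?_⟩
  rw [towerIso, isoPart, map_mul, mul_apply_eq_comp, e, map_smul, towerGen, map_mul,
    mul_apply_eq_comp, standardRep_towerProj_apply hq0 hq1 hJ.le, if_pos hw, mul_smul, hgen]

/-- Used with `k` as in the basic projection, to place basis vectors in the range of the power, and
with the full entry `w_J`, to reach a vector of the next corner. -/
theorem exists_towerIso_pow {J : ℕ} (hJ : J < n) (k : ℕ) (m : ℤ) {w : Fin n → ℕ}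
    (hw : VanishesBelow J w) (hk : k ≤ w ⟨J, hJ⟩) :
    ∃ (a : ℂ) (m' : ℤ) (u : Fin n → ℕ), VanishesBelow J u ∧ u ⟨J, hJ⟩ = w ⟨J, hJ⟩ - k ∧
      basisVec m w =
        a • standardRep n hq0 hq1 (towerIso q (sphereGen n q) J ^ k) (basisVec m' u) := by
  induction k with
  | zero => exact ⟨1, m, w, hw, rfl, by simp⟩
  | succ k ih =>
    obtain ⟨a, m', u, hu, hu', e⟩ := ih (by omega)
    have hu1 : VanishesBelow J (u - Pi.single ⟨J, hJ⟩ 1) := fun s hs => by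
      rw [Pi.sub_apply, hu s hs, zero_tsub]
    obtain ⟨b, hb, eb⟩ := standardRep_towerIso_apply hq0 hq1 hJ (m' - 1) hu1
    have hadd : u - Pi.single ⟨J, hJ⟩ 1 + Pi.single ⟨J, hJ⟩ 1 = u := by
      funext s
      by_cases hs : s = ⟨J, hJ⟩
      · subst hs
        simp only [Pi.add_apply, Pi.sub_apply, Pi.single_eq_same]
        omega
      · simp [Pi.single_eq_of_ne hs]
    rw [hadd, sub_add_cancel] at eb
    refine ⟨a * b⁻¹, m' - 1, _, hu1, ?_, ?_⟩
    · rw [Pi.sub_apply, Pi.single_eq_same]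
      omega
    · rw [pow_succ, map_mul, mul_apply_eq_comp, eb, map_smul, smul_smul, mul_assoc,
        inv_mul_cancel₀ hb, mul_one, e]

theorem towerIso_mem {J : ℕ} (hJ : J < n) :
    InCorner (towerProj (sphereGen n q) J) (towerIso q (sphereGen n q) J) ∧
      InCorner (towerProj (sphereGen n q) J) (star (towerIso q (sphereGen n q) J)) ∧
      star (towerIso q (sphereGen n q) J) * towerIso q (sphereGen n q) J =
        towerProj (sphereGen n q) J ∧
      towerProj (sphereGen n q) (J + 1) = towerProj (sphereGen n q) J -
        towerIso q (sphereGen n q) J * star (towerIso q (sphereGen n q) J) := by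
  obtain ⟨l, hl⟩ : ∃ l, J + (l + 1) = n + 1 := ⟨n - J, by omega⟩
  have hr := sphere_tower hq0 hq1 hl
  exact ⟨hr.isoPart_mem, hr.isoPart_mem.star hr.proj, hr.star_isoPart_mul_isoPart hq0 hq1,
    hr.nextProj_eq hq0 hq1⟩

end StandardAction

variable (n q) in
/-- The basic projections. -/
def basicProj (j k : ℕ) : SphereAlgebra n q :=
  towerProj (sphereGen n q) (j - 1) - towerIso q (sphereGen n q) (j - 1) ^ k *
    star (towerIso q (sphereGen n q) (j - 1)) ^ k

/-! ### Properties of the basic projections -/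

section Properties

variable (hq0 : 0 < q) (hq1 : q < 1)
include hq0 hq1

theorem isStarProjection_basicProj {j k : ℕ} (hj : 1 ≤ j) (hjn : j ≤ n) (hk : 0 < k) :
    IsStarProjection (basicProj n q j k) := by
  obtain ⟨J, rfl⟩ : ∃ J, j = J + 1 := ⟨j - 1, by omega⟩
  obtain ⟨k, rfl⟩ : ∃ l, k = l + 1 := ⟨k - 1, by omega⟩
  obtain ⟨hv, hw, hwv, -⟩ := towerIso_mem hq0 hq1 (n := n) hjn
  have hp := isStarProjection_towerProj (n := n) hq0 hq1 (J := J) (by omega)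
  rw [basicProj, Nat.add_sub_cancel]
  set v := towerIso q (sphereGen n q) J
  set p := towerProj (sphereGen n q) J
  have h1 := pow_mul_pow_eq hp.isIdempotentElem hv hwv (k + 1) 0
  rw [add_zero, pow_zero, mul_one, hp.isIdempotentElem.eq, pow_succ v, mul_assoc (v ^ k), hv.2,
    ← pow_succ] at h1
  have hpv : p * v ^ (k + 1) = v ^ (k + 1) := by rw [pow_succ', ← mul_assoc, hv.1]
  have hwp : star v ^ (k + 1) * p = star v ^ (k + 1) := by rw [pow_succ, mul_assoc, hw.2]
  refine ⟨?_, ?_⟩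
  · have hf : v ^ (k + 1) * star v ^ (k + 1) * (v ^ (k + 1) * star v ^ (k + 1)) =
        v ^ (k + 1) * star v ^ (k + 1) := by
      rw [mul_assoc, ← mul_assoc (star v ^ (k + 1)), h1, pow_succ' (star v), ← mul_assoc p, hw.1]
    change _ * _ = _
    rw [sub_mul, mul_sub, mul_sub, hp.isIdempotentElem.eq, hf, ← mul_assoc p, hpv, mul_assoc, hwp]
    abel
  · change star _ = _
    rw [star_sub, hp.isSelfAdjoint.star_eq, star_mul, star_pow, star_pow, star_star]

/-- With `J = j - 1`, basis vectors outside the corner are killed by the factor `p`. Inside it,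
those with `w_J ≥ k` lie in the range of `v^k` and are killed; those with `w_J < k` come from the
complement `p - v v*` by fewer than `k` applications of `v`, so `v*^k` annihilates them. -/
theorem isBasicOperator_basicProj {j k : ℕ} (hj : 1 ≤ j) (hjn : j ≤ n) (hk : 0 < k) :
    IsBasicOperator j k (standardRep n hq0 hq1 (basicProj n q j k)) := by
  classical
  intro m w
  obtain ⟨J, rfl⟩ : ∃ J, j = J + 1 := ⟨j - 1, by omega⟩
  obtain ⟨hv, hw, hwv, hnext⟩ := towerIso_mem hq0 hq1 (n := n) hjn
  have hp := (isStarProjection_towerProj (n := n) hq0 hq1 (J := J) (by omega)).isIdempotentElem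
  have hpe := standardRep_towerProj_apply hq0 hq1 (n := n) (J := J) (by omega)
  have hcond : (∀ s : Fin n, (s.1 + 1 < J + 1 → w s < 1) ∧ (s.1 + 1 = J + 1 → w s < k)) ↔
      VanishesBelow J w ∧ w ⟨J, hjn⟩ < k := by
    constructor
    · exact fun h => ⟨fun s hs => by have := (h s).1 (by omega); omega, (h ⟨J, hjn⟩).2 rfl⟩
    · rintro ⟨h, h'⟩ s
      refine ⟨fun hs => by rw [h s (by omega)]; exact one_pos, fun hs => ?_⟩
      rwa [show s = ⟨J, hjn⟩ from Fin.ext (Nat.succ.inj hs)]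
  simp only [hcond]
  rw [basicProj, Nat.add_sub_cancel]
  set v := towerIso q (sphereGen n q) J
  set p := towerProj (sphereGen n q) J
  set π := standardRep n hq0 hq1
  by_cases hvan : VanishesBelow J w
  · by_cases hwk : w ⟨J, hjn⟩ < k
    · rw [if_pos ⟨hvan, hwk⟩]
      obtain ⟨a, m', u, hu, hu', e⟩ := exists_towerIso_pow hq0 hq1 hjn _ m hvan le_rfl
      rw [Nat.sub_self] at hu'
      have hu1 : VanishesBelow (J + 1) u := (vanishesBelow_succ hjn).2 ⟨hu, hu'⟩
      have hpu := standardRep_towerProj_apply hq0 hq1 (n := n) hjn m' u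
      rw [if_pos hu1, hnext] at hpu
      have hz : π (star v ^ k) (basisVec m w) = 0 := by
        obtain ⟨i, hi⟩ := Nat.exists_eq_add_of_lt hwk
        rw [e, map_smul, ← hpu, ← mul_apply_eq_comp, ← mul_apply_eq_comp, ← map_mul, ← map_mul,
          mul_assoc, show k = i + 1 + w ⟨J, hjn⟩ by omega,
          pow_mul_pow_mul_compl hp hv hw hwv]
        simp
      rw [map_sub, sub_apply, map_mul, mul_apply_eq_comp, hz, map_zero, sub_zero, hpe,
        if_pos hvan]
    · rw [if_neg (by tauto)]
      obtain ⟨a, m', u, hu, -, e⟩ := exists_towerIso_pow hq0 hq1 hjn k m hvan (by omega)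
      change basisVec m w = a • π (v ^ k) (basisVec m' u) at e
      have hz : (p - v ^ k * star v ^ k) * v ^ k * p = 0 := by
        have h1 := pow_mul_pow_eq hp hv hwv k 0
        rw [add_zero, pow_zero, mul_one, hp.eq] at h1
        rw [mul_assoc, sub_mul, mul_assoc (v ^ k), h1, sub_eq_zero, ← mul_assoc]
        obtain ⟨k, rfl⟩ : ∃ l, k = l + 1 := ⟨k - 1, by omega⟩
        rw [pow_succ', ← mul_assoc p, hv.1]
      have hpu := hpe m' u
      rw [if_pos hu] at hpu
      rw [e, ← hpu, map_smul, ← mul_apply_eq_comp, ← mul_apply_eq_comp, ← map_mul, ← map_mul,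
        hz]
      simp
  · rw [if_neg (by tauto)]
    have hpw := hpe m w
    rw [if_neg hvan] at hpw
    have hfac : p - v ^ k * star v ^ k = (p - v ^ k * star v ^ k) * p := by
      obtain ⟨k, rfl⟩ : ∃ l, k = l + 1 := ⟨k - 1, by omega⟩
      rw [sub_mul, hp.eq, pow_succ (star v), mul_assoc, mul_assoc, hw.2]
    rw [hfac, map_mul, mul_apply_eq_comp, hpw, map_zero]

theorem one_absorbs_basicProj {j k : ℕ} (hj : 1 ≤ j) (hjn : j ≤ n) (hk : 0 < k) :
    Absorbs (1 : SphereAlgebra n q) (basicProj n q j k) := by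
  have hbp := (isStarProjection_basicProj hq0 hq1 hj hjn hk).isIdempotentElem
  obtain ⟨J, rfl⟩ : ∃ J, j = J + 1 := ⟨j - 1, by omega⟩
  obtain ⟨hv, hw, hwv, -⟩ := towerIso_mem hq0 hq1 (n := n) hjn
  have hp := (isStarProjection_towerProj (n := n) hq0 hq1 (J := J) (by omega)).isIdempotentElem
  have h1 : Absorbs (towerProj (sphereGen n q) J) (basicProj n q (J + 1) k) :=
    absorbs_sub_pow hp hv hw hwv hk
  cases J with
  | zero => exact h1
  | succ J =>
    have h2 := towerProj_absorbs hq0 hq1 sphereGen_relations (sphereGen_generates (n := n))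
      (J := 0) (l := J) (by omega)
    rw [zero_add] at h2
    exact h2.trans h1 IsIdempotentElem.one hp hbp

theorem idemEquiv_basicProj {j k : ℕ} (hj : 1 ≤ j) (hjn : j ≤ n) (hk : 0 < k) :
    IdemEquiv (constDiag Unit (basicProj n q j k))
      (constDiag (Fin k) (towerProj (sphereGen n q) j)) := by
  obtain ⟨J, rfl⟩ : ∃ J, j = J + 1 := ⟨j - 1, by omega⟩
  obtain ⟨hv, hw, hwv, hnext⟩ := towerIso_mem hq0 hq1 (n := n) hjn
  have hp := (isStarProjection_towerProj (n := n) hq0 hq1 (J := J) (by omega)).isIdempotentElem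
  rw [hnext]
  exact idemEquiv_sub_pow hp hv hw hwv hk

theorem eq_of_idemEquiv_towerProj {j k l : ℕ} (hj : j ≤ n)
    (h : IdemEquiv (constDiag (Fin k) (towerProj (sphereGen n q) j))
      (constDiag (Fin l) (towerProj (sphereGen n q) j))) : k = l := by
  have hη := isSymbol_vacuumSymbol (n := n) hq0 hq1 hj (m := n - j) (by omega)
  exact eq_of_idemEquiv_constDiag (η := (vacuumSymbol hq0 hq1 hj : SphereAlgebra n q →+ C(Circle, ℂ)))
    (isStarProjection_towerProj hq0 hq1 (by omega)).isIdempotentElem ⟨hη.map_mul, hη.map_unit⟩ h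

/-- If `j' < j`, the larger projection swallows one more copy of the smaller one. Transported back
along the equivalence, this identifies `k + 1` copies of the smaller projection with `k` copies,
against uniqueness of multiplicities. -/
theorem eq_of_idemEquiv_towerProj_of_le {j k j' k' : ℕ} (hj : j ≤ n) (hjj : j' ≤ j)
    (hk' : 0 < k') (h : IdemEquiv (constDiag (Fin k) (towerProj (sphereGen n q) j))
      (constDiag (Fin k') (towerProj (sphereGen n q) j'))) : j = j' ∧ k = k' := by
  rcases hjj.eq_or_lt with rfl | hlt
  · exact ⟨rfl, eq_of_idemEquiv_towerProj hq0 hq1 hj h⟩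
  exfalso
  set p := towerProj (sphereGen n q) j
  set p' := towerProj (sphereGen n q) j'
  have hp : IsIdempotentElem p :=
    (isStarProjection_towerProj hq0 hq1 (by omega)).isIdempotentElem
  have hp' : IsIdempotentElem p' :=
    (isStarProjection_towerProj hq0 hq1 (by omega)).isIdempotentElem
  have hab : Absorbs p' p := by
    obtain ⟨l, rfl⟩ := Nat.exists_eq_add_of_lt hlt
    exact towerProj_absorbs hq0 hq1 sphereGen_relations sphereGen_generates (by omega)
  have ik : IsIdempotentElem (constDiag (Fin k) p) := isIdempotentElem_constDiag hp
  have ik1 : IsIdempotentElem (constDiag (Fin (k + 1)) p) := isIdempotentElem_constDiag hp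
  have iu : IsIdempotentElem (constDiag Unit p) := isIdempotentElem_constDiag hp
  have ik' : IsIdempotentElem (constDiag (Fin k') p') := isIdempotentElem_constDiag hp'
  have isum : IsIdempotentElem (constDiag (Fin k ⊕ Unit) p) := isIdempotentElem_constDiag hp
  have e0 : Fin k ⊕ Unit ≃ Fin (k + 1) :=
    (Equiv.sumCongr (Equiv.refl _) finOneEquiv.symm).trans finSumFinEquiv
  have e1 := (IdemEquiv.constDiag_congr hp e0).trans (IdemEquiv.constDiag_sum hp) ik1
    (isIdempotentElem_blockSum ik iu)
  have e2 := e1.trans (h.sum (IdemEquiv.refl iu)) ik1 (isIdempotentElem_blockSum ik' iu)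
  have e3 := e2.trans (idemEquiv_absorb_unit hp' hp hab hk') ik1 ik'
  have e4 := e3.trans h.symm ik1 ik
  have := eq_of_idemEquiv_towerProj hq0 hq1 hj e4
  omega

theorem eq_of_idemEquiv_basicProj {j k j' k' : ℕ} (hj : 1 ≤ j) (hjn : j ≤ n) (hk : 0 < k)
    (hj' : 1 ≤ j') (hjn' : j' ≤ n) (hk' : 0 < k')
    (h : IdemEquiv (constDiag Unit (basicProj n q j k)) (constDiag Unit (basicProj n q j' k'))) :
    j = j' ∧ k = k' := by
  have hi : ∀ {j k : ℕ}, j ≤ n →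
      IsIdempotentElem (constDiag (Fin k) (towerProj (sphereGen n q) j)) := fun hj =>
    isIdempotentElem_constDiag (isStarProjection_towerProj hq0 hq1 (by omega)).isIdempotentElem
  have hb' : IsIdempotentElem (constDiag Unit (basicProj n q j' k')) :=
    isIdempotentElem_constDiag (isStarProjection_basicProj hq0 hq1 hj' hjn' hk').isIdempotentElem
  have e := ((idemEquiv_basicProj hq0 hq1 hj hjn hk).symm.trans h (hi hjn) hb').trans
    (idemEquiv_basicProj hq0 hq1 hj' hjn' hk') (hi hjn) (hi hjn')
  rcases le_total j' j with hle | hle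
  · exact eq_of_idemEquiv_towerProj_of_le hq0 hq1 hjn hle hk' e
  · obtain ⟨h1, h2⟩ := eq_of_idemEquiv_towerProj_of_le hq0 hq1 hjn' hle hk e.symm
    exact ⟨h1.symm, h2.symm⟩

end Properties

end BasicProj

/-! ### Equivalence of projections over the quantum sphere -/

section Equivalence

variable {n : ℕ} {q : ℝ}

theorem singleton_eq_constDiag {A : Type*} [Ring A] (p : A) : !![p] = constDiag (Fin 1) p := by
  ext i j
  rw [Subsingleton.elim i 0, Subsingleton.elim j 0]
  simp

theorem isIdempotentElem_singleton {A : Type*} [Ring A] {p : A} (hp : IsIdempotentElem p) :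
    IsIdempotentElem !![p] := by
  rw [singleton_eq_constDiag]
  exact isIdempotentElem_constDiag hp

theorem isStarProjection_singleton {A : Type*} [CStarAlgebra A] {p : A}
    (hp : IsStarProjection p) : IsStarProjection !![p] := by
  refine ⟨isIdempotentElem_singleton hp.isIdempotentElem, ?_⟩
  ext i j
  rw [Subsingleton.elim i 0, Subsingleton.elim j 0]
  exact hp.isSelfAdjoint

theorem idemEquiv_singleton {A : Type*} [Ring A] {p : A} (hp : IsIdempotentElem p) :
    IdemEquiv !![p] (constDiag Unit p) := by
  rw [singleton_eq_constDiag]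
  exact IdemEquiv.constDiag_congr hp finOneEquiv.symm

variable (hq0 : 0 < q) (hq1 : q < 1)
include hq0 hq1

theorem equivalent_one_of_rank_pos {a : ℕ} {P : Matrix (Fin a) (Fin a) (SphereAlgebra n q)}
    (hP : IsIdempotentElem P) (hr : 0 < rank P) :
    Equivalent P (1 : Matrix (Fin (rank P)) (Fin (rank P)) (SphereAlgebra n q)) :=
  (idemEquiv_one_of_rank_pos hq0 hq1 hP hr).equivalent hP .one

/-- Cancellation happens among the ranks: equal positive ranks make both idempotents equivalent to
the same trivial one. -/
theorem equivalent_of_diagSum {a b c : ℕ} {P : Matrix (Fin a) (Fin a) (SphereAlgebra n q)}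
    {Q : Matrix (Fin b) (Fin b) (SphereAlgebra n q)}
    {R : Matrix (Fin c) (Fin c) (SphereAlgebra n q)} (hP : IsIdempotentElem P)
    (hQ : IsIdempotentElem Q) (hR : IsIdempotentElem R) (hrP : 0 < rank P) (hrQ : 0 < rank Q)
    (h : Equivalent (diagSum P R) (diagSum Q R)) : Equivalent P Q := by
  have hPR := isIdempotentElem_diagSum hP hR
  have hQR := isIdempotentElem_diagSum hQ hR
  have hr := rank_eq_of_idemEquiv hPR hQR (h.idemEquiv hPR hQR)
  rw [rank_diagSum hP hR, rank_diagSum hQ hR, add_left_inj] at hr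
  have e1 := idemEquiv_one_of_rank_pos hq0 hq1 hP hrP
  have e2 := idemEquiv_one_of_rank_pos hq0 hq1 hQ hrQ
  rw [hr] at e1
  exact (e1.trans e2.symm hP hQ).equivalent hP hQ

theorem equivalent_basicProj_diagSum_one {j k : ℕ} (hj : 1 ≤ j) (hjn : j ≤ n) (hk : 0 < k) :
    Equivalent (diagSum !![basicProj n q j k] (1 : Matrix (Fin 1) (Fin 1) (SphereAlgebra n q)))
      (1 : Matrix (Fin 1) (Fin 1) (SphereAlgebra n q)) := by
  have hp := (isStarProjection_basicProj hq0 hq1 hj hjn hk).isIdempotentElem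
  have h1 : IsIdempotentElem (1 : SphereAlgebra n q) := .one
  have i1 : IsIdempotentElem (1 : Matrix (Fin 1) (Fin 1) (SphereAlgebra n q)) := .one
  have ip := isIdempotentElem_singleton hp
  have iu : IsIdempotentElem (constDiag Unit (1 : SphereAlgebra n q)) :=
    isIdempotentElem_constDiag h1
  have iq : IsIdempotentElem (constDiag Unit (basicProj n q j k)) := isIdempotentElem_constDiag hp
  have hone : IdemEquiv (1 : Matrix (Fin 1) (Fin 1) (SphereAlgebra n q)) (constDiag Unit 1) := by
    have := idemEquiv_singleton h1
    rwa [singleton_eq_constDiag, constDiag, Matrix.diagonal_one] at this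
  have isum := isIdempotentElem_diagSum ip i1
  have e1 := (idemEquiv_diagSum ip i1).symm.trans ((idemEquiv_singleton hp).sum hone) isum
    (isIdempotentElem_blockSum iq iu)
  have e2 := e1.trans (IdemEquiv.sum_comm iq iu) isum (isIdempotentElem_blockSum iu iq)
  have e3 := e2.trans (one_absorbs_basicProj hq0 hq1 hj hjn hk) isum iu
  exact (e3.trans hone.symm isum i1).equivalent isum i1

/-- No symbol has to be computed: absorption by the unit forces the rank `r` to satisfy `r + 1 = 1`.
-/
theorem rank_basicProj {j k : ℕ} (hj : 1 ≤ j) (hjn : j ≤ n) (hk : 0 < k) :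
    rank !![basicProj n q j k] = 0 := by
  have hp := isIdempotentElem_singleton
    (isStarProjection_basicProj hq0 hq1 hj hjn hk).isIdempotentElem
  have i1 : IsIdempotentElem (1 : Matrix (Fin 1) (Fin 1) (SphereAlgebra n q)) := .one
  have isum := isIdempotentElem_diagSum hp i1
  have h := rank_eq_of_idemEquiv isum i1
    ((equivalent_basicProj_diagSum_one hq0 hq1 hj hjn hk).idemEquiv isum i1)
  rw [rank_diagSum hp i1, rank_one] at h
  omega

theorem not_equivalent_basicProj {j k j' k' : ℕ} (hj : 1 ≤ j) (hjn : j ≤ n) (hk : 0 < k)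
    (hj' : 1 ≤ j') (hjn' : j' ≤ n) (hk' : 0 < k') (hne : (j, k) ≠ (j', k')) :
    ¬ Equivalent !![basicProj n q j k] !![basicProj n q j' k'] := by
  intro h
  have hp := (isStarProjection_basicProj hq0 hq1 hj hjn hk).isIdempotentElem
  have hp' := (isStarProjection_basicProj hq0 hq1 hj' hjn' hk').isIdempotentElem
  have iu : IsIdempotentElem (constDiag Unit (basicProj n q j k)) := isIdempotentElem_constDiag hp
  have iu' : IsIdempotentElem (constDiag Unit (basicProj n q j' k')) :=
    isIdempotentElem_constDiag hp'
  have is' := isIdempotentElem_singleton hp'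
  have e := ((idemEquiv_singleton hp).symm.trans
    (h.idemEquiv (isIdempotentElem_singleton hp) is') iu is').trans (idemEquiv_singleton hp') iu iu'
  obtain ⟨h1, h2⟩ := eq_of_idemEquiv_basicProj hq0 hq1 hj hjn hk hj' hjn' hk' e
  exact hne (by rw [h1, h2])

end Equivalence

end QSphere

end

theorem corollary1 (n : ℕ) (q : ℝ) (hq0 : 0 < q) (hq1 : q < 1) :
    -- every projection of strictly positive rank is trivial
    (∀ (a : ℕ) (P : Matrix (Fin a) (Fin a) (SphereAlgebra n q)),
      IsStarProjection P → 0 < rank P →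
        Equivalent P (1 : Matrix (Fin (rank P)) (Fin (rank P)) (SphereAlgebra n q))) ∧
    -- cancellation holds in positive rank
    (∀ (a b c : ℕ) (P : Matrix (Fin a) (Fin a) (SphereAlgebra n q))
      (Q : Matrix (Fin b) (Fin b) (SphereAlgebra n q))
      (R : Matrix (Fin c) (Fin c) (SphereAlgebra n q)),
      IsStarProjection P → IsStarProjection Q → IsStarProjection R →
        0 < rank P → 0 < rank Q → Equivalent (P ⊞ R) (Q ⊞ R) → Equivalent P Q) ∧
    -- cancellation fails in rank zero if `n > 0`
    (0 < n → ∃ (a b c : ℕ) (P : Matrix (Fin a) (Fin a) (SphereAlgebra n q))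
      (Q : Matrix (Fin b) (Fin b) (SphereAlgebra n q))
      (R : Matrix (Fin c) (Fin c) (SphereAlgebra n q)),
      IsStarProjection P ∧ IsStarProjection Q ∧ IsStarProjection R ∧
        rank P = 0 ∧ rank Q = 0 ∧ Equivalent (P ⊞ R) (Q ⊞ R) ∧ ¬ Equivalent P Q) ∧
    -- the basic projections `p j k` (`1 ≤ j ≤ n`, `k > 0`), given in the standard representation,
    -- are pairwise inequivalent rank zero projections absorbed by the unit
    (∃ π : SphereAlgebra n q →⋆ₐ[ℂ] (Hilb n →L[ℂ] Hilb n), IsStandardRep π ∧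
      ∃ p : ℕ → ℕ → SphereAlgebra n q,
        (∀ j k, 1 ≤ j → j ≤ n → 0 < k →
          IsStarProjection (p j k) ∧ IsBasicOperator j k (π (p j k)) ∧ rank !![p j k] = 0 ∧
            Equivalent (!![p j k] ⊞ (1 : Matrix (Fin 1) (Fin 1) (SphereAlgebra n q)))
              (1 : Matrix (Fin 1) (Fin 1) (SphereAlgebra n q))) ∧
        (∀ j k j' k', 1 ≤ j → j ≤ n → 0 < k → 1 ≤ j' → j' ≤ n → 0 < k' → (j, k) ≠ (j', k') →
          ¬ Equivalent !![p j k] !![p j' k'])) := by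
  refine ⟨fun a P hP hr => equivalent_one_of_rank_pos hq0 hq1 hP.isIdempotentElem hr,
    fun a b c P Q R hP hQ hR hrP hrQ h => equivalent_of_diagSum hq0 hq1 hP.isIdempotentElem
      hQ.isIdempotentElem hR.isIdempotentElem hrP hrQ h, fun hn => ?_,
    standardRep n hq0 hq1, isStandardRep_standardRep hq0 hq1, basicProj n q,
    fun j k hj hjn hk => ⟨isStarProjection_basicProj hq0 hq1 hj hjn hk,
      isBasicOperator_basicProj hq0 hq1 hj hjn hk, rank_basicProj hq0 hq1 hj hjn hk,
      equivalent_basicProj_diagSum_one hq0 hq1 hj hjn hk⟩,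
    fun j k j' k' hj hjn hk hj' hjn' hk' hne =>
      not_equivalent_basicProj hq0 hq1 hj hjn hk hj' hjn' hk' hne⟩
  have h1 := isStarProjection_basicProj hq0 hq1 le_rfl hn one_pos
  have h2 := isStarProjection_basicProj hq0 hq1 le_rfl hn two_pos
  have i1 := isIdempotentElem_singleton h1.isIdempotentElem
  have i2 := isIdempotentElem_singleton h2.isIdempotentElem
  -- Two inequivalent basic projections, both swallowed by the unit; `n > 0` makes `j = 1`
  -- admissible.
  refine ⟨1, 1, 1, !![basicProj n q 1 1], !![basicProj n q 1 2], 1,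
    isStarProjection_singleton h1, isStarProjection_singleton h2, .one _,
    rank_basicProj hq0 hq1 le_rfl hn one_pos, rank_basicProj hq0 hq1 le_rfl hn two_pos, ?_,
    not_equivalent_basicProj hq0 hq1 le_rfl hn one_pos le_rfl hn two_pos (by simp)⟩
  have e1 := equivalent_basicProj_diagSum_one hq0 hq1 le_rfl hn one_pos
  have e2 := equivalent_basicProj_diagSum_one hq0 hq1 le_rfl hn two_pos
  have j1 := isIdempotentElem_diagSum i1 (.one : IsIdempotentElem (1 : Matrix (Fin 1) (Fin 1) _))
  have j2 := isIdempotentElem_diagSum i2 (.one : IsIdempotentElem (1 : Matrix (Fin 1) (Fin 1) _))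
  exact ((e1.idemEquiv j1 .one).trans (e2.idemEquiv j2 .one).symm j1 j2).equivalent j1 j2
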